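/- Let $(S,o)$ be a germ of smooth complex surface, let $L$ be a smooth branch on it and let $C$ be a reduced plane curve singularity on $(S,o)$ which does not contain $L$. Choose local coordinates $(x,y)$ with $L=Z(x)$, so that $\widehat{\mathcal O}_{S,o}=\mathbb C[[x,y]]$; curves are formal, and a branch is identified with the principal prime ideal which defines it. **The algorithm.** A run of the toroidal pseudo-resolution algorithm on $(L,C)$ is the following. If $(L,C)$ is a cross (a pair of transversal smooth branches), stop. Otherwise choose a smooth branch $L'$, possibly included in $C$, such that $(L,L')$ is a cross, and coordinates $(x',y')$ with $L=Z(x')$, $L'=Z(y')$. The Newton fan of $C$ relative to $(L,L')$ is the subdivision of the cone $\mathbb R_{\ge 0}^2$ by the rays $\mathbb R_{\geq 0}(c,d)$ ($c,d>0$ coprime) orthogonal to the compact edges of the Newton polygon of $C$ in the coordinates $(x',y')$; the slope of such a ray is $d/c$. Perform the associated toric modification of $S$. Each ray $(c,d)$ in the interior of the cone yields an exceptional component; in the chart $x'=u^cv^{\gamma}$, $y'=u^dv^{\delta}$ with $c\delta-d\gamma=1$, it is $Z(u)$, and its orbit is $\{u=0,\ v\neq 0\}$. At each point of these orbits which lies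 on the strict transform of $C$, restart the algorithm, with $L$ replaced by the germ of the exceptional component and $C$ by the germ of the strict transform of $C$. Let $\pi$ be the toroidal pseudo-resolution of $C$ produced by a run, and let $\{(A_i,B_i)\}_{i\in I}$ be the crosses considered in the run, including those at which it stops (then $B_i$ is the germ of the strict transform of $C$). The completion $\widehat C_\pi$ of $C$ relative to $\pi$ is the reduced curve whose branches are $L$, the branches of $C$, and the images on $S$ of the branches $B_i$ which were chosen during the run. **The fan tree** $\theta_\pi(C)$. For each $i\in I$ take a segment $[e_{A_i},e_{B_i}]$ (a trunk), identified with $[0,\infty]$ by its slope function. Its marked points are $e_{A_i}$ (slope $0$), $e_{B_i}$ (slope $\infty$), and the points whose slopes are those of the interior rays of the Newton fan at $(A_i,B_i)$ (there are none if the run stops there). Label $e_{B_i}$ by the image of $B_i$ on $S$, label an interior marked point by the corresponding exceptional component, and label $e_{A_i}$ by $L$ for the first cross and otherwise by the exceptional component of which $A_i$ is a germ. Then $\theta_\pi(C)$ is the topological space obtained from the disjoint union of the trunks by identifying marked points with equal labels. Its vertices are the images of the marked points, and its root is the vertex labeled by $L$. **The Eggers–Wall tree** $\Theta_L(D)$ of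 a reduced curve $D$. For branches $P,Q\ne L$, let $\mathcal Z_x(P)$ be the finite set of Newton–Puiseux roots of $P$ in $\mathbb C[[x^{1/\mathbb N}]]$, let $k_x(P,Q)$ for $P\neq Q$ be the maximal order $\nu_x(\xi-\eta)$ for $\xi\in\mathcal Z_x(P)$, $\eta\in\mathcal Z_x(Q)$, and let the characteristic exponents of $P$ be the numbers $\nu_x(\xi-\xi')$ with $\xi\ne\xi'$ in $\mathcal Z_x(P)$. Take for each branch $P\neq L$ of $D$ a segment identified with $[0,\infty]$ by an exponent function, and, if $L$ is a branch of $D$, one further point of exponent $0$ for $L$. For each pair of distinct branches $P,Q\neq L$ identify the points of equal exponent $t\le k_x(P,Q)$ of their segments; all points of exponent $0$ are identified. The quotient is $\Theta_L(D)$; its root (exponent $0$) is labeled by $L$ and the end of the segment of $P$ (exponent $\infty$) by $P$. Its vertices are the labeled points, the points on the segment of a branch $P$ whose exponent is a characteristic exponent of $P$, and the ramification points (the points at which the segments of two distinct branches separate). **Theorem.** There is a unique isomorphism from the fan tree $\theta_\pi(C)$ to the Eggers–Wall tree $\Theta_L(\widehat C_\pi)$ which preserves the labels by the branches of $\widehat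 C_\pi$ (including $L$, the label of the roots). Here an isomorphism is a bijection between the sets of vertices which is induced by a homeomorphism of the two trees, and it preserves the labels if, for every branch $P$, a vertex of $\theta_\pi(C)$ is labeled by $P$ if and only if its image is labeled by $P$. -/

import Mathlib

open scoped ENNReal

noncomputable section

namespace FanEW

/-! ## Germs of smooth surfaces, branches and crosses -/

/-- The completed local ring `ℂ[[x, y]]` of a germ `(S, o)` of smooth complex surface, read in a
local coordinate system `(x, y)`. -/
abbrev FormalRing : Type := MvPowerSeries (Fin 2) ℂ

/-- The first coordinate. The smooth reference branch is `L = Z(x)`. -/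
def x : FormalRing := MvPowerSeries.X 0

/-- The second coordinate. -/
def y : FormalRing := MvPowerSeries.X 1

/-- The ideal of the smooth reference branch `L = Z(x)`. -/
def idealL : Ideal FormalRing := Ideal.span {x}

/-- The branches of the curve singularity `Z(f)`, each given by its (principal, prime) ideal. -/
def branches (f : FormalRing) : Set (Ideal FormalRing) :=
  {P | ∃ p : FormalRing, Prime p ∧ p ∣ f ∧ P = Ideal.span {p}}

/-- `(Z(a), Z(b))` is a cross, that is, a pair of transversal smooth branches: `a` and `b`
generate the maximal ideal `(x, y)`. -/
def IsCross (a b : FormalRing) : Prop :=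
  Ideal.span {a, b} = Ideal.span {x, y}

/-! ## Newton polygons and Newton fans -/

/-- The Newton polygon of a series: the convex hull of `support + ℕ²`. -/
def newtonPolygon (F : FormalRing) : Set (Fin 2 → ℝ) :=
  convexHull ℝ {p | ∃ m n : Fin 2 →₀ ℕ, MvPowerSeries.coeff m F ≠ 0 ∧
    p = fun i => ((m i : ℝ) + (n i : ℝ))}

/-- The face of the Newton polygon on which the linear form `w = (c, d)` is minimal. -/
def newtonFace (F : FormalRing) (c d : ℕ) : Set (Fin 2 → ℝ) :=
  {p ∈ newtonPolygon F | ∀ q ∈ newtonPolygon F,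
    (c : ℝ) * p 0 + (d : ℝ) * p 1 ≤ (c : ℝ) * q 0 + (d : ℝ) * q 1}

/-- The ray spanned by `(c, d)`, in the interior of the first quadrant, is orthogonal to a compact
edge of the Newton polygon (for `c, d > 0` the face is compact, and it is an edge exactly when it
has more than one point). -/
def IsNewtonRay (F : FormalRing) (c d : ℕ) : Prop :=
  0 < c ∧ 0 < d ∧ (newtonFace F c d).Nontrivial

/-- The slopes `d / c` of the rays of the Newton fan which lie in the interior of the first
quadrant. -/
def newtonSlopes (F : FormalRing) : Set ℝ≥0∞ :=
  {s | ∃ c d : ℕ, IsNewtonRay F c d ∧ s = (d : ℝ≥0∞) / (c : ℝ≥0∞)}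

/-! ## Newton modifications near the points of the strict transform -/

/-- A point of the one-dimensional orbit of the exceptional component attached to the ray spanned
by the primitive vector `(c, d)`. The vector is completed by `(γ, δ)` to a basis of determinant
one (the bound on `γ` only makes this basis unique). In the toric chart
`x = u ^ c * v ^ γ`, `y = u ^ d * v ^ δ`, the exceptional component is `u = 0`, the orbit is
`u = 0`, `v ≠ 0`, and `v` is the value at the point of the coordinate `x ^ (-d) * y ^ c`. -/
structure OrbitPoint where
  c : ℕ
  d : ℕ
  γ : ℕ
  δ : ℕ
  v : ℂ
  d_pos : 0 < d
  γ_lt : γ < c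
  det_eq : c * δ = d * γ + 1
  v_ne : v ≠ 0

namespace OrbitPoint

variable (p : OrbitPoint)

/-- The slope of the ray attached to the exceptional component through the point. -/
def slope : ℝ≥0∞ := (p.d : ℝ≥0∞) / (p.c : ℝ≥0∞)

/-- The two coordinates of the lower surface, in the local coordinates `(u, v - p.v)` centered at
the point (again called `(x, y)`). -/
def chart : Fin 2 → FormalRing :=
  ![x ^ p.c * (MvPowerSeries.C p.v + y) ^ p.γ, x ^ p.d * (MvPowerSeries.C p.v + y) ^ p.δ]

theorem hasSubst_chart : MvPowerSeries.HasSubst p.chart := by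
  apply MvPowerSeries.hasSubst_of_constantCoeff_zero
  have hc : p.c ≠ 0 := by have := p.γ_lt; omega
  have hd : p.d ≠ 0 := p.d_pos.ne'
  intro i
  fin_cases i <;> simp [chart, x, hc, hd]

/-- The morphism of completed local rings induced by the modification at the point. -/
def pullback : FormalRing →ₐ[ℂ] FormalRing :=
  MvPowerSeries.substAlgHom p.hasSubst_chart

end OrbitPoint

/-- `g` defines the strict transform of the curve whose total transform is `Z(G)`, at a point of
the exceptional divisor `Z(x)`. -/
def IsStrictTransform (G g : FormalRing) : Prop :=
  (∃ h : ℕ, G = x ^ h * g) ∧ ¬ x ∣ g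

/-- The points at which the strict transform of `Z(F)` by its Newton modification (relative to the
coordinate cross) meets the exceptional divisor, on the orbits of the exceptional components. -/
structure NewtonPoint (F : FormalRing) extends OrbitPoint where
  isNewtonRay : IsNewtonRay F c d
  mem_strictTransform : ∃ g : FormalRing,
    IsStrictTransform (toOrbitPoint.pullback F) g ∧ MvPowerSeries.constantCoeff g = 0

/-! ## The algorithm of toroidal pseudo-resolution -/

/-- The runs of the algorithm of toroidal pseudo-resolution on the curve `C = Z(f)` and the smooth
branch `L = Z(x)`.

* If `(L, C)` is a cross, the algorithm stops.
* Otherwise one chooses a smooth branch `L'` such that `(L, L')` is a cross, and a coordinate system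
  defining this cross: an isomorphism `φ` onto `ℂ[[x, y]]` such that `L = Z(φ⁻¹ x)` and
  `L' = Z(φ⁻¹ y)`. One performs the Newton modification of `C` relative to the cross and one runs the
  algorithm at every point at which the strict transform of `C` meets the exceptional divisor,
  with the germ of the exceptional divisor instead of `L` and the germ of the strict transform
  instead of `C`. -/
inductive Run : FormalRing → Type
  | halt (f : FormalRing) (hcross : IsCross x f) : Run f
  | step (f : FormalRing) (hcross : ¬ IsCross x f) (φ : FormalRing ≃ₐ[ℂ] FormalRing)
      (hφ : Associated (φ x) x) (g : NewtonPoint (φ f) → FormalRing)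
      (hg : ∀ p, IsStrictTransform (p.toOrbitPoint.pullback (φ f)) (g p))
      (next : ∀ p, Run (g p)) : Run f

namespace Run

/-- The index set of the crosses `(A_i, B_i)` considered during a run: the first cross, and the
crosses considered when the algorithm is run at the points of the strict transform. -/
def Cross : {f : FormalRing} → Run f → Type
  | _, halt _ _ => Unit
  | _, step _ _ _ _ _ _ next => Option (Σ p, Cross (next p))

/-- The cross is one for which the branch `B_i` was chosen (as opposed to a cross at which the
algorithm stops). -/
def IsChosen : {f : FormalRing} → (r : Run f) → r.Cross → Prop
  | _, halt _ _ => fun _ => False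
  | _, step _ _ _ _ _ _ next => fun (k : Option (Σ p, Cross (next p))) =>
      match k with
      | none => True
      | some ⟨p, i⟩ => IsChosen (next p) i

/-- The ideal of the branch on the initial surface which is the image of `B_i`. -/
def branchIdeal : {f : FormalRing} → (r : Run f) → r.Cross → Ideal FormalRing
  | _, halt f _ => fun _ => Ideal.span {f}
  | _, step _ _ φ _ _ _ next => fun (k : Option (Σ p, Cross (next p))) =>
      match k with
      | none => Ideal.span {φ.symm y}
      | some ⟨p, i⟩ =>
          (branchIdeal (next p) i).comap (p.toOrbitPoint.pullback.comp φ.toAlgHom)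

/-- The slopes of the interior rays of the Newton fan of the strict transform of `C` relative to the
cross `(A_i, B_i)`. -/
def slopes : {f : FormalRing} → (r : Run f) → r.Cross → Set ℝ≥0∞
  | _, halt _ _ => fun _ => ∅
  | _, step f _ φ _ _ _ next => fun (k : Option (Σ p, Cross (next p))) =>
      match k with
      | none => newtonSlopes (φ f)
      | some ⟨p, i⟩ => slopes (next p) i

/-- The exceptional component of which `A_i` is a germ, given by the cross at which this component
was created and by the slope of the corresponding ray; `none` if `A_i` is the initial branch. -/
def parent : {f : FormalRing} → (r : Run f) → r.Cross → Option (r.Cross × ℝ≥0∞)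
  | _, halt _ _ => fun _ => none
  | _, step _ _ _ _ _ _ next => fun (k : Option (Σ p, Cross (next p))) =>
      match k with
      | none => none
      | some ⟨p, i⟩ =>
          match parent (next p) i with
          | none => some ((none : Option (Σ p, Cross (next p))), p.toOrbitPoint.slope)
          | some (j, s) => some ((some ⟨p, j⟩ : Option (Σ p, Cross (next p))), s)

variable {f : FormalRing} (r : Run f)

/-- The branches of the completion of `C = Z(f)` relative to the run: `L`, the branches of `C`, and
the images of the branches chosen during the run. -/
def completion : Set (Ideal FormalRing) :=
  {idealL} ∪ branches f ∪ {P | ∃ j : r.Cross, r.IsChosen j ∧ P = r.branchIdeal j}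

/-! ## The fan tree -/

/-- The irreducible components of the boundary of the source of the pseudo-resolution: strict
transforms of branches, and exceptional components, each one given by the cross at which it was
created and the slope of its ray. -/
inductive Component
  | branch (P : Ideal FormalRing) : Component
  | exceptional (i : r.Cross) (s : ℝ≥0∞) : Component

/-- The disjoint union of the trunks: the trunk `[e_A, e_B]` of a cross `(A, B)` is identified with
`[0, ∞]` through its slope function. -/
abbrev Trunks : Type := Σ _ : r.Cross, ℝ≥0∞

/-- The marked points of the trunks (the points on the rays of the fans), with their labels. -/
inductive HasLabel : r.Trunks → r.Component → Prop
  | root (i : r.Cross) (h : r.parent i = none) : HasLabel ⟨i, 0⟩ (.branch idealL)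
  | start (i j : r.Cross) (s : ℝ≥0∞) (h : r.parent i = some (j, s)) :
      HasLabel ⟨i, 0⟩ (.exceptional j s)
  | inner (i : r.Cross) (s : ℝ≥0∞) (h : s ∈ r.slopes i) : HasLabel ⟨i, s⟩ (.exceptional i s)
  | finish (i : r.Cross) : HasLabel ⟨i, ⊤⟩ (.branch (r.branchIdeal i))

/-- The fan tree: the trunks are glued by identifying the marked points with the same label. -/
def FanTree : Type := Quot fun a b : r.Trunks => ∃ l, r.HasLabel a l ∧ r.HasLabel b l

instance : TopologicalSpace r.FanTree :=
  inferInstanceAs (TopologicalSpace (Quot fun a b : r.Trunks => ∃ l, r.HasLabel a l ∧ r.HasLabel b l))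

/-- The image in the fan tree of a point of a trunk. -/
def fanMk (a : r.Trunks) : r.FanTree := Quot.mk _ a

/-- The vertices (marked points) of the fan tree. -/
def IsFanVertex (z : r.FanTree) : Prop := ∃ a l, r.HasLabel a l ∧ r.fanMk a = z

/-- The point `z` of the fan tree is labeled by the branch `P`. -/
def IsFanLabel (z : r.FanTree) (P : Ideal FormalRing) : Prop :=
  ∃ a, r.HasLabel a (.branch P) ∧ r.fanMk a = z

end Run

/-! ## Newton-Puiseux roots -/

/-- The order embedding `k ↦ k / n`. -/
def divEmb (n : ℕ+) : ℕ ↪o ℚ :=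
  OrderEmbedding.ofStrictMono (fun k : ℕ => (k : ℚ) / (n : ℕ)) fun a b hab => by
    have hn : (0 : ℚ) < (n : ℕ) := by exact_mod_cast n.pos
    have hab' : (a : ℚ) < b := by exact_mod_cast hab
    exact div_lt_div_of_pos_right hab' hn

/-- The Newton-Puiseux series `ζ(x ^ (1 / n))`. -/
def puiseux (n : ℕ+) (ζ : PowerSeries ℂ) : HahnSeries ℚ ℂ :=
  HahnSeries.embDomain (divEmb n) (HahnSeries.toPowerSeries.symm ζ)

/-- The Newton-Puiseux roots relative to `x` of the curve with ideal `P`: the Newton-Puiseux series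
`η = ζ(x ^ (1 / n))` without constant term such that `f(x, η(x)) = 0`, that is,
`f(t ^ n, ζ(t)) = 0`, for all `f` in `P`. -/
def puiseuxRoots (P : Ideal FormalRing) : Set (HahnSeries ℚ ℂ) :=
  {η | ∃ (n : ℕ+) (ζ : PowerSeries ℂ), PowerSeries.constantCoeff ζ = 0 ∧ η = puiseux n ζ ∧
    ∀ f ∈ P, MvPowerSeries.subst ![(PowerSeries.X ^ (n : ℕ) : PowerSeries ℂ), ζ] f
      = (0 : PowerSeries ℂ)}

open Classical in
/-- The order of a Newton-Puiseux series: its smallest exponent, and `∞` for the series `0`. -/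
def puiseuxOrder (η : HahnSeries ℚ ℂ) : ℝ≥0∞ :=
  if η = 0 then ⊤ else ENNReal.ofReal (η.order : ℝ)

/-- The order of coincidence of two distinct branches: the maximal order of coincidence of their
Newton-Puiseux roots. (It is `0` if one of the branches is `L`, which has no root.) -/
def coincidence (P Q : Ideal FormalRing) : ℝ≥0∞ :=
  sSup {k | ∃ ξ ∈ puiseuxRoots P, ∃ η ∈ puiseuxRoots Q, k = puiseuxOrder (ξ - η)}

/-- The characteristic exponents of a branch: the orders of coincidence of pairs of distinct
Newton-Puiseux roots. -/
def charExponents (P : Ideal FormalRing) : Set ℝ≥0∞ :=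
  {k | ∃ ξ ∈ puiseuxRoots P, ∃ η ∈ puiseuxRoots P, ξ ≠ η ∧ k = puiseuxOrder (ξ - η)}

/-! ## The Eggers-Wall tree -/

section EggersWall

variable (B : Set (Ideal FormalRing))

/-- The disjoint union of the Eggers-Wall trees of the branches in `B`: a branch different from `L`
gives a segment, identified with `[0, ∞]` through the exponent function; the branch `L` gives one
point, of exponent `0`. -/
abbrev EWSegments : Type := Σ P : B, {t : ℝ≥0∞ // (P : Ideal FormalRing) = idealL → t = 0}

/-- The Eggers-Wall tree relative to `L = Z(x)` of the reduced curve with set of branches `B`: for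
each pair of distinct branches, the points with equal exponents not greater than the order of
coincidence are identified. -/
def EWTree : Type := Quot fun a b : EWSegments B =>
  a.1 ≠ b.1 ∧ (a.2 : ℝ≥0∞) = b.2 ∧ (a.2 : ℝ≥0∞) ≤ coincidence a.1 b.1

instance : TopologicalSpace (EWTree B) :=
  inferInstanceAs (TopologicalSpace (Quot fun a b : EWSegments B =>
    a.1 ≠ b.1 ∧ (a.2 : ℝ≥0∞) = b.2 ∧ (a.2 : ℝ≥0∞) ≤ coincidence a.1 b.1))

variable {B}

/-- The image in the Eggers-Wall tree of a point of one of the segments. -/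
def ewMk (a : EWSegments B) : EWTree B := Quot.mk _ a

/-- The point `z` of the Eggers-Wall tree is labeled by the branch `P`: the root, of exponent `0`, is
labeled by `L`, and the end of exponent `∞` of the segment of a branch `P ≠ L` by `P`. -/
def IsEWLabel (z : EWTree B) (P : Ideal FormalRing) : Prop :=
  ∃ a : EWSegments B, ewMk a = z ∧
    (((a.2 : ℝ≥0∞) = 0 ∧ P = idealL) ∨ ((a.2 : ℝ≥0∞) = ⊤ ∧ P = a.1))

/-- The vertices of the Eggers-Wall tree: the labeled points, and the marked points, which are the
points whose exponent is a characteristic exponent of a branch and the ramification points (those at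
which the segments of two distinct branches separate). -/
def IsEWVertex (z : EWTree B) : Prop :=
  (∃ P, IsEWLabel z P) ∨
  ∃ a : EWSegments B, ewMk a = z ∧ ((a.2 : ℝ≥0∞) ∈ charExponents a.1 ∨
    ∃ b : EWSegments B, ewMk b = z ∧ a.1 ≠ b.1 ∧ (a.2 : ℝ≥0∞) = coincidence a.1 b.1)

end EggersWall

/-- The bijection `e` between the vertices of the fan tree of a run and the vertices of the
Eggers-Wall tree of the associated completion is an isomorphism of trees (it is induced by a
homeomorphism of the two trees) which preserves the labels by branches. -/
def IsLabelIso {f : FormalRing} (r : Run f)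
    (e : {z : r.FanTree // r.IsFanVertex z} ≃ {z : EWTree r.completion // IsEWVertex z}) : Prop :=
  (∃ Ψ : r.FanTree ≃ₜ EWTree r.completion, ∀ z, Ψ z.1 = (e z).1) ∧
  ∀ z P, r.IsFanLabel z.1 P ↔ IsEWLabel (e z).1 P

end FanEW

end

/-!
# The fan tree of a toroidal pseudo-resolution is an Eggers-Wall tree

Both trees are unions of segments indexed by the crosses `(A_i, B_i)` of the run: each branch
of the completion other than `L` is the image `P_i` of exactly one branch `B_i`, and both trees carry
an exponent function. On the trunk of the cross `i`, the exponent is an affine function of the slope: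
a Newton modification at a point of the exceptional component of the ray `(c, d)` changes exponents
by `s ↦ (d + s) / c` (`OrbitPoint.lift`, `Run.exponent`). The same recursion defines a number
`Run.coin i j`, at which the paths of the fan tree towards the ends labeled by `P_i` and `P_j`
separate. The isomorphism sends the point of slope `s` on the trunk of `i` to the point of exponent
`Run.exponent i s` on the segment of `P_i`.

*Orders of coincidence.* That this map is well defined and bijective amounts to the equality
`coincidence P_i P_j = coin i j` for `i ≠ j` (`Run.coincidence_branchIdeal`). Branches are handled
through their parametrizations, which are morphisms `ℂ[[x, y]] → ℂ[[t]]`; the normalized ones, with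
`x ↦ t ^ N`, are the Newton-Puiseux roots, and all those of a given branch are conjugate
(`exists_conj`), by the usual product over the `N`-th roots of unity. The relation `Close α β N K`
expresses that two parametrizations have order `N` along `Z(x)` and that their normalizations agree
to the order `K` in `t`, that is, to the exponent `K / N` in `x`. It can be checked without
normalizing, it does not depend on the coordinate `y`, and it is transformed by `K ↦ d M + K`,
`N = c M`, under a Newton modification (`Close.comp_pullback`), with a converse for the exponents
greater than the slope (`Close.lift_pullback`, `Close.le_of_ne`), because a monomial change of
coordinates of determinant one is invertible on units. The equality follows by recursion on the run.

*Vertices.* The marked points of the trunks are exactly the root, the ends and the ramification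
points. A ray of the Newton fan carries a point of the strict transform
(`exists_newtonPoint_slope_eq`), so that another trunk starts at the corresponding marked point, and
conversely branches separate only at marked points. Characteristic exponents give nothing new:
`B_i` is smooth and transversal to the exceptional component `A_i`, so the characteristic exponents
of `P_i` are at most the exponent at which the trunk of `i` starts (`Run.charExponents_le`), and the
smaller ones are shared with the branch of the parent cross (`Run.charExponents_of_lt_coin`).
Each branch of the curve is some `P_i`, since a factor of the equation which is not the chosen
coordinate passes through a point of the strict transform (`exists_newtonPoint_of_dvd`).

*Uniqueness.* Two isomorphisms differ by a self-homeomorphism of the Eggers-Wall tree which fixes the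
root and the ends. As the interior points of the segment from the root to an end are those which
separate the root from this end, each such segment is preserved, by an increasing bijection. Two
segments meet along an initial interval, which is therefore preserved too, and its last point is fixed
(`Run.ramification_fixed`).
-/

noncomputable section

namespace FanEW

/-! ### Homomorphisms out of rings of formal power series -/

/-- The ring `ℂ[[t]]` of formal power series in one variable, the target of parametrizations. -/
abbrev Series : Type := PowerSeries ℂ

/-- The variable `t` of `ℂ[[t]]`. -/
abbrev t : Series := PowerSeries.X

/-- An arc on the surface: a morphism of `ℂ`-algebras `ℂ[[x, y]] → ℂ[[t]]`. It is
automatically local and continuous. -/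
abbrev Arc : Type := FormalRing →ₐ[ℂ] Series

/-- The constant coefficient as a morphism of algebras. -/
def evalZero : FormalRing →ₐ[ℂ] ℂ :=
  { MvPowerSeries.constantCoeff (σ := Fin 2) (R := ℂ) with
    commutes' := fun r => by
      change MvPowerSeries.constantCoeff (MvPowerSeries.C r) = r
      simp }

/-- The constant coefficient of a series in one variable as a morphism of algebras. -/
def evalZeroSeries : Series →ₐ[ℂ] ℂ :=
  { PowerSeries.constantCoeff (R := ℂ) with
    commutes' := fun r => by
      change PowerSeries.constantCoeff (PowerSeries.C r) = r
      simp }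

theorem algebraMap_formal (r : ℂ) : algebraMap ℂ FormalRing r = MvPowerSeries.C r := rfl

theorem algebraMap_series (r : ℂ) : algebraMap ℂ Series r = PowerSeries.C r := rfl

theorem algHom_formal_eq_evalZero (e : FormalRing →ₐ[ℂ] ℂ) (F : FormalRing) :
    e F = MvPowerSeries.constantCoeff F := by
  have h : ¬ IsUnit (F - MvPowerSeries.C (e F)) := by
    intro hu
    have := hu.map e
    rw [map_sub, ← algebraMap_formal, AlgHom.commutes] at this
    simp at this
  rw [MvPowerSeries.isUnit_iff_constantCoeff, isUnit_iff_ne_zero, not_not, map_sub] at h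
  simp at h
  exact (sub_eq_zero.1 h).symm

theorem algHom_series_eq_evalZero (e : Series →ₐ[ℂ] ℂ) (F : Series) :
    e F = PowerSeries.constantCoeff F := by
  have h : ¬ IsUnit (F - PowerSeries.C (e F)) := by
    intro hu
    have := hu.map e
    rw [map_sub, ← algebraMap_series, AlgHom.commutes] at this
    simp at this
  rw [PowerSeries.isUnit_iff_constantCoeff, isUnit_iff_ne_zero, not_not, map_sub] at h
  simp at h
  exact (sub_eq_zero.1 h).symm

theorem constantCoeff_arc (α : Arc) (F : FormalRing) :
    PowerSeries.constantCoeff (α F) = MvPowerSeries.constantCoeff F :=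
  algHom_formal_eq_evalZero (evalZeroSeries.comp α) F

theorem constantCoeff_endo (ψ : FormalRing →ₐ[ℂ] FormalRing) (F : FormalRing) :
    MvPowerSeries.constantCoeff (ψ F) = MvPowerSeries.constantCoeff F :=
  algHom_formal_eq_evalZero (evalZero.comp ψ) F

theorem constantCoeff_seriesEndo (σ : Series →ₐ[ℂ] Series) (F : Series) :
    PowerSeries.constantCoeff (σ F) = PowerSeries.constantCoeff F :=
  algHom_series_eq_evalZero (evalZeroSeries.comp σ) F

@[simp] theorem constantCoeff_x : MvPowerSeries.constantCoeff x = 0 := by simp [x]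

@[simp] theorem constantCoeff_y : MvPowerSeries.constantCoeff y = 0 := by simp [y]

theorem exists_eq_const_add (F : FormalRing) : ∃ F₁ F₂ : FormalRing,
    F = MvPowerSeries.C (MvPowerSeries.constantCoeff F) + x * F₁ + y * F₂ := by
  classical
  let G : FormalRing := fun m => if m 1 = 0 then MvPowerSeries.coeff m F else 0
  have hG : ∀ m, MvPowerSeries.coeff m G = if m 1 = 0 then MvPowerSeries.coeff m F else 0 :=
    fun _ => rfl
  have h1 : y ∣ F - G := by
    rw [y, MvPowerSeries.X_dvd_iff]
    intro m hm
    rw [map_sub, hG, if_pos hm, sub_self]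
  have h2 : x ∣ G - MvPowerSeries.C (MvPowerSeries.constantCoeff F) := by
    rw [x, MvPowerSeries.X_dvd_iff]
    intro m hm
    rw [map_sub, hG, MvPowerSeries.coeff_C]
    by_cases h : m 1 = 0
    · have : m = 0 := by ext i; fin_cases i <;> simp_all
      subst this
      simp
    · have : m ≠ 0 := by rintro rfl; simp at h
      simp [h, this]
  obtain ⟨F₂, h1⟩ := h1
  obtain ⟨F₁, h2⟩ := h2
  refine ⟨F₁, F₂, ?_⟩
  rw [← h1, ← h2]
  ring

theorem exists_eq_const_add_series (F : Series) : ∃ F₁ : Series,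
    F = PowerSeries.C (PowerSeries.constantCoeff F) + t * F₁ := by
  have : t ∣ F - PowerSeries.C (PowerSeries.constantCoeff F) := by
    rw [PowerSeries.X_dvd_iff]; simp
  obtain ⟨F₁, h⟩ := this
  exact ⟨F₁, by rw [← h]; ring⟩

section Congruence

variable {B : Type*} [CommRing B] [Algebra ℂ B]

/-- Two morphisms which are congruent on the coordinates are congruent everywhere. -/
theorem algHom_sub_mem (α β : FormalRing →ₐ[ℂ] B) (I : Ideal B) (K : ℕ)
    (hx : α x ∈ I) (hy : α y ∈ I) (hxx : α x - β x ∈ I ^ K) (hyy : α y - β y ∈ I ^ K)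
    (F : FormalRing) : α F - β F ∈ I ^ K := by
  have key : ∀ n ≤ K, ∀ F : FormalRing, α F - β F ∈ I ^ n := by
    intro n
    induction n with
    | zero => intro _ F; simp
    | succ n ih =>
      intro hn F
      obtain ⟨F₁, F₂, hF⟩ := exists_eq_const_add F
      have e : α F - β F = (α x * (α F₁ - β F₁) + (α x - β x) * β F₁) +
          (α y * (α F₂ - β F₂) + (α y - β y) * β F₂) := by
        rw [hF, ← algebraMap_formal]
        simp only [map_add, map_mul, AlgHom.commutes]
        ring
      have hle : I ^ K ≤ I ^ (n + 1) := Ideal.pow_le_pow_right hn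
      rw [e]
      refine add_mem (add_mem ?_ ?_) (add_mem ?_ ?_)
      · rw [pow_succ']; exact Ideal.mul_mem_mul hx (ih (by omega) _)
      · exact Ideal.mul_mem_right _ _ (hle hxx)
      · rw [pow_succ']; exact Ideal.mul_mem_mul hy (ih (by omega) _)
      · exact Ideal.mul_mem_right _ _ (hle hyy)
  exact key K le_rfl F

theorem seriesAlgHom_sub_mem (σ τ : Series →ₐ[ℂ] B) (I : Ideal B) (K : ℕ)
    (hx : σ t ∈ I) (hxx : σ t - τ t ∈ I ^ K) (F : Series) : σ F - τ F ∈ I ^ K := by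
  have key : ∀ n ≤ K, ∀ F : Series, σ F - τ F ∈ I ^ n := by
    intro n
    induction n with
    | zero => intro _ F; simp
    | succ n ih =>
      intro hn F
      obtain ⟨F₁, hF⟩ := exists_eq_const_add_series F
      have e : σ F - τ F = σ t * (σ F₁ - τ F₁) + (σ t - τ t) * τ F₁ := by
        rw [hF, ← algebraMap_series]
        simp only [map_add, map_mul, AlgHom.commutes]
        ring
      have hle : I ^ K ≤ I ^ (n + 1) := Ideal.pow_le_pow_right hn
      rw [e]
      refine add_mem ?_ ?_
      · rw [pow_succ']; exact Ideal.mul_mem_mul hx (ih (by omega) _)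
      · exact Ideal.mul_mem_right _ _ (hle hxx)
  exact key K le_rfl F

/-- Krull's intersection theorem makes a morphism out of `ℂ[[x, y]]` depend only on its values on
the coordinates. -/
theorem algHom_ext_of_local [IsLocalRing B] [IsNoetherianRing B] {α β : FormalRing →ₐ[ℂ] B}
    (hx : ¬ IsUnit (α x)) (hy : ¬ IsUnit (α y)) (hxx : α x = β x) (hyy : α y = β y) : α = β := by
  ext F
  rw [← sub_eq_zero, ← Ideal.mem_bot,
    ← Ideal.iInf_pow_eq_bot_of_isLocalRing (IsLocalRing.maximalIdeal B)
      (IsLocalRing.maximalIdeal.isMaximal B).ne_top, Ideal.mem_iInf]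
  intro n
  exact algHom_sub_mem α β _ n hx hy (by simp [hxx]) (by simp [hyy]) F

theorem seriesAlgHom_ext_of_local [IsLocalRing B] [IsNoetherianRing B] {σ τ : Series →ₐ[ℂ] B}
    (hx : ¬ IsUnit (σ t)) (hxx : σ t = τ t) : σ = τ := by
  ext F
  rw [← sub_eq_zero, ← Ideal.mem_bot,
    ← Ideal.iInf_pow_eq_bot_of_isLocalRing (IsLocalRing.maximalIdeal B)
      (IsLocalRing.maximalIdeal.isMaximal B).ne_top, Ideal.mem_iInf]
  intro n
  exact seriesAlgHom_sub_mem σ τ _ n hx (by simp [hxx]) F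

end Congruence

theorem not_isUnit_series {F : Series} (h : PowerSeries.constantCoeff F = 0) : ¬ IsUnit F := by
  simp [PowerSeries.isUnit_iff_constantCoeff, h]

theorem not_isUnit_formal {F : FormalRing} (h : MvPowerSeries.constantCoeff F = 0) :
    ¬ IsUnit F := by
  simp [MvPowerSeries.isUnit_iff_constantCoeff, h]

theorem arc_ext {α β : Arc} (hx : α x = β x) (hy : α y = β y) : α = β :=
  algHom_ext_of_local (not_isUnit_series (by simp [constantCoeff_arc]))
    (not_isUnit_series (by simp [constantCoeff_arc])) hx hy

theorem endo_ext {α β : FormalRing →ₐ[ℂ] FormalRing} (hx : α x = β x) (hy : α y = β y) :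
    α = β :=
  algHom_ext_of_local (not_isUnit_formal (by simp [constantCoeff_endo]))
    (not_isUnit_formal (by simp [constantCoeff_endo])) hx hy

theorem seriesEndo_ext {σ τ : Series →ₐ[ℂ] Series} (h : σ t = τ t) : σ = τ :=
  seriesAlgHom_ext_of_local (not_isUnit_series (by simp [constantCoeff_seriesEndo])) h

theorem series_dvd_sub (σ τ : Series →ₐ[ℂ] Series) {K : ℕ} (h : t ^ K ∣ σ t - τ t)
    (F : Series) : t ^ K ∣ σ F - τ F := by
  have := seriesAlgHom_sub_mem σ τ (Ideal.span {t}) K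
    (by rw [Ideal.mem_span_singleton, PowerSeries.X_dvd_iff, constantCoeff_seriesEndo]; simp)
    (by rwa [Ideal.span_singleton_pow, Ideal.mem_span_singleton]) F
  rwa [Ideal.span_singleton_pow, Ideal.mem_span_singleton] at this

theorem t_dvd_arc (α : Arc) {F : FormalRing} (hF : MvPowerSeries.constantCoeff F = 0) :
    t ∣ α F := by
  rw [PowerSeries.X_dvd_iff, constantCoeff_arc, hF]

theorem arc_dvd_sub (α β : Arc) {K : ℕ} (hx : t ^ K ∣ α x - β x) (hy : t ^ K ∣ α y - β y)
    (F : FormalRing) : t ^ K ∣ α F - β F := by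
  have := algHom_sub_mem α β (Ideal.span {t}) K
    (by rw [Ideal.mem_span_singleton]; exact t_dvd_arc α (by simp))
    (by rw [Ideal.mem_span_singleton]; exact t_dvd_arc α (by simp))
    (by rwa [Ideal.span_singleton_pow, Ideal.mem_span_singleton])
    (by rwa [Ideal.span_singleton_pow, Ideal.mem_span_singleton]) F
  rwa [Ideal.span_singleton_pow, Ideal.mem_span_singleton] at this

/-! ### Substitutions -/

theorem hasSubst_pair {τ : Type*} {a b : MvPowerSeries τ ℂ}
    (ha : MvPowerSeries.constantCoeff a = 0) (hb : MvPowerSeries.constantCoeff b = 0) :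
    MvPowerSeries.HasSubst ![a, b] := by
  apply MvPowerSeries.hasSubst_of_constantCoeff_zero
  intro i
  fin_cases i <;> simp [ha, hb]

/-- The arc `t ↦ (a(t), b(t))`. -/
def mkArc (a b : Series) (ha : PowerSeries.constantCoeff a = 0)
    (hb : PowerSeries.constantCoeff b = 0) : Arc :=
  MvPowerSeries.substAlgHom (a := ![a, b]) (hasSubst_pair (τ := Unit) ha hb)

@[simp] theorem mkArc_x (a b : Series) (ha hb) : mkArc a b ha hb x = a := by
  rw [mkArc, x, MvPowerSeries.substAlgHom_X]; rfl

@[simp] theorem mkArc_y (a b : Series) (ha hb) : mkArc a b ha hb y = b := by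
  rw [mkArc, y, MvPowerSeries.substAlgHom_X]; rfl

theorem mkArc_apply (a b : Series) (ha hb) (F : FormalRing) :
    mkArc a b ha hb F = MvPowerSeries.subst ![a, b] F := by
  rw [mkArc, MvPowerSeries.substAlgHom_apply]

/-- The endomorphism of `ℂ[[x, y]]` which sends the coordinates to `a` and `b`. -/
def mkEndo (a b : FormalRing) (ha : MvPowerSeries.constantCoeff a = 0)
    (hb : MvPowerSeries.constantCoeff b = 0) : FormalRing →ₐ[ℂ] FormalRing :=
  MvPowerSeries.substAlgHom (a := ![a, b]) (hasSubst_pair ha hb)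

@[simp] theorem mkEndo_x (a b : FormalRing) (ha hb) : mkEndo a b ha hb x = a := by
  rw [mkEndo, x, MvPowerSeries.substAlgHom_X]; rfl

@[simp] theorem mkEndo_y (a b : FormalRing) (ha hb) : mkEndo a b ha hb y = b := by
  rw [mkEndo, y, MvPowerSeries.substAlgHom_X]; rfl

/-- The endomorphism `t ↦ a(t)` of `ℂ[[t]]`. -/
def reparam (a : Series) (ha : PowerSeries.constantCoeff a = 0) : Series →ₐ[ℂ] Series :=
  PowerSeries.substAlgHom (PowerSeries.HasSubst.of_constantCoeff_zero' ha)

@[simp] theorem reparam_t (a : Series) (ha) : reparam a ha t = a := by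
  rw [reparam, PowerSeries.substAlgHom_X]

theorem reparam_apply (a : Series) (ha) (F : Series) : reparam a ha F = F.subst a := by
  rw [reparam, PowerSeries.coe_substAlgHom]

/-- A series in `t`, read as a series in the coordinate `x`. -/
def inX : Series →ₐ[ℂ] FormalRing :=
  PowerSeries.substAlgHom (a := x) (PowerSeries.HasSubst.of_constantCoeff_zero (by simp))

@[simp] theorem inX_t : inX t = x := by rw [inX, PowerSeries.substAlgHom_X]

theorem constantCoeff_inX (F : Series) :
    MvPowerSeries.constantCoeff (inX F) = PowerSeries.constantCoeff F :=
  algHom_series_eq_evalZero (evalZero.comp inX) F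

/-- The endomorphism `t ↦ ω t ^ m` of `ℂ[[t]]`, for `m > 0`. -/
def monoEndo (ω : ℂ) (m : ℕ) (hm : 0 < m) : Series →ₐ[ℂ] Series :=
  reparam (PowerSeries.C ω * t ^ m) (by simp [hm.ne'])

@[simp] theorem monoEndo_t (ω : ℂ) (m : ℕ) (hm : 0 < m) :
    monoEndo ω m hm t = PowerSeries.C ω * t ^ m := by simp [monoEndo]

theorem monoEndo_t_pow (ω : ℂ) (m : ℕ) (hm : 0 < m) (n : ℕ) :
    monoEndo ω m hm (t ^ n) = PowerSeries.C (ω ^ n) * t ^ (m * n) := by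
  rw [map_pow, monoEndo_t, mul_pow, ← map_pow, ← pow_mul]

theorem endo_C {σ : Series →ₐ[ℂ] Series} (r : ℂ) : σ (PowerSeries.C r) = PowerSeries.C r := by
  rw [← algebraMap_series, AlgHom.commutes]

theorem arc_C {α : Arc} (r : ℂ) : α (MvPowerSeries.C r) = PowerSeries.C r := by
  rw [← algebraMap_formal, AlgHom.commutes, algebraMap_series]
/-! ### Orders of series in one variable -/

/-- The series `F` has order `N`. -/
def HasOrd (F : Series) (N : ℕ) : Prop := ∃ u : Series, IsUnit u ∧ F = t ^ N * u

theorem exists_hasOrd {F : Series} (h : F ≠ 0) : ∃ N, HasOrd F N := by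
  refine ⟨F.order.toNat, PowerSeries.divXPowOrder F, ?_, ?_⟩
  · rw [PowerSeries.isUnit_iff_constantCoeff, isUnit_iff_ne_zero]
    rw [Ne, PowerSeries.constantCoeff_divXPowOrder_eq_zero_iff]
    exact h
  · rw [PowerSeries.X_pow_order_mul_divXPowOrder]

theorem HasOrd.ne_zero {F : Series} {N : ℕ} (h : HasOrd F N) : F ≠ 0 := by
  obtain ⟨u, hu, rfl⟩ := h
  exact mul_ne_zero (pow_ne_zero _ PowerSeries.X_ne_zero) hu.ne_zero

theorem HasOrd.dvd_iff {F : Series} {N : ℕ} (h : HasOrd F N) (K : ℕ) : t ^ K ∣ F ↔ K ≤ N := by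
  obtain ⟨u, hu, rfl⟩ := h
  rw [hu.dvd_mul_right]
  refine ⟨fun h => ?_, fun h => pow_dvd_pow _ h⟩
  exact (pow_dvd_pow_iff PowerSeries.X_ne_zero PowerSeries.X_prime.not_isUnit).1 h

theorem HasOrd.unique {F : Series} {M N : ℕ} (h : HasOrd F M) (h' : HasOrd F N) : M = N :=
  le_antisymm ((h'.dvd_iff M).1 ((h.dvd_iff M).2 le_rfl))
    ((h.dvd_iff N).1 ((h'.dvd_iff N).2 le_rfl))

theorem hasOrd_t_pow (N : ℕ) : HasOrd (t ^ N) N := ⟨1, isUnit_one, by simp⟩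

theorem hasOrd_t : HasOrd t 1 := by simpa using hasOrd_t_pow 1

theorem hasOrd_zero_iff {F : Series} : HasOrd F 0 ↔ IsUnit F := by
  constructor
  · rintro ⟨u, hu, rfl⟩; simpa using hu
  · intro h; exact ⟨F, h, by simp⟩

theorem HasOrd.mul {F G : Series} {M N : ℕ} (h : HasOrd F M) (h' : HasOrd G N) :
    HasOrd (F * G) (M + N) := by
  obtain ⟨u, hu, rfl⟩ := h
  obtain ⟨v, hv, rfl⟩ := h'
  exact ⟨u * v, hu.mul hv, by ring⟩

theorem HasOrd.pow {F : Series} {M : ℕ} (h : HasOrd F M) (k : ℕ) : HasOrd (F ^ k) (k * M) := by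
  obtain ⟨u, hu, rfl⟩ := h
  exact ⟨u ^ k, hu.pow k, by rw [mul_pow, ← pow_mul, mul_comm k]⟩

theorem HasOrd.pos {F : Series} {N : ℕ} (h : HasOrd F N)
    (hF : PowerSeries.constantCoeff F = 0) : 0 < N := by
  rcases Nat.eq_zero_or_pos N with rfl | h'
  · exact absurd (hasOrd_zero_iff.1 h) (not_isUnit_series hF)
  · exact h'

theorem HasOrd.map {F : Series} {N m : ℕ} (h : HasOrd F N) {σ : Series →ₐ[ℂ] Series}
    (hσ : HasOrd (σ t) m) : HasOrd (σ F) (m * N) := by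
  obtain ⟨u, hu, rfl⟩ := h
  rw [map_mul, map_pow, mul_comm m]
  simpa using (hσ.pow N).mul (hasOrd_zero_iff.2 (hu.map σ))

theorem dvd_map {F : Series} {K m : ℕ} {σ : Series →ₐ[ℂ] Series} (hσ : HasOrd (σ t) m)
    (h : t ^ K ∣ F) : t ^ (m * K) ∣ σ F := by
  obtain ⟨G, rfl⟩ := h
  rw [map_mul, map_pow]
  exact Dvd.dvd.mul_right (((hσ.pow K).dvd_iff _).2 (by rw [mul_comm])) _

theorem endo_injective {σ : Series →ₐ[ℂ] Series} (hσ : σ t ≠ 0) : Function.Injective σ := by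
  rw [injective_iff_map_eq_zero]
  intro F hF
  by_contra h
  obtain ⟨N, hN⟩ := exists_hasOrd h
  obtain ⟨m, hm⟩ := exists_hasOrd hσ
  exact (hN.map hm).ne_zero hF

theorem dvd_of_dvd_map {F : Series} {K m : ℕ} {σ : Series →ₐ[ℂ] Series} (hσ : HasOrd (σ t) m)
    (h : t ^ (m * K) ∣ σ F) : t ^ K ∣ F := by
  by_cases hF : F = 0
  · simp [hF]
  obtain ⟨N, hN⟩ := exists_hasOrd hF
  have h1 := ((hN.map hσ).dvd_iff _).1 h
  have hm : 0 < m := hσ.pos (by simp [constantCoeff_seriesEndo])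
  exact (hN.dvd_iff _).2 (Nat.le_of_mul_le_mul_left h1 hm)

theorem eq_zero_of_forall_dvd {F : Series} (h : ∀ K, t ^ K ∣ F) : F = 0 := by
  by_contra hF
  obtain ⟨N, hN⟩ := exists_hasOrd hF
  have := (hN.dvd_iff (N + 1)).1 (h _)
  omega

theorem hasOrd_monoEndo {ω : ℂ} (hω : ω ≠ 0) (m : ℕ) (hm : 0 < m) :
    HasOrd (monoEndo ω m hm t) m := by
  refine ⟨PowerSeries.C ω, ?_, ?_⟩
  · rw [PowerSeries.isUnit_iff_constantCoeff]; simpa using hω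
  · rw [monoEndo_t, mul_comm]

/-! ### Implicit functions and normalization of arcs -/

/-- A formal contraction principle. -/
theorem exists_fixed_series (H : FormalRing) : ∃ (ζ : Series)
    (hζ : PowerSeries.constantCoeff ζ = 0), ζ = t * mkArc t ζ (by simp) hζ H := by
  let step : {ζ : Series // PowerSeries.constantCoeff ζ = 0} →
      {ζ : Series // PowerSeries.constantCoeff ζ = 0} :=
    fun ζ => ⟨t * mkArc t ζ.1 (by simp) ζ.2 H, by simp⟩
  let s : ℕ → {ζ : Series // PowerSeries.constantCoeff ζ = 0} := fun n => step^[n] ⟨0, by simp⟩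
  have hs : ∀ n, s (n + 1) = step (s n) := fun n => Function.iterate_succ_apply' _ _ _
  have hstep : ∀ (ζ η : {ζ : Series // PowerSeries.constantCoeff ζ = 0}) (k : ℕ),
      t ^ k ∣ ζ.1 - η.1 → t ^ (k + 1) ∣ (step ζ).1 - (step η).1 := by
    intro ζ η k h
    have : (step ζ).1 - (step η).1 =
        t * (mkArc t ζ.1 (by simp) ζ.2 H - mkArc t η.1 (by simp) η.2 H) := by
      simp only [step]; ring
    rw [this, pow_succ']
    exact mul_dvd_mul_left _ (arc_dvd_sub _ _ (by simp) (by simpa using h) _)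
  have hdiff : ∀ n, t ^ (n + 1) ∣ (s (n + 1)).1 - (s n).1 := by
    intro n
    induction n with
    | zero =>
      simp only [zero_add, pow_one]
      rw [PowerSeries.X_dvd_iff, map_sub, (s 1).2, (s 0).2, sub_zero]
    | succ n ih =>
      have := hstep _ _ _ ih
      rwa [← hs, ← hs] at this
  have hcauchy : ∀ n k, t ^ (n + 1) ∣ (s (n + k)).1 - (s n).1 := by
    intro n k
    induction k with
    | zero => simp
    | succ k ih =>
      have := (pow_dvd_pow t (show n + 1 ≤ n + k + 1 by omega)).trans (hdiff (n + k))
      have e : (s (n + (k + 1))).1 - (s n).1 =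
          ((s (n + k + 1)).1 - (s (n + k)).1) + ((s (n + k)).1 - (s n).1) := by
        rw [← add_assoc]; ring
      rw [e]
      exact dvd_add this ih
  let ζ : Series := PowerSeries.mk fun n => PowerSeries.coeff n (s n).1
  have hζs : ∀ n, t ^ (n + 1) ∣ ζ - (s n).1 := by
    intro n
    rw [PowerSeries.X_pow_dvd_iff]
    intro m hm
    obtain ⟨k, rfl⟩ : ∃ k, n = m + k := ⟨n - m, by omega⟩
    have := (PowerSeries.X_pow_dvd_iff.1 (hcauchy m k)) m (by omega)
    rw [map_sub] at this ⊢
    simp only [ζ, PowerSeries.coeff_mk]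
    linear_combination -this
  have hζ : PowerSeries.constantCoeff ζ = 0 := by
    rw [← PowerSeries.coeff_zero_eq_constantCoeff_apply]
    simp [ζ, s]
  refine ⟨ζ, hζ, ?_⟩
  rw [← sub_eq_zero]
  apply eq_zero_of_forall_dvd
  intro K
  have h1 : t ^ K ∣ ζ - (s (K + 1)).1 := (pow_dvd_pow t (by omega)).trans (hζs (K + 1))
  have h2 : t ^ K ∣ (step ⟨ζ, hζ⟩).1 - (step (s K)).1 :=
    (pow_dvd_pow t (by omega)).trans (hstep ⟨ζ, hζ⟩ (s K) (K + 1) (hζs K))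
  rw [hs] at h1
  have := dvd_sub h1 h2
  simpa [step] using this

/-- The formal implicit function theorem. -/
theorem exists_implicit {f f₁ f₂ : FormalRing} (h : f = x * f₁ + y * f₂) (h₂ : IsUnit f₂) :
    ∃ (ζ : Series) (hζ : PowerSeries.constantCoeff ζ = 0), mkArc t ζ (by simp) hζ f = 0 := by
  obtain ⟨g, hg⟩ := h₂.exists_right_inv
  obtain ⟨ζ, hζ, e⟩ := exists_fixed_series (-f₁ * g)
  refine ⟨ζ, hζ, ?_⟩
  have hg' := congrArg (mkArc t ζ (by simp) hζ) hg
  rw [map_mul, map_one] at hg'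
  rw [h, map_add, map_mul, map_mul, mkArc_x, mkArc_y]
  rw [map_mul, map_neg] at e
  linear_combination (mkArc t ζ (by simp) hζ f₂) * e - t * mkArc t ζ (by simp) hζ f₁ * hg'

/-- Roots of a unit of `ℂ[[t]]`, with prescribed constant term. -/
theorem exists_series_root {a : Series} {N : ℕ} (hN : 0 < N) {c : ℂ} (hc : c ≠ 0)
    (ha : PowerSeries.constantCoeff a = c ^ N) :
    ∃ A : Series, A ^ N = a ∧ PowerSeries.constantCoeff A = c := by
  obtain ⟨a₁, e⟩ := exists_eq_const_add_series a
  let S : FormalRing := ∑ i ∈ Finset.range N,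
    (y + MvPowerSeries.C c) ^ i * (MvPowerSeries.C c) ^ (N - 1 - i)
  have hS : S * y = (y + MvPowerSeries.C c) ^ N - (MvPowerSeries.C c) ^ N := by
    have := geom_sum₂_mul (y + MvPowerSeries.C c) (MvPowerSeries.C c) N
    rwa [add_sub_cancel_right] at this
  have hSu : IsUnit S := by
    rw [MvPowerSeries.isUnit_iff_constantCoeff, isUnit_iff_ne_zero]
    simp only [S, map_sum, map_mul, map_pow, map_add, constantCoeff_y,
      MvPowerSeries.constantCoeff_C, zero_add]
    have : ∀ i ∈ Finset.range N, c ^ i * c ^ (N - 1 - i) = c ^ (N - 1) := by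
      intro i hi
      rw [Finset.mem_range] at hi
      rw [← pow_add]; congr 1; omega
    rw [Finset.sum_congr rfl this]
    simp [hc, hN.ne']
  have key : (y + MvPowerSeries.C c) ^ N - inX a = x * (-inX a₁) + y * S := by
    have e2 : inX a = (MvPowerSeries.C c) ^ N + x * inX a₁ := by
      rw [e, map_add, map_mul, inX_t, ha]
      have : inX (PowerSeries.C (c ^ N)) = (MvPowerSeries.C c) ^ N := by
        rw [← algebraMap_series, AlgHom.commutes, algebraMap_formal, map_pow]
      rw [this]
    rw [e2]
    linear_combination -hS
  obtain ⟨ζ, hζ, h⟩ := exists_implicit key hSu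
  refine ⟨ζ + PowerSeries.C c, ?_, by simp [hζ]⟩
  have hcomp : (mkArc t ζ (by simp) hζ).comp inX = AlgHom.id ℂ Series := by
    apply seriesEndo_ext; simp
  have := DFunLike.congr_fun hcomp a
  simp only [AlgHom.comp_apply, AlgHom.id_apply] at this
  rw [map_sub, map_pow, map_add, mkArc_y, arc_C, this, sub_eq_zero] at h
  exact h

theorem hasOrd_one_iff {F : Series} : HasOrd F 1 ↔
    PowerSeries.constantCoeff F = 0 ∧ PowerSeries.coeff 1 F ≠ 0 := by
  constructor
  · rintro ⟨u, hu, rfl⟩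
    rw [PowerSeries.isUnit_iff_constantCoeff, isUnit_iff_ne_zero] at hu
    rw [pow_one, ← zero_add 1, PowerSeries.coeff_succ_X_mul]
    simpa using hu
  · rintro ⟨h0, h1⟩
    obtain ⟨G, rfl⟩ := PowerSeries.X_dvd_iff.2 h0
    rw [← zero_add 1, PowerSeries.coeff_succ_X_mul] at h1
    refine ⟨G, ?_, by simp⟩
    rw [PowerSeries.isUnit_iff_constantCoeff, isUnit_iff_ne_zero]
    simpa using h1

/-- A series of order one is the parameter of a reparametrization, and the inverse
reparametrizations of congruent series are congruent. -/
theorem exists_reparam {S : Series} (hS : HasOrd S 1) :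
    ∃ σ : Series →ₐ[ℂ] Series, HasOrd (σ t) 1 ∧ σ S = t ∧
      ∃ ρ : Series →ₐ[ℂ] Series, ρ t = S ∧ ρ (σ t) = t := by
  obtain ⟨h0, h1⟩ := hasOrd_one_iff.1 hS
  have hu : IsUnit (PowerSeries.coeff 1 S) := isUnit_iff_ne_zero.2 h1
  refine ⟨reparam (S.substInvOfIsUnit hu) (by simp), ?_, ?_, reparam S h0, by simp, ?_⟩
  · rw [reparam_t, hasOrd_one_iff]
    refine ⟨by simp, ?_⟩
    rw [PowerSeries.coeff_one_substInvOfIsUnit]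
    exact Units.ne_zero _
  · rw [reparam_apply, PowerSeries.subst_substInvOfIsUnit_right _ h0]
  · rw [reparam_t, reparam_apply, PowerSeries.subst_substInvOfIsUnit_left _ h0]

theorem exists_root_of_unity_factor {N : ℕ} (hN : 0 < N) {a : Series} (ha : IsUnit a) :
    ∃ c : ℂ, c ≠ 0 ∧ c ^ N = PowerSeries.constantCoeff a := by
  rw [PowerSeries.isUnit_iff_constantCoeff, isUnit_iff_ne_zero] at ha
  obtain ⟨c, hc⟩ := IsAlgClosed.exists_pow_nat_eq (PowerSeries.constantCoeff a) hN
  refine ⟨c, ?_, hc⟩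
  rintro rfl
  rw [zero_pow hN.ne'] at hc
  exact ha hc.symm

/-- After a reparametrization, a series of order `N > 0` becomes `t ^ N`. -/
theorem exists_normalize {F : Series} {N : ℕ} (hN : 0 < N) (hF : HasOrd F N) :
    ∃ σ : Series →ₐ[ℂ] Series, HasOrd (σ t) 1 ∧ σ F = t ^ N := by
  obtain ⟨a, ha, rfl⟩ := hF
  obtain ⟨c, hc, hca⟩ := exists_root_of_unity_factor hN ha
  obtain ⟨A, rfl, hA⟩ := exists_series_root hN hc hca.symm
  have hAu : IsUnit A := by
    rw [PowerSeries.isUnit_iff_constantCoeff, isUnit_iff_ne_zero, hA]; exact hc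
  obtain ⟨σ, h1, h2, -⟩ := exists_reparam (S := t * A) ⟨A, hAu, by simp⟩
  exact ⟨σ, h1, by rw [← mul_pow, map_pow, h2]⟩

theorem dvd_sub_of_pow_sub {A B : Series} {N K : ℕ} (hN : 0 < N) (hA : IsUnit A)
    (h0 : PowerSeries.constantCoeff A = PowerSeries.constantCoeff B)
    (h : t ^ K ∣ A ^ N - B ^ N) : t ^ K ∣ A - B := by
  rw [← geom_sum₂_mul] at h
  refine (IsUnit.dvd_mul_left ?_).1 h
  rw [PowerSeries.isUnit_iff_constantCoeff, isUnit_iff_ne_zero] at hA ⊢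
  simp only [map_sum, map_mul, map_pow, ← h0]
  have : ∀ i ∈ Finset.range N, PowerSeries.constantCoeff A ^ i *
      PowerSeries.constantCoeff A ^ (N - 1 - i) = PowerSeries.constantCoeff A ^ (N - 1) := by
    intro i hi
    rw [Finset.mem_range] at hi
    rw [← pow_add]; congr 1; omega
  rw [Finset.sum_congr rfl this]
  simp [hA, hN.ne']

/-- The arcs `α` and `β` have order `N` with respect to `x` and they agree up to order `K`: the
quotient `x ∘ α / x ∘ β` is congruent to `1` and `y ∘ α` to `y ∘ β` modulo `t ^ K`. This notion is
invariant under changes of coordinates which preserve `Z(x)`, and `K / N` under ramifications. -/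
structure Close (α β : Arc) (N K : ℕ) : Prop where
  ord_left : HasOrd (α x) N
  ord_right : HasOrd (β x) N
  dvd_x : t ^ (N + K) ∣ α x - β x
  dvd_y : t ^ K ∣ α y - β y

theorem Close.pos {α β : Arc} {N K : ℕ} (h : Close α β N K) : 0 < N :=
  h.ord_left.pos (by simp [constantCoeff_arc])

theorem Close.map {α β : Arc} {N K m : ℕ} (h : Close α β N K) {σ : Series →ₐ[ℂ] Series}
    (hσ : HasOrd (σ t) m) : Close (σ.comp α) (σ.comp β) (m * N) (m * K) where
  ord_left := h.ord_left.map hσ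
  ord_right := h.ord_right.map hσ
  dvd_x := by simpa [mul_add] using dvd_map hσ h.dvd_x
  dvd_y := by simpa using dvd_map hσ h.dvd_y

theorem dvd_mul_sub_mul {a a' b b' : Series} {M N K : ℕ} (ha : t ^ M ∣ a) (hb : t ^ N ∣ b')
    (h : t ^ (M + K) ∣ a - a') (h' : t ^ (N + K) ∣ b - b') :
    t ^ (M + N + K) ∣ a * b - a' * b' := by
  have e : a * b - a' * b' = a * (b - b') + (a - a') * b' := by ring
  rw [e]
  refine dvd_add ?_ ?_
  · rw [add_assoc, pow_add]; exact mul_dvd_mul ha h'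
  · rw [show M + N + K = (M + K) + N by ring, pow_add]; exact mul_dvd_mul h hb

theorem pow_mul_dvd_pow {a : Series} {M : ℕ} (ha : t ^ M ∣ a) (n : ℕ) : t ^ (n * M) ∣ a ^ n := by
  rw [mul_comm, pow_mul]; exact pow_dvd_pow_of_dvd ha n

theorem dvd_pow_sub_pow {a b : Series} {M K : ℕ} (ha : t ^ M ∣ a) (hb : t ^ M ∣ b)
    (h : t ^ (M + K) ∣ a - b) (n : ℕ) : t ^ (n * M + K) ∣ a ^ n - b ^ n := by
  induction n with
  | zero => simp
  | succ n ih =>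
    have := dvd_mul_sub_mul (pow_mul_dvd_pow ha n) hb ih h
    rw [← pow_succ, ← pow_succ] at this
    rwa [show (n + 1) * M + K = n * M + M + K by ring]

/-- Congruent series of the same order can be normalized by congruent reparametrizations. -/
theorem exists_normalize_pair {F G : Series} {N K : ℕ} (hN : 0 < N) (hF : HasOrd F N)
    (hG : HasOrd G N) (h : t ^ (N + K) ∣ F - G) :
    ∃ σ τ : Series →ₐ[ℂ] Series, HasOrd (σ t) 1 ∧ HasOrd (τ t) 1 ∧ σ F = t ^ N ∧ τ G = t ^ N ∧
      t ^ (1 + K) ∣ σ t - τ t := by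
  rcases Nat.eq_zero_or_pos K with rfl | hK
  · obtain ⟨σ, h1, h2⟩ := exists_normalize hN hF
    obtain ⟨τ, h3, h4⟩ := exists_normalize hN hG
    refine ⟨σ, τ, h1, h3, h2, h4, ?_⟩
    exact dvd_sub ((h1.dvd_iff _).2 le_rfl) ((h3.dvd_iff _).2 le_rfl)
  obtain ⟨a, ha, rfl⟩ := hF
  obtain ⟨b, hb, rfl⟩ := hG
  rw [← mul_sub, pow_add] at h
  replace h := (mul_dvd_mul_iff_left (pow_ne_zero N PowerSeries.X_ne_zero)).1 h
  obtain ⟨c, hc, hca⟩ := exists_root_of_unity_factor hN ha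
  have hab : PowerSeries.constantCoeff a = PowerSeries.constantCoeff b := by
    have := PowerSeries.X_dvd_iff.1 ((dvd_pow_self t hK.ne').trans h)
    rwa [map_sub, sub_eq_zero] at this
  obtain ⟨A, rfl, hA⟩ := exists_series_root hN hc hca.symm
  obtain ⟨B, rfl, hB⟩ := exists_series_root hN hc (hca.trans hab).symm
  have hAu : IsUnit A := by
    rw [PowerSeries.isUnit_iff_constantCoeff, isUnit_iff_ne_zero, hA]; exact hc
  have hBu : IsUnit B := by
    rw [PowerSeries.isUnit_iff_constantCoeff, isUnit_iff_ne_zero, hB]; exact hc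
  have hAB : t ^ K ∣ A - B := dvd_sub_of_pow_sub hN hAu (hA.trans hB.symm) h
  obtain ⟨σ, h1, h2, ρ, h3, h4⟩ := exists_reparam (S := t * A) ⟨A, hAu, by simp⟩
  obtain ⟨τ, h5, h6, ρ', h7, h8⟩ := exists_reparam (S := t * B) ⟨B, hBu, by simp⟩
  refine ⟨σ, τ, h1, h5, by rw [← mul_pow, map_pow, h2], by rw [← mul_pow, map_pow, h6], ?_⟩
  have hρ : HasOrd (ρ t) 1 := by rw [h3]; exact ⟨A, hAu, by simp⟩
  -- the inverse reparametrizations `ρ` and `ρ'` are congruent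
  have hρρ : t ^ (1 + K) ∣ ρ' t - ρ t := by
    rw [h3, h7, ← mul_sub, pow_add, pow_one]
    exact mul_dvd_mul_left _ (dvd_sub_comm.1 hAB)
  refine dvd_of_dvd_map (m := 1) hρ ?_
  rw [map_sub, h4, one_mul]
  have := series_dvd_sub ρ' ρ hρρ (τ t)
  rwa [h8] at this

theorem dvd_map_sub_map {σ τ : Series →ₐ[ℂ] Series} {D K : ℕ} (hσ : HasOrd (σ t) 1)
    (hτ : HasOrd (τ t) 1) (h : t ^ (1 + K) ∣ σ t - τ t) {F G : Series} (hF : t ^ D ∣ F)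
    (hFG : t ^ (D + K) ∣ F - G) : t ^ (D + K) ∣ σ F - τ G := by
  have hG : t ^ D ∣ G := by
    have := dvd_sub hF ((pow_dvd_pow t (Nat.le_add_right D K)).trans hFG)
    rwa [sub_sub_cancel] at this
  have e : σ F - τ G = σ (F - G) + (σ G - τ G) := by rw [map_sub]; ring
  rw [e]
  refine dvd_add (by simpa using dvd_map hσ hFG) ?_
  obtain ⟨G', rfl⟩ := hG
  rw [map_mul, map_mul, map_pow, map_pow]
  have h1 := (hσ.dvd_iff 1).2 le_rfl
  have h2 := (hτ.dvd_iff 1).2 le_rfl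
  have := dvd_mul_sub_mul (N := 0) (K := K) (pow_mul_dvd_pow h1 D) (by simp)
    (dvd_pow_sub_pow h1 h2 h D) (b := σ G') (b' := τ G')
    (by rw [zero_add]; exact series_dvd_sub σ τ ((pow_dvd_pow t (Nat.le_add_left K 1)).trans h) _)
  simpa using this

/-- Two close arcs can be normalized simultaneously, without becoming less close. -/
theorem Close.exists_normalize {α β : Arc} {N K : ℕ} (h : Close α β N K) :
    ∃ σ τ : Series →ₐ[ℂ] Series, HasOrd (σ t) 1 ∧ HasOrd (τ t) 1 ∧ σ (α x) = t ^ N ∧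
      τ (β x) = t ^ N ∧ t ^ K ∣ σ (α y) - τ (β y) := by
  obtain ⟨σ, τ, h1, h2, h3, h4, h5⟩ :=
    exists_normalize_pair h.pos h.ord_left h.ord_right h.dvd_x
  refine ⟨σ, τ, h1, h2, h3, h4, ?_⟩
  simpa using dvd_map_sub_map (D := 0) h1 h2 h5 (by simp) (by simpa using h.dvd_y)

/-! ### Conjugate arcs and the ideal of an arc -/

instance : IsDomain FormalRing := NoZeroDivisors.to_isDomain _

/-- The exponent of the monomial `x ^ a * y ^ b`. -/
def expo (a b : ℕ) : Fin 2 →₀ ℕ := Finsupp.single 0 a + Finsupp.single 1 b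

@[simp] theorem expo_zero (a b : ℕ) : expo a b 0 = a := by simp [expo]

@[simp] theorem expo_one (a b : ℕ) : expo a b 1 = b := by simp [expo]

theorem expo_eta (m : Fin 2 →₀ ℕ) : expo (m 0) (m 1) = m := by
  ext i; fin_cases i <;> simp

theorem expo_ext {m n : Fin 2 →₀ ℕ} (h0 : m 0 = n 0) (h1 : m 1 = n 1) : m = n := by
  rw [← expo_eta m, ← expo_eta n, h0, h1]

theorem x_pow_mul_y_pow (a b : ℕ) :
    x ^ a * y ^ b = MvPowerSeries.monomial (expo a b) (1 : ℂ) := by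
  rw [x, y, MvPowerSeries.X_pow_eq, MvPowerSeries.X_pow_eq, MvPowerSeries.monomial_mul_monomial,
    one_mul, expo]

theorem coeff_inX (g : Series) (m : Fin 2 →₀ ℕ) :
    MvPowerSeries.coeff m (inX g) = if m 1 = 0 then PowerSeries.coeff (m 0) g else 0 := by
  classical
  rw [inX, PowerSeries.coe_substAlgHom, x, PowerSeries.coeff_subst_single]
  congr 1
  apply propext
  constructor
  · intro h; rw [h]; simp
  · intro h; exact expo_ext (by simp) (by simpa using h)

theorem exists_eq_inX_add (F : FormalRing) : ∃ (g : Series) (F₂ : FormalRing),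
    F = inX g + y * F₂ := by
  let g : Series := PowerSeries.mk fun n => MvPowerSeries.coeff (expo n 0) F
  have : y ∣ F - inX g := by
    rw [y, MvPowerSeries.X_dvd_iff]
    intro m hm
    rw [map_sub, coeff_inX, if_pos hm, PowerSeries.coeff_mk, ← hm, expo_eta, sub_self]
  obtain ⟨F₂, h⟩ := this
  exact ⟨g, F₂, by rw [← h]; ring⟩

theorem arc_comp_inX (α : Arc) (h : α x = t) (g : Series) : α (inX g) = g := by
  have : α.comp inX = AlgHom.id ℂ Series := seriesEndo_ext (by simpa using h)
  exact DFunLike.congr_fun this g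

theorem arc_inX (α : Arc) {σ : Series →ₐ[ℂ] Series} (h : α x = σ t) (g : Series) :
    α (inX g) = σ g := by
  have : α.comp inX = σ := seriesEndo_ext (by simpa using h)
  exact DFunLike.congr_fun this g

/-- The ideal of the graph `y = η(x)`. -/
theorem mkArc_eq_zero_iff (η : Series) (hη : PowerSeries.constantCoeff η = 0) (h : FormalRing) :
    mkArc t η (by simp) hη h = 0 ↔ y - inX η ∣ h := by
  have h0 : ∀ F, mkArc t 0 (by simp) (map_zero _) F = 0 → y ∣ F := by
    intro F hF
    obtain ⟨g, F₂, rfl⟩ := exists_eq_inX_add F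
    rw [map_add, map_mul, arc_comp_inX _ (by simp)] at hF
    simp only [mkArc_y, zero_mul, add_zero] at hF
    simp [hF]
  constructor
  · intro hh
    have c1 : MvPowerSeries.constantCoeff (y + inX η) = 0 := by simp [constantCoeff_inX, hη]
    have c2 : MvPowerSeries.constantCoeff (y - inX η) = 0 := by simp [constantCoeff_inX, hη]
    let s := mkEndo x (y + inX η) (by simp) c1
    let s' := mkEndo x (y - inX η) (by simp) c2
    have e1 : (mkArc t 0 (by simp) (map_zero _)).comp s = mkArc t η (by simp) hη := by
      apply arc_ext <;> simp [s, arc_comp_inX]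
    have e2 : s'.comp s = AlgHom.id ℂ FormalRing := by
      have : s'.comp inX = inX := by
        apply seriesAlgHom_ext_of_local
        · exact not_isUnit_formal (by simp [s'])
        · simp [s']
      have this' : s' (inX η) = inX η := DFunLike.congr_fun this η
      apply endo_ext
      · simp [s, s']
      · simp only [AlgHom.comp_apply, AlgHom.id_apply, s, mkEndo_y, map_add, this']
        simp [s']
    obtain ⟨G, hG⟩ := h0 (s h) (by
      rw [← AlgHom.comp_apply, e1, hh])
    refine ⟨s' G, ?_⟩
    have := DFunLike.congr_fun e2 h
    rw [AlgHom.comp_apply, hG, map_mul] at this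
    rw [AlgHom.id_apply] at this
    rw [← this]
    simp [s']
  · rintro ⟨G, rfl⟩
    rw [map_mul, map_sub, arc_comp_inX _ (by simp)]
    simp

theorem prime_y_sub_inX (η : Series) (hη : PowerSeries.constantCoeff η = 0) :
    Prime (y - inX η) := by
  have hne : y - inX η ≠ 0 := by
    intro h
    have := congrArg (MvPowerSeries.coeff (expo 0 1)) h
    rw [map_sub, coeff_inX] at this
    rw [y, MvPowerSeries.coeff_X] at this
    simp [expo] at this
  rw [← Ideal.span_singleton_prime hne]
  have : Ideal.span {y - inX η} = RingHom.ker (mkArc t η (by simp) hη) := by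
    ext h
    rw [Ideal.mem_span_singleton, RingHom.mem_ker, mkArc_eq_zero_iff]
  rw [this]
  exact RingHom.ker_isPrime _

/-- The endomorphism `x ↦ x ^ n`, `y ↦ y` of `ℂ[[x, y]]`. -/
def expandX (n : ℕ) (hn : 0 < n) : FormalRing →ₐ[ℂ] FormalRing :=
  mkEndo (x ^ n) y (by simp [hn.ne']) (by simp)

theorem coeff_expandX (n : ℕ) (hn : 0 < n) (F : FormalRing) (m : Fin 2 →₀ ℕ) :
    MvPowerSeries.coeff m (expandX n hn F) =
      if n ∣ m 0 then MvPowerSeries.coeff (expo (m 0 / n) (m 1)) F else 0 := by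
  classical
  rw [expandX, mkEndo, MvPowerSeries.substAlgHom_apply, MvPowerSeries.coeff_subst]
  swap
  · exact hasSubst_pair (by simp [hn.ne']) (by simp)
  have hmon : ∀ d : Fin 2 →₀ ℕ, MvPowerSeries.coeff m (d.prod fun s e => ![x ^ n, y] s ^ e) =
      if m = expo (n * d 0) (d 1) then 1 else 0 := by
    intro d
    rw [Finsupp.prod_fintype _ _ (by simp), Fin.prod_univ_two]
    simp only [Matrix.cons_val_zero, Matrix.cons_val_one]
    rw [← pow_mul, x_pow_mul_y_pow, MvPowerSeries.coeff_monomial]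
  simp_rw [hmon]
  split_ifs with h
  · obtain ⟨k, hk⟩ := h
    rw [finsum_eq_single _ (expo (m 0 / n) (m 1))]
    · rw [if_pos]
      · simp
      · apply expo_ext
        · rw [expo_zero, expo_zero, hk, Nat.mul_div_cancel_left _ hn]
        · simp
    · intro d hd
      rw [if_neg, smul_zero]
      intro e
      apply hd
      have h0 := DFunLike.congr_fun e 0
      have h1 := DFunLike.congr_fun e 1
      rw [expo_zero] at h0
      rw [expo_one] at h1
      apply expo_ext
      · rw [expo_zero, h0, Nat.mul_div_cancel_left _ hn]
      · rw [expo_one, h1]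
  · apply finsum_eq_zero_of_forall_eq_zero
    intro d
    rw [if_neg, smul_zero]
    intro e
    apply h
    rw [e, expo_zero]
    exact dvd_mul_right _ _

theorem expandX_injective (n : ℕ) (hn : 0 < n) : Function.Injective (expandX n hn) := by
  rw [injective_iff_map_eq_zero]
  intro F hF
  ext m
  have := congrArg (MvPowerSeries.coeff (expo (n * m 0) (m 1))) hF
  rw [coeff_expandX] at this
  simpa [hn, expo_eta] using this

/-- The rotation `x ↦ ω x`. -/
def rotX (ω : ℂ) : FormalRing →ₐ[ℂ] FormalRing :=
  mkEndo (MvPowerSeries.C ω * x) y (by simp) (by simp)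

theorem coeff_rotX (ω : ℂ) (F : FormalRing) (m : Fin 2 →₀ ℕ) :
    MvPowerSeries.coeff m (rotX ω F) = ω ^ m 0 * MvPowerSeries.coeff m F := by
  have : rotX ω = MvPowerSeries.rescaleAlgHom ![ω, 1] := by
    apply endo_ext
    · rw [rotX, mkEndo_x, MvPowerSeries.rescaleAlgHom_apply]
      ext m
      rw [MvPowerSeries.coeff_rescale, MvPowerSeries.coeff_C_mul, x, MvPowerSeries.coeff_X]
      split_ifs with h
      · simp [h]
      · simp
    · rw [rotX, mkEndo_y, MvPowerSeries.rescaleAlgHom_apply]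
      ext m
      rw [MvPowerSeries.coeff_rescale, y, MvPowerSeries.coeff_X]
      split_ifs with h
      · simp [h]
      · simp
  rw [this, MvPowerSeries.rescaleAlgHom_apply, MvPowerSeries.coeff_rescale,
    Finsupp.prod_fintype _ _ (by simp), Fin.prod_univ_two]
  simp

theorem exists_expandX_eq {n : ℕ} (hn : 0 < n) {ω : ℂ} (hω : IsPrimitiveRoot ω n)
    {G : FormalRing} (hG : rotX ω G = G) : ∃ f, expandX n hn f = G := by
  let f : FormalRing := fun m => MvPowerSeries.coeff (expo (n * m 0) (m 1)) G
  have hf : ∀ m, MvPowerSeries.coeff m f = MvPowerSeries.coeff (expo (n * m 0) (m 1)) G :=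
    fun _ => rfl
  refine ⟨f, ?_⟩
  ext m
  rw [coeff_expandX]
  split_ifs with h
  · obtain ⟨k, hk⟩ := h
    rw [hf, expo_zero, expo_one, hk, Nat.mul_div_cancel_left _ hn, ← hk, expo_eta]
  · have h1 := congrArg (MvPowerSeries.coeff m) hG
    rw [coeff_rotX] at h1
    have h2 : (ω ^ m 0 - 1) * MvPowerSeries.coeff m G = 0 := by linear_combination h1
    rcases mul_eq_zero.1 h2 with h3 | h3
    · exact absurd ((hω.pow_eq_one_iff_dvd _).1 (sub_eq_zero.1 h3)) h
    · exact h3.symm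

open Classical in
/-- The conjugates `ζ(ω t)`, `ω ^ n = 1`, of a series `ζ`. -/
def conjugates (n : ℕ) (ζ : Series) : Finset Series :=
  (Polynomial.nthRootsFinset n (1 : ℂ)).image fun ω => monoEndo ω 1 one_pos ζ

theorem mem_conjugates {n : ℕ} (hn : 0 < n) {ζ η : Series} :
    η ∈ conjugates n ζ ↔ ∃ ω : ℂ, ω ^ n = 1 ∧ monoEndo ω 1 one_pos ζ = η := by
  simp [conjugates, Polynomial.mem_nthRootsFinset hn]

theorem self_mem_conjugates {n : ℕ} (hn : 0 < n) (ζ : Series) : ζ ∈ conjugates n ζ := by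
  rw [mem_conjugates hn]
  refine ⟨1, one_pow _, ?_⟩
  have : monoEndo 1 1 one_pos = AlgHom.id ℂ Series := seriesEndo_ext (by simp)
  rw [this]; rfl

theorem ne_zero_of_pow_eq_one {n : ℕ} (hn : 0 < n) {ω : ℂ} (h : ω ^ n = 1) : ω ≠ 0 := by
  rintro rfl
  rw [zero_pow hn.ne'] at h
  exact zero_ne_one h

theorem image_conjugates {n : ℕ} (hn : 0 < n) {ω : ℂ} (hω : ω ^ n = 1) (ζ : Series)
    [DecidableEq Series] :
    (conjugates n ζ).image (monoEndo ω 1 one_pos) = conjugates n ζ := by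
  apply Finset.eq_of_subset_of_card_le
  · intro η hη
    rw [Finset.mem_image] at hη
    obtain ⟨η', h, rfl⟩ := hη
    rw [mem_conjugates hn] at h ⊢
    obtain ⟨ω', h', rfl⟩ := h
    refine ⟨ω * ω', by rw [mul_pow, hω, h', one_mul], ?_⟩
    have : monoEndo (ω * ω') 1 one_pos =
        (monoEndo ω 1 one_pos).comp (monoEndo ω' 1 one_pos) := by
      apply seriesEndo_ext
      simp [endo_C]
      ring
    rw [this]; rfl
  · rw [Finset.card_image_of_injective]
    exact endo_injective (hasOrd_monoEndo (ne_zero_of_pow_eq_one hn hω) 1 one_pos).ne_zero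

/-- The product of the conjugates of `y - ζ` is a series in `x ^ n` and `y`. -/
theorem exists_expandX_eq_prod {n : ℕ} (hn : 0 < n) (ζ : Series) :
    ∃ f, expandX n hn f = ∏ η ∈ conjugates n ζ, (y - inX η) := by
  classical
  have hω := Complex.isPrimitiveRoot_exp n hn.ne'
  set ω := Complex.exp (2 * Real.pi * Complex.I / n)
  apply exists_expandX_eq hn hω
  have hinX : ∀ η, rotX ω (inX η) = inX (monoEndo ω 1 one_pos η) := by
    have : (rotX ω).comp inX = inX.comp (monoEndo ω 1 one_pos) := by
      apply seriesAlgHom_ext_of_local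
      · exact not_isUnit_formal (by simp [constantCoeff_endo])
      · have : inX (PowerSeries.C ω) = MvPowerSeries.C ω := by
          rw [← algebraMap_series, AlgHom.commutes, algebraMap_formal]
        simp [rotX, this]
    exact fun η => DFunLike.congr_fun this η
  rw [map_prod]
  have : ∀ η, rotX ω (y - inX η) = y - inX (monoEndo ω 1 one_pos η) := by
    intro η; rw [map_sub, hinX]; simp [rotX]
  simp_rw [this]
  conv_rhs => rw [← image_conjugates hn hω.pow_eq_one ζ]
  rw [Finset.prod_image]
  intro a _ b _ h
  exact endo_injective (hasOrd_monoEndo (ne_zero_of_pow_eq_one hn hω.pow_eq_one) 1 one_pos).ne_zero h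

theorem conj_constantCoeff {n : ℕ} (hn : 0 < n) {ζ η : Series}
    (hζ : PowerSeries.constantCoeff ζ = 0) (h : η ∈ conjugates n ζ) :
    PowerSeries.constantCoeff η = 0 := by
  obtain ⟨ω, -, rfl⟩ := (mem_conjugates hn).1 h
  rw [constantCoeff_seriesEndo, hζ]

/-- An equation of the image of the arc `t ↦ (t ^ n, ζ(t))`, evaluated along another arc. -/
theorem monoEndo_arc_eq_prod {n : ℕ} (hn : 0 < n) {ζ : Series} {f : FormalRing}
    (hf : expandX n hn f = ∏ η ∈ conjugates n ζ, (y - inX η)) {β : Arc} {N : ℕ} (hN : 0 < N)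
    (hβ : β x = t ^ N) :
    monoEndo 1 n hn (β f) =
      ∏ η ∈ conjugates n ζ, (monoEndo 1 n hn (β y) - monoEndo 1 N hN η) := by
  let γ := mkArc (t ^ N) (monoEndo 1 n hn (β y)) (by simp [hN.ne'])
    (by simp [constantCoeff_seriesEndo, constantCoeff_arc])
  have e : γ.comp (expandX n hn) = (monoEndo 1 n hn).comp β := by
    apply arc_ext
    · simp [γ, expandX, hβ, ← pow_mul, mul_comm]
    · simp [γ, expandX]
  have := DFunLike.congr_fun e f
  simp only [AlgHom.comp_apply] at this
  rw [← this, hf, map_prod]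
  refine Finset.prod_congr rfl fun η _ => ?_
  rw [map_sub, arc_inX γ (σ := monoEndo 1 N hN) (by simp [γ])]
  simp [γ]

theorem arc_eq_zero_of_expandX_eq_prod {n : ℕ} (hn : 0 < n) {α : Arc} (hα : α x = t ^ n)
    {f : FormalRing} (hf : expandX n hn f = ∏ η ∈ conjugates n (α y), (y - inX η)) : α f = 0 := by
  apply endo_injective (hasOrd_monoEndo one_ne_zero n hn).ne_zero
  rw [monoEndo_arc_eq_prod hn hf hn hα, map_zero]
  exact Finset.prod_eq_zero (self_mem_conjugates hn _) (sub_self _)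

/-- A normalized arc on the curve of a normalized arc `α₀` is, after a ramification, a conjugate of
`α₀`. -/
theorem exists_conj {n N : ℕ} (hn : 0 < n) (hN : 0 < N) {α₀ α : Arc} (h₀ : α₀ x = t ^ n)
    (h : α x = t ^ N) (hker : RingHom.ker α₀ ≤ RingHom.ker α) :
    ∃ ω : ℂ, ω ^ n = 1 ∧ (monoEndo 1 n hn).comp α = (monoEndo ω N hN).comp α₀ := by
  obtain ⟨f, hf⟩ := exists_expandX_eq_prod hn (α₀ y)
  have hf0 : α f = 0 := hker (arc_eq_zero_of_expandX_eq_prod hn h₀ hf)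
  have h1 := monoEndo_arc_eq_prod hn hf hN h
  rw [hf0, map_zero] at h1
  obtain ⟨η, hη, e⟩ := Finset.prod_eq_zero_iff.1 h1.symm
  obtain ⟨ω, hω, rfl⟩ := (mem_conjugates hn).1 hη
  have e2 : (monoEndo 1 N hN).comp (monoEndo ω 1 one_pos) = monoEndo ω N hN := by
    apply seriesEndo_ext; simp [endo_C]
  refine ⟨ω, hω, arc_ext ?_ ?_⟩
  · rw [AlgHom.comp_apply, AlgHom.comp_apply, h, h₀, monoEndo_t_pow, monoEndo_t_pow, hω, one_pow,
      mul_comm n]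
  · rw [AlgHom.comp_apply, AlgHom.comp_apply, sub_eq_zero.1 e, ← e2]; rfl

theorem prod_dvd_of_prime {M : Type*} [CommRing M] [IsDomain M] {ι : Type*} {s : Finset ι}
    (p : ι → M) (hp : ∀ i ∈ s, Prime (p i))
    (hpp : ∀ i ∈ s, ∀ j ∈ s, p i ∣ p j → i = j) {h : M} (hd : ∀ i ∈ s, p i ∣ h) :
    ∏ i ∈ s, p i ∣ h := by
  classical
  induction s using Finset.induction_on with
  | empty => simp
  | insert a s ha ih =>
    obtain ⟨m, rfl⟩ := ih (fun i hi => hp i (Finset.mem_insert_of_mem hi))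
      (fun i hi j hj => hpp i (Finset.mem_insert_of_mem hi) j (Finset.mem_insert_of_mem hj))
      (fun i hi => hd i (Finset.mem_insert_of_mem hi))
    have hpa := hp a (Finset.mem_insert_self _ _)
    rw [Finset.prod_insert ha, mul_comm]
    refine mul_dvd_mul_left _ ?_
    rcases hpa.dvd_or_dvd (hd a (Finset.mem_insert_self _ _)) with h1 | h1
    · obtain ⟨j, hj, hd'⟩ := (Prime.dvd_finsetProd_iff hpa _).1 h1
      have := hpp a (Finset.mem_insert_self _ _) j (Finset.mem_insert_of_mem hj) hd'
      exact absurd (this ▸ hj) ha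
    · exact h1

theorem exists_prime_ker_of_normalized {n : ℕ} (hn : 0 < n) {α : Arc} (hα : α x = t ^ n) :
    ∃ p, Prime p ∧ RingHom.ker α = Ideal.span {p} := by
  obtain ⟨f, hf⟩ := exists_expandX_eq_prod hn (α y)
  have hαy : PowerSeries.constantCoeff (α y) = 0 := by simp [constantCoeff_arc]
  have hω := Complex.isPrimitiveRoot_exp n hn.ne'
  set ω := Complex.exp (2 * Real.pi * Complex.I / n)
  have hker : RingHom.ker α = Ideal.span {f} := by
    apply le_antisymm
    · intro h hh
      rw [RingHom.mem_ker] at hh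
      rw [Ideal.mem_span_singleton]
      have hd : ∏ η ∈ conjugates n (α y), (y - inX η) ∣ expandX n hn h := by
        apply prod_dvd_of_prime
        · intro η hη; exact prime_y_sub_inX η (conj_constantCoeff hn hαy hη)
        · intro η hη η' hη' hd
          rw [← mkArc_eq_zero_iff η (conj_constantCoeff hn hαy hη), map_sub, mkArc_y,
            arc_comp_inX _ (by simp)] at hd
          exact sub_eq_zero.1 hd
        · intro η hη
          rw [← mkArc_eq_zero_iff η (conj_constantCoeff hn hαy hη)]
          have hη' := hη
          obtain ⟨ω', h', e⟩ := (mem_conjugates hn).1 hη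
          have e2 : (mkArc t η (by simp) (conj_constantCoeff hn hαy hη)).comp (expandX n hn) =
              (monoEndo ω' 1 one_pos).comp α := by
            apply arc_ext
            · rw [AlgHom.comp_apply, AlgHom.comp_apply, expandX, mkEndo_x, map_pow, mkArc_x, hα,
                monoEndo_t_pow, h', map_one, one_mul, one_mul]
            · simp [expandX, e]
          have := DFunLike.congr_fun e2 h
          simpa [hh] using this
      obtain ⟨q, hq⟩ := hd
      have hrot : (rotX ω).comp (expandX n hn) = expandX n hn := by
        apply endo_ext
        · rw [AlgHom.comp_apply, expandX, mkEndo_x, map_pow, rotX, mkEndo_x, mul_pow, ← map_pow,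
            hω.pow_eq_one, map_one, one_mul]
        · simp [expandX, rotX]
      have hF : rotX ω (expandX n hn f) = expandX n hn f := DFunLike.congr_fun hrot f
      have hH : rotX ω (expandX n hn h) = expandX n hn h := DFunLike.congr_fun hrot h
      rw [← hf] at hq
      have hf0 : expandX n hn f ≠ 0 := by
        rw [hf, Finset.prod_ne_zero_iff]
        intro η hη
        exact (prime_y_sub_inX η (conj_constantCoeff hn hαy hη)).ne_zero
      have hq2 : rotX ω q = q := by
        rw [hq, map_mul, hF] at hH
        exact mul_left_cancel₀ hf0 hH
      obtain ⟨q', rfl⟩ := exists_expandX_eq hn hω hq2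
      refine ⟨q', expandX_injective n hn ?_⟩
      rw [hq, map_mul]
    · rw [Ideal.span_singleton_le_iff_mem, RingHom.mem_ker]
      exact arc_eq_zero_of_expandX_eq_prod hn hα hf
  refine ⟨f, ?_, hker⟩
  have hf0 : f ≠ 0 := by
    rintro rfl
    rw [map_zero] at hf
    refine Finset.prod_ne_zero_iff.2 (fun η hη => ?_) hf.symm
    exact (prime_y_sub_inX η (conj_constantCoeff hn hαy hη)).ne_zero
  rw [← Ideal.span_singleton_prime hf0, ← hker]
  exact RingHom.ker_isPrime _

theorem ker_comp_of_ne_zero (α : Arc) {σ : Series →ₐ[ℂ] Series} (hσ : σ t ≠ 0) :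
    RingHom.ker (σ.comp α) = RingHom.ker α := by
  ext F
  simp only [RingHom.mem_ker, AlgHom.comp_apply]
  rw [map_eq_zero_iff σ (endo_injective hσ)]

theorem exists_normalize_arc (α : Arc) (hα : α x ≠ 0) : ∃ (σ : Series →ₐ[ℂ] Series) (n : ℕ),
    0 < n ∧ HasOrd (σ t) 1 ∧ (σ.comp α) x = t ^ n := by
  obtain ⟨n, hn⟩ := exists_hasOrd hα
  have hn0 := hn.pos (by simp [constantCoeff_arc])
  obtain ⟨σ, h1, h2⟩ := exists_normalize hn0 hn
  exact ⟨σ, n, hn0, h1, h2⟩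

/-- The ideal of an arc which is not contained in `Z(x)` is principal and prime. -/
theorem exists_prime_ker (α : Arc) (hα : α x ≠ 0) :
    ∃ p, Prime p ∧ RingHom.ker α = Ideal.span {p} := by
  obtain ⟨σ, n, hn, hσ, h⟩ := exists_normalize_arc α hα
  rw [← ker_comp_of_ne_zero α hσ.ne_zero]
  exact exists_prime_ker_of_normalized hn h

/-- Every arc on the curve of an arc `α₀` factors through `α₀`, after a ramification. -/
theorem exists_factor (α₀ : Arc) (h₀ : α₀ x ≠ 0) {α : Arc} {N : ℕ} (hN : 0 < N)
    (h : α x = t ^ N) (hker : RingHom.ker α₀ ≤ RingHom.ker α) :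
    ∃ (m : ℕ) (hm : 0 < m) (σ : Series →ₐ[ℂ] Series), σ t ≠ 0 ∧
      (monoEndo 1 m hm).comp α = σ.comp α₀ := by
  obtain ⟨τ, n, hn, hτ, hn'⟩ := exists_normalize_arc α₀ h₀
  obtain ⟨ω, hω, e⟩ := exists_conj hn hN hn' h (by rwa [ker_comp_of_ne_zero _ hτ.ne_zero])
  refine ⟨n, hn, (monoEndo ω N hN).comp τ, ?_, e⟩
  exact (hτ.map (hasOrd_monoEndo (ne_zero_of_pow_eq_one hn hω) N hN)).ne_zero

/-! ### Newton-Puiseux roots and normalized arcs -/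

theorem monoEndo_one_eq_expand (m : ℕ) (hm : 0 < m) :
    monoEndo 1 m hm = PowerSeries.expand m hm.ne' := by
  apply seriesEndo_ext
  rw [monoEndo_t, t, PowerSeries.expand_X]
  simp

theorem coeff_puiseux (n : ℕ+) (ζ : Series) (k : ℕ) :
    (puiseux n ζ).coeff ((k : ℚ) / (n : ℕ)) = PowerSeries.coeff k ζ := by
  have : (k : ℚ) / (n : ℕ) = divEmb n k := rfl
  rw [puiseux, this, HahnSeries.embDomain_coeff, HahnSeries.coeff_toPowerSeries_symm]

theorem coeff_puiseux_of_forall_ne (n : ℕ+) (ζ : Series) {q : ℚ}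
    (hq : ∀ k : ℕ, q ≠ (k : ℚ) / (n : ℕ)) : (puiseux n ζ).coeff q = 0 := by
  rw [puiseux, HahnSeries.embDomain_of_notMem_range]
  rintro ⟨k, rfl⟩
  exact hq k rfl

theorem puiseux_expand (n m : ℕ+) (ζ : Series) :
    puiseux (n * m) (monoEndo 1 m m.pos ζ) = puiseux n ζ := by
  have hn : ((n : ℕ) : ℚ) ≠ 0 := by exact_mod_cast n.ne_zero
  have hm : ((m : ℕ) : ℚ) ≠ 0 := by exact_mod_cast m.ne_zero
  ext q
  rw [monoEndo_one_eq_expand]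
  by_cases h : ∃ k : ℕ, q = (k : ℚ) / ((n * m : ℕ+) : ℕ)
  · obtain ⟨k, rfl⟩ := h
    rw [coeff_puiseux, PowerSeries.coeff_expand]
    split_ifs with hd
    · obtain ⟨l, rfl⟩ := hd
      have : ((((m : ℕ) * l : ℕ) : ℚ)) / ((n * m : ℕ+) : ℕ) = (l : ℚ) / (n : ℕ) := by
        push_cast
        field_simp
      rw [this, coeff_puiseux, Nat.mul_div_cancel_left _ m.pos]
    · rw [coeff_puiseux_of_forall_ne]
      intro l hl
      apply hd
      refine ⟨l, ?_⟩
      push_cast at hl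
      field_simp at hl
      have : (k : ℚ) = ((m * l : ℕ) : ℚ) := by push_cast; linarith
      exact_mod_cast this
  · push Not at h
    rw [coeff_puiseux_of_forall_ne _ _ h, coeff_puiseux_of_forall_ne]
    intro k hk
    apply h (m * k)
    rw [hk]
    push_cast
    field_simp

theorem puiseux_sub (n : ℕ+) (ζ η : Series) :
    puiseux n ζ - puiseux n η = puiseux n (ζ - η) := by
  rw [sub_eq_iff_eq_add, puiseux, puiseux, puiseux, ← HahnSeries.embDomain_add, ← map_add,
    sub_add_cancel]

theorem puiseux_injective (n : ℕ+) : Function.Injective (puiseux n) := by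
  intro ζ η h
  ext k
  rw [← coeff_puiseux n, h, coeff_puiseux]

theorem puiseux_zero (n : ℕ+) : puiseux n 0 = 0 := by
  rw [← sub_self (0 : Series), ← puiseux_sub, sub_self]

theorem puiseuxOrder_of_hasOrd (n : ℕ+) {ζ : Series} {K : ℕ} (h : HasOrd ζ K) :
    puiseuxOrder (puiseux n ζ) = (K : ℝ≥0∞) / (n : ℕ) := by
  have hne : puiseux n ζ ≠ 0 := by
    rw [← puiseux_zero n]
    exact fun e => h.ne_zero (puiseux_injective n e)
  have hn : (0 : ℚ) < (n : ℕ) := by exact_mod_cast n.pos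
  have hcoeff : ∀ j < K, PowerSeries.coeff j ζ = 0 :=
    PowerSeries.X_pow_dvd_iff.1 ((h.dvd_iff K).2 le_rfl)
  have hK : PowerSeries.coeff K ζ ≠ 0 := by
    intro h0
    have : t ^ (K + 1) ∣ ζ := by
      rw [PowerSeries.X_pow_dvd_iff]
      intro j hj
      rcases Nat.lt_succ_iff_lt_or_eq.1 hj with h1 | rfl
      · exact hcoeff j h1
      · exact h0
    have := (h.dvd_iff _).1 this
    omega
  have hord : (puiseux n ζ).order = (K : ℚ) / (n : ℕ) := by
    apply le_antisymm
    · apply HahnSeries.order_le_of_coeff_ne_zero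
      rwa [coeff_puiseux]
    · rw [HahnSeries.order_of_ne hne]
      by_contra hlt
      push Not at hlt
      have h1 := HahnSeries.coeff_order_eq_zero.not.2 hne
      rw [HahnSeries.order_of_ne hne] at h1
      by_cases hq : ∃ k : ℕ, (Set.IsWF.min (puiseux n ζ).isWF_support
          (HahnSeries.support_nonempty_iff.2 hne)) = (k : ℚ) / (n : ℕ)
      · obtain ⟨k, hk⟩ := hq
        rw [hk] at hlt h1
        rw [coeff_puiseux] at h1
        apply h1
        apply hcoeff
        have := (div_lt_div_iff_of_pos_right hn).1 hlt
        exact_mod_cast this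
      · push Not at hq
        exact h1 (coeff_puiseux_of_forall_ne _ _ hq)
  rw [puiseuxOrder, if_neg hne, hord]
  push_cast
  rw [ENNReal.ofReal_div_of_pos (by exact_mod_cast hn)]
  simp

theorem mem_puiseuxRoots {P : Ideal FormalRing} {η : HahnSeries ℚ ℂ} :
    η ∈ puiseuxRoots P ↔ ∃ (n : ℕ+) (α : Arc), α x = t ^ (n : ℕ) ∧ P ≤ RingHom.ker α ∧
      η = puiseux n (α y) := by
  constructor
  · rintro ⟨n, ζ, hζ, rfl, h⟩
    refine ⟨n, mkArc (t ^ (n : ℕ)) ζ (by simp) hζ, by simp, ?_, by simp⟩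
    intro f hf
    rw [RingHom.mem_ker, mkArc_apply]
    exact h f hf
  · rintro ⟨n, α, hα, hP, rfl⟩
    have hy : PowerSeries.constantCoeff (α y) = 0 := by simp [constantCoeff_arc]
    refine ⟨n, α y, hy, rfl, fun f hf => ?_⟩
    have : α = mkArc (t ^ (n : ℕ)) (α y) (by simp) hy := by
      apply arc_ext <;> simp [hα]
    have h0 : α f = 0 := hP hf
    rw [this, mkArc_apply] at h0
    exact h0

theorem ker_le_ker_comp (α : Arc) (σ : Series →ₐ[ℂ] Series) :
    RingHom.ker α ≤ RingHom.ker (σ.comp α) := by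
  intro F hF
  rw [RingHom.mem_ker] at hF ⊢
  simp [hF]

/-- Two Newton-Puiseux roots, written with a common denominator. -/
theorem exists_arcs_of_roots {P Q : Ideal FormalRing} {ξ η : HahnSeries ℚ ℂ}
    (hξ : ξ ∈ puiseuxRoots P) (hη : η ∈ puiseuxRoots Q) :
    ∃ (N : ℕ+) (α β : Arc), α x = t ^ (N : ℕ) ∧ β x = t ^ (N : ℕ) ∧ P ≤ RingHom.ker α ∧
      Q ≤ RingHom.ker β ∧ ξ = puiseux N (α y) ∧ η = puiseux N (β y) := by
  obtain ⟨n, α, hα, hP, rfl⟩ := mem_puiseuxRoots.1 hξ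
  obtain ⟨m, β, hβ, hQ, rfl⟩ := mem_puiseuxRoots.1 hη
  refine ⟨n * m, (monoEndo 1 m m.pos).comp α, (monoEndo 1 n n.pos).comp β, ?_, ?_,
    hP.trans (ker_le_ker_comp _ _), hQ.trans (ker_le_ker_comp _ _), ?_, ?_⟩
  · rw [AlgHom.comp_apply, hα, monoEndo_t_pow]; simp [mul_comm]
  · rw [AlgHom.comp_apply, hβ, monoEndo_t_pow]; simp
  · rw [AlgHom.comp_apply, puiseux_expand]
  · rw [AlgHom.comp_apply, mul_comm, puiseux_expand]

theorem puiseux_mem_puiseuxRoots {P : Ideal FormalRing} (N : ℕ+) {α : Arc}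
    (hα : α x = t ^ (N : ℕ)) (hP : P ≤ RingHom.ker α) : puiseux N (α y) ∈ puiseuxRoots P :=
  mem_puiseuxRoots.2 ⟨N, α, hα, hP, rfl⟩

theorem le_puiseuxOrder_of_dvd (N : ℕ+) {ζ η : Series} {K : ℕ} (h : t ^ K ∣ ζ - η) :
    (K : ℝ≥0∞) / (N : ℕ) ≤ puiseuxOrder (puiseux N ζ - puiseux N η) := by
  rw [puiseux_sub]
  by_cases h0 : ζ - η = 0
  · rw [h0, puiseux_zero, puiseuxOrder, if_pos rfl]; exact le_top
  · obtain ⟨M, hM⟩ := exists_hasOrd h0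
    rw [puiseuxOrder_of_hasOrd N hM]
    have := (hM.dvd_iff K).1 h
    gcongr

/-- The order of coincidence is bounded below by the closeness of any two arcs. -/
theorem Close.le_coincidence {P Q : Ideal FormalRing} {α β : Arc} {N K : ℕ} (h : Close α β N K)
    (hP : P ≤ RingHom.ker α) (hQ : Q ≤ RingHom.ker β) :
    (K : ℝ≥0∞) / N ≤ coincidence P Q := by
  obtain ⟨σ, τ, h1, h2, h3, h4, h5⟩ := h.exists_normalize
  let M : ℕ+ := ⟨N, h.pos⟩
  refine (le_puiseuxOrder_of_dvd M h5).trans (le_sSup ?_)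
  exact ⟨_, puiseux_mem_puiseuxRoots M (α := σ.comp α) h3 (hP.trans (ker_le_ker_comp _ _)), _,
    puiseux_mem_puiseuxRoots M (α := τ.comp β) h4 (hQ.trans (ker_le_ker_comp _ _)), rfl⟩

theorem eq_top_of_forall_nat_div_le {s : ℝ≥0∞} (N : ℕ) (hs : ∀ K : ℕ, (K : ℝ≥0∞) / N ≤ s) :
    s = ⊤ := by
  rw [eq_top_iff]
  refine le_of_forall_lt fun c hc => ?_
  obtain ⟨K, hK⟩ := ENNReal.exists_nat_gt (ENNReal.mul_ne_top hc.ne (ENNReal.natCast_ne_top N))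
  rcases Nat.eq_zero_or_pos N with rfl | hN
  · have := hs 1
    simp at this
    rwa [this]
  · refine lt_of_lt_of_le ?_ (hs K)
    rw [ENNReal.lt_div_iff_mul_lt (Or.inl (by exact_mod_cast hN.ne')) (Or.inl (by simp))]
    exact hK

/-- The order of coincidence is bounded above as soon as the closeness of all the normalized arcs
is bounded. -/
theorem coincidence_le {P Q : Ideal FormalRing} {s : ℝ≥0∞}
    (h : ∀ (N K : ℕ) (α β : Arc), 0 < N → α x = t ^ N → β x = t ^ N → P ≤ RingHom.ker α →
      Q ≤ RingHom.ker β → t ^ K ∣ α y - β y → (K : ℝ≥0∞) / N ≤ s) : coincidence P Q ≤ s := by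
  refine sSup_le ?_
  rintro k ⟨ξ, hξ, η, hη, rfl⟩
  obtain ⟨N, α, β, h1, h2, h3, h4, rfl, rfl⟩ := exists_arcs_of_roots hξ hη
  rw [puiseux_sub]
  by_cases h0 : α y - β y = 0
  · have : s = ⊤ := eq_top_of_forall_nat_div_le N fun K =>
      h N K α β N.pos h1 h2 h3 h4 (by rw [h0]; exact dvd_zero _)
    rw [this]; exact le_top
  · obtain ⟨K, hK⟩ := exists_hasOrd h0
    rw [puiseuxOrder_of_hasOrd N hK]
    exact h N K α β N.pos h1 h2 h3 h4 ((hK.dvd_iff K).2 le_rfl)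

theorem mem_charExponents {P : Ideal FormalRing} {k : ℝ≥0∞} : k ∈ charExponents P ↔
    ∃ (N K : ℕ) (α β : Arc), 0 < N ∧ α x = t ^ N ∧ β x = t ^ N ∧ P ≤ RingHom.ker α ∧
      P ≤ RingHom.ker β ∧ HasOrd (α y - β y) K ∧ k = (K : ℝ≥0∞) / N := by
  constructor
  · rintro ⟨ξ, hξ, η, hη, hne, rfl⟩
    obtain ⟨N, α, β, h1, h2, h3, h4, rfl, rfl⟩ := exists_arcs_of_roots hξ hη
    have h0 : α y - β y ≠ 0 := by
      intro h0
      exact hne (by rw [sub_eq_zero.1 h0])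
    obtain ⟨K, hK⟩ := exists_hasOrd h0
    exact ⟨N, K, α, β, N.pos, h1, h2, h3, h4, hK, by
      rw [puiseux_sub, puiseuxOrder_of_hasOrd N hK]⟩
  · rintro ⟨N, K, α, β, hN, h1, h2, h3, h4, hK, rfl⟩
    let M : ℕ+ := ⟨N, hN⟩
    refine ⟨_, puiseux_mem_puiseuxRoots M h1 h3, _, puiseux_mem_puiseuxRoots M h2 h4, ?_, ?_⟩
    · intro e
      exact hK.ne_zero (sub_eq_zero.2 (puiseux_injective M e))
    · rw [puiseux_sub, puiseuxOrder_of_hasOrd M hK]; rfl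

theorem puiseuxRoots_idealL : puiseuxRoots idealL = ∅ := by
  ext η
  simp only [Set.mem_empty_iff_false, iff_false]
  intro h
  obtain ⟨n, α, h1, h2, -⟩ := mem_puiseuxRoots.1 h
  have : α x = 0 := h2 (Ideal.mem_span_singleton_self x)
  rw [h1] at this
  exact pow_ne_zero _ PowerSeries.X_ne_zero this

theorem coincidence_idealL_left (Q : Ideal FormalRing) : coincidence idealL Q = 0 := by
  simp [coincidence, puiseuxRoots_idealL]

theorem coincidence_comm (P Q : Ideal FormalRing) : coincidence P Q = coincidence Q P := by
  have hneg : ∀ ξ : HahnSeries ℚ ℂ, puiseuxOrder (-ξ) = puiseuxOrder ξ := by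
    intro ξ
    by_cases h : ξ = 0
    · rw [h, neg_zero]
    · have h' : -ξ ≠ 0 := fun e => h (neg_eq_zero.1 e)
      rw [puiseuxOrder, puiseuxOrder, HahnSeries.order_neg, if_neg h, if_neg h']
  have : ∀ P Q, coincidence P Q ≤ coincidence Q P := by
    intro P Q
    refine sSup_le ?_
    rintro k ⟨ξ, hξ, η, hη, rfl⟩
    refine le_sSup ⟨η, hη, ξ, hξ, ?_⟩
    rw [← hneg, neg_sub]
  exact le_antisymm (this _ _) (this _ _)
/-! ### Newton polygons and strict transforms -/

/-- The weight of an exponent for the linear form `(c, d)`. -/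
def weight (c d : ℕ) (m : Fin 2 →₀ ℕ) : ℕ := c * m 0 + d * m 1

/-- The monomial of exponent `m` occurs in `F`, with minimal weight. -/
def IsMinimal (F : FormalRing) (c d : ℕ) (m : Fin 2 →₀ ℕ) : Prop :=
  MvPowerSeries.coeff m F ≠ 0 ∧
    ∀ n, MvPowerSeries.coeff n F ≠ 0 → weight c d m ≤ weight c d n

theorem exists_isMinimal {F : FormalRing} (hF : F ≠ 0) (c d : ℕ) : ∃ m, IsMinimal F c d m := by
  have hne : {m | MvPowerSeries.coeff m F ≠ 0}.Nonempty := by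
    by_contra h
    rw [Set.not_nonempty_iff_eq_empty] at h
    apply hF
    ext m
    by_contra hm
    have : m ∈ {m | MvPowerSeries.coeff m F ≠ 0} := hm
    rw [h] at this
    exact this
  obtain ⟨m, hm, hmin⟩ := (measure (weight c d)).wf.has_min _ hne
  exact ⟨m, hm, fun n hn => not_lt.1 (hmin n hn)⟩

/-- The exponent `m` as a point of the plane. -/
def toPoint (m : Fin 2 →₀ ℕ) : Fin 2 → ℝ := fun i => (m i : ℝ)

theorem toPoint_injective : Function.Injective toPoint := by
  intro m n h
  ext i
  have := congrFun h i
  simp only [toPoint] at this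
  exact_mod_cast this

theorem toPoint_mem_newtonPolygon {F : FormalRing} {m : Fin 2 →₀ ℕ}
    (hm : MvPowerSeries.coeff m F ≠ 0) : toPoint m ∈ newtonPolygon F :=
  subset_convexHull ℝ _ ⟨m, 0, hm, by ext i; simp [toPoint]⟩

theorem cast_weight (c d : ℕ) (m : Fin 2 →₀ ℕ) :
    ((weight c d m : ℕ) : ℝ) = (c : ℝ) * toPoint m 0 + (d : ℝ) * toPoint m 1 := by
  simp [weight, toPoint]

theorem weight_le_of_mem_newtonPolygon {F : FormalRing} {c d : ℕ} {m : Fin 2 →₀ ℕ}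
    (hm : IsMinimal F c d m) {q : Fin 2 → ℝ} (hq : q ∈ newtonPolygon F) :
    ((weight c d m : ℕ) : ℝ) ≤ (c : ℝ) * q 0 + (d : ℝ) * q 1 := by
  have hconv : Convex ℝ {q : Fin 2 → ℝ | ((weight c d m : ℕ) : ℝ) ≤ (c : ℝ) * q 0 + (d : ℝ) * q 1} := by
    intro p hp q hq a b ha hb hab
    simp only [Set.mem_ofPred_eq, Pi.add_apply, Pi.smul_apply, smul_eq_mul] at hp hq ⊢
    have e : ((weight c d m : ℕ) : ℝ) = a * (weight c d m : ℕ) + b * (weight c d m : ℕ) := by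
      rw [← add_mul, hab, one_mul]
    rw [e]
    have h1 := mul_le_mul_of_nonneg_left hp ha
    have h2 := mul_le_mul_of_nonneg_left hq hb
    linarith
  refine convexHull_min ?_ hconv hq
  rintro _ ⟨k, n, hk, rfl⟩
  simp only [Set.mem_ofPred_eq]
  have h1 : ((weight c d m : ℕ) : ℝ) ≤ (weight c d k : ℕ) := by exact_mod_cast hm.2 k hk
  rw [cast_weight c d k] at h1
  simp only [toPoint] at h1
  have h2 : (0 : ℝ) ≤ (c : ℝ) * (n 0 : ℝ) := by positivity
  have h3 : (0 : ℝ) ≤ (d : ℝ) * (n 1 : ℝ) := by positivity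
  linarith

/-- A ray is a ray of the Newton fan when the associated initial form is not a monomial. -/
theorem isNewtonRay_iff {F : FormalRing} {c d : ℕ} : IsNewtonRay F c d ↔
    0 < c ∧ 0 < d ∧ ∃ m n, m ≠ n ∧ IsMinimal F c d m ∧ IsMinimal F c d n := by
  constructor
  · rintro ⟨hc, hd, p, hp, q, hq, hpq⟩
    refine ⟨hc, hd, ?_⟩
    have hF : F ≠ 0 := by
      rintro rfl
      have := hp.1
      simp [newtonPolygon] at this
    obtain ⟨m, hm⟩ := exists_isMinimal hF c d
    by_contra hcon
    push Not at hcon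
    have hc' : (0 : ℝ) < c := by exact_mod_cast hc
    have hd' : (0 : ℝ) < d := by exact_mod_cast hd
    -- a vertex together with the open half-plane above it form a convex set
    let S : Set (Fin 2 → ℝ) := {q | q = toPoint m ∨
      ((weight c d m : ℕ) : ℝ) < (c : ℝ) * q 0 + (d : ℝ) * q 1}
    have hS : Convex ℝ S := by
      intro p hp q hq a b ha hb hab
      rcases ha.eq_or_lt with rfl | ha
      · rw [zero_add] at hab
        simpa [hab] using hq
      rcases hb.eq_or_lt with rfl | hb
      · rw [add_zero] at hab
        simpa [hab] using hp
      have e : ((weight c d m : ℕ) : ℝ) = a * (weight c d m : ℕ) + b * (weight c d m : ℕ) := by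
        rw [← add_mul, hab, one_mul]
      have hw := cast_weight c d m
      rcases hp with rfl | hp <;> rcases hq with rfl | hq
      · left; rw [← add_smul, hab, one_smul]
      · right
        simp only [Pi.add_apply, Pi.smul_apply, smul_eq_mul]
        have h2 := mul_lt_mul_of_pos_left hq hb
        have h1 := congrArg (fun r => a * r) hw
        linarith
      · right
        simp only [Pi.add_apply, Pi.smul_apply, smul_eq_mul]
        have h2 := mul_lt_mul_of_pos_left hp ha
        have h1 := congrArg (fun r => b * r) hw
        linarith
      · right
        simp only [Pi.add_apply, Pi.smul_apply, smul_eq_mul]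
        have h1 := mul_lt_mul_of_pos_left hp ha
        have h2 := mul_lt_mul_of_pos_left hq hb
        linarith
    have hsub : newtonPolygon F ⊆ S := by
      refine convexHull_min ?_ hS
      rintro _ ⟨k, n, hk, rfl⟩
      have hle := hm.2 k hk
      have hcast : ((weight c d k : ℕ) : ℝ) = (c : ℝ) * (k 0 : ℝ) + (d : ℝ) * (k 1 : ℝ) :=
        cast_weight c d k
      have h2 : (0 : ℝ) ≤ (c : ℝ) * (n 0 : ℝ) := by positivity
      have h3 : (0 : ℝ) ≤ (d : ℝ) * (n 1 : ℝ) := by positivity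
      rcases hle.eq_or_lt with he | hlt
      · have hkm : m = k := by
          by_contra hne
          exact hcon m k hne hm ⟨hk, fun l hl => he ▸ hm.2 l hl⟩
        subst hkm
        by_cases hn : n = 0
        · left; ext i; simp [toPoint, hn]
        · right
          simp only
          have : n 0 ≠ 0 ∨ n 1 ≠ 0 := by
            by_contra h
            push Not at h
            exact hn (expo_ext (by simpa using h.1) (by simpa using h.2))
          rcases this with h | h
          · have : (0 : ℝ) < (c : ℝ) * (n 0 : ℝ) :=
              mul_pos hc' (by exact_mod_cast Nat.pos_of_ne_zero h)
            linarith
          · have : (0 : ℝ) < (d : ℝ) * (n 1 : ℝ) :=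
              mul_pos hd' (by exact_mod_cast Nat.pos_of_ne_zero h)
            linarith
      · right
        simp only
        have : ((weight c d m : ℕ) : ℝ) < (weight c d k : ℕ) := by exact_mod_cast hlt
        linarith
    have hface : ∀ r ∈ newtonFace F c d, r = toPoint m := by
      intro r hr
      rcases hsub hr.1 with h | h
      · exact h
      · have := hr.2 _ (toPoint_mem_newtonPolygon hm.1)
        rw [← cast_weight] at this
        linarith
    exact hpq ((hface p hp).trans (hface q hq).symm)
  · rintro ⟨hc, hd, m, n, hne, hm, hn⟩
    refine ⟨hc, hd, toPoint m, ⟨toPoint_mem_newtonPolygon hm.1, fun q hq => ?_⟩, toPoint n,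
      ⟨toPoint_mem_newtonPolygon hn.1, fun q hq => ?_⟩, fun h => hne (toPoint_injective h)⟩
    · rw [← cast_weight]; exact weight_le_of_mem_newtonPolygon hm hq
    · rw [← cast_weight]; exact weight_le_of_mem_newtonPolygon hn hq

theorem weight_mul (g c d : ℕ) (m : Fin 2 →₀ ℕ) :
    weight (g * c) (g * d) m = g * weight c d m := by
  simp only [weight]; ring

theorem IsNewtonRay.of_mul {F : FormalRing} {g c d : ℕ} (h : IsNewtonRay F (g * c) (g * d)) :
    IsNewtonRay F c d := by
  rw [isNewtonRay_iff] at h ⊢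
  obtain ⟨hc, hd, m, n, hne, hm, hn⟩ := h
  have hg : 0 < g := Nat.pos_of_mul_pos_right hc
  refine ⟨Nat.pos_of_mul_pos_left hc, Nat.pos_of_mul_pos_left hd, m, n, hne, ⟨hm.1, ?_⟩, ⟨hn.1, ?_⟩⟩
  · intro k hk
    have := hm.2 k hk
    rw [weight_mul, weight_mul] at this
    exact Nat.le_of_mul_le_mul_left this hg
  · intro k hk
    have := hn.2 k hk
    rw [weight_mul, weight_mul] at this
    exact Nat.le_of_mul_le_mul_left this hg

/-- The finite set of exponents of weight `w`. -/
def weightFiber (c d w : ℕ) : Finset (Fin 2 →₀ ℕ) :=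
  {m ∈ (Finset.range (w + 1) ×ˢ Finset.range (w + 1)).image fun p => expo p.1 p.2 |
    weight c d m = w}

theorem mem_weightFiber {c d w : ℕ} (hc : 0 < c) (hd : 0 < d) {m : Fin 2 →₀ ℕ} :
    m ∈ weightFiber c d w ↔ weight c d m = w := by
  rw [weightFiber, Finset.mem_filter, and_iff_right_iff_imp]
  intro h
  rw [Finset.mem_image]
  refine ⟨(m 0, m 1), ?_, expo_eta m⟩
  rw [weight] at h
  have h1 : m 0 ≤ c * m 0 := Nat.le_mul_of_pos_left _ hc
  have h2 : m 1 ≤ d * m 1 := Nat.le_mul_of_pos_left _ hd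
  simp only [Finset.mem_product, Finset.mem_range]
  omega

/-- The part of weight `w` of `F`, read on the orbit of the exceptional component of the ray
`(c, d)`: the coordinate `v` of the orbit appears with the exponent `γ i + δ j` in the monomial
`x ^ i * y ^ j`. -/
def facePoly (F : FormalRing) (c d γ δ w : ℕ) : Polynomial ℂ :=
  ∑ m ∈ weightFiber c d w,
    Polynomial.C (MvPowerSeries.coeff m F) * Polynomial.X ^ (weight γ δ m)

theorem eq_of_weight_eq {c d γ δ : ℕ} (hdet : c * δ = d * γ + 1) {m n : Fin 2 →₀ ℕ}
    (h1 : weight c d m = weight c d n) (h2 : weight γ δ m = weight γ δ n) : m = n := by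
  simp only [weight] at h1 h2
  zify at hdet h1 h2
  apply expo_ext
  · zify
    linear_combination (δ : ℤ) * h1 - d * h2 - ((m 0 : ℤ) - n 0) * hdet
  · zify
    linear_combination (c : ℤ) * h2 - γ * h1 - ((m 1 : ℤ) - n 1) * hdet

theorem coeff_facePoly {F : FormalRing} {c d γ δ : ℕ} (hc : 0 < c) (hd : 0 < d)
    (hdet : c * δ = d * γ + 1) (m : Fin 2 →₀ ℕ) :
    (facePoly F c d γ δ (weight c d m)).coeff (weight γ δ m) = MvPowerSeries.coeff m F := by
  rw [facePoly, Polynomial.finsetSum_coeff, Finset.sum_eq_single m]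
  · simp
  · intro n hn hne
    rw [Polynomial.coeff_C_mul_X_pow, if_neg]
    intro h
    exact hne (eq_of_weight_eq hdet ((mem_weightFiber hc hd).1 hn) h.symm)
  · intro h
    exact absurd ((mem_weightFiber hc hd).2 rfl) h

theorem coeff_x_pow_mul_aeval (w : ℕ) (q : Polynomial ℂ) (m : Fin 2 →₀ ℕ) :
    MvPowerSeries.coeff m (x ^ w * Polynomial.aeval y q) =
      if m 0 = w then q.coeff (m 1) else 0 := by
  classical
  induction q using Polynomial.induction_on' with
  | add p q hp hq =>
    rw [map_add, mul_add, map_add, hp, hq]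
    split_ifs <;> simp
  | monomial n a =>
    have e : x ^ w * Polynomial.aeval y (Polynomial.monomial n a) =
        MvPowerSeries.monomial (expo w n) a := by
      rw [Polynomial.aeval_monomial, algebraMap_formal, mul_left_comm, x_pow_mul_y_pow]
      ext k
      rw [MvPowerSeries.coeff_C_mul, MvPowerSeries.coeff_monomial, MvPowerSeries.coeff_monomial]
      split_ifs <;> simp
    rw [e, MvPowerSeries.coeff_monomial, Polynomial.coeff_monomial]
    by_cases h0 : m 0 = w
    · by_cases h1 : n = m 1
      · rw [if_pos h0, if_pos h1, if_pos]
        rw [← h0, h1, expo_eta]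
      · rw [if_pos h0, if_neg h1, if_neg]
        rintro rfl
        simp at h1
    · rw [if_neg h0, if_neg]
      rintro rfl
      simp at h0

namespace OrbitPoint

variable (p : OrbitPoint)

theorem c_pos : 0 < p.c := lt_of_le_of_lt (Nat.zero_le _) p.γ_lt

theorem pullback_x : p.pullback x = x ^ p.c * (MvPowerSeries.C p.v + y) ^ p.γ := by
  rw [pullback, x, MvPowerSeries.substAlgHom_X]; rfl

theorem pullback_y : p.pullback y = x ^ p.d * (MvPowerSeries.C p.v + y) ^ p.δ := by
  rw [pullback, y, MvPowerSeries.substAlgHom_X]; rfl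

/-- The coefficients of the total transform. -/
theorem coeff_pullback (F : FormalRing) (m : Fin 2 →₀ ℕ) :
    MvPowerSeries.coeff m (p.pullback F) =
      ((facePoly F p.c p.d p.γ p.δ (m 0)).comp (Polynomial.X + Polynomial.C p.v)).coeff (m 1) := by
  rw [pullback, MvPowerSeries.substAlgHom_apply, MvPowerSeries.coeff_subst p.hasSubst_chart]
  have hmon : ∀ d : Fin 2 →₀ ℕ, MvPowerSeries.coeff m (d.prod fun s e => p.chart s ^ e) =
      if m 0 = weight p.c p.d d then
        ((Polynomial.X + Polynomial.C p.v) ^ (weight p.γ p.δ d)).coeff (m 1) else 0 := by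
    intro d
    rw [← coeff_x_pow_mul_aeval, Finsupp.prod_fintype _ _ (by simp), Fin.prod_univ_two]
    congr 1
    simp only [chart, Matrix.cons_val_zero, Matrix.cons_val_one, map_pow, map_add,
      Polynomial.aeval_X, Polynomial.aeval_C, algebraMap_formal, weight]
    ring
  simp_rw [hmon]
  rw [finsum_eq_sum_of_support_subset (s := weightFiber p.c p.d (m 0))]
  · rw [facePoly, Polynomial.sum_comp, Polynomial.finsetSum_coeff]
    refine Finset.sum_congr rfl fun d hd => ?_
    rw [if_pos ((mem_weightFiber p.c_pos p.d_pos).1 hd).symm, Polynomial.mul_comp,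
      Polynomial.C_comp, Polynomial.X_pow_comp, Polynomial.coeff_C_mul, smul_eq_mul]
  · intro d hd
    rw [Function.mem_support] at hd
    rw [Finset.mem_coe, mem_weightFiber p.c_pos p.d_pos]
    by_contra h
    apply hd
    rw [if_neg (fun e => h e.symm), smul_zero]

/-- The strict transform at a point of the orbit, and its value at this point. -/
theorem exists_strictTransform {F : FormalRing} {m : Fin 2 →₀ ℕ} (hm : IsMinimal F p.c p.d m) :
    ∃ g, IsStrictTransform (p.pullback F) g ∧ MvPowerSeries.constantCoeff g =
      (facePoly F p.c p.d p.γ p.δ (weight p.c p.d m)).eval p.v := by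
  set w := weight p.c p.d m with hw
  have hR : facePoly F p.c p.d p.γ p.δ w ≠ 0 := by
    intro h
    apply hm.1
    rw [← coeff_facePoly p.c_pos p.d_pos p.det_eq m, ← hw, h, Polynomial.coeff_zero]
  have hdvd : x ^ w ∣ p.pullback F := by
    rw [x, MvPowerSeries.X_pow_dvd_iff]
    intro n hn
    rw [coeff_pullback]
    have : facePoly F p.c p.d p.γ p.δ (n 0) = 0 := by
      apply Finset.sum_eq_zero
      intro k hk
      have hk' := (mem_weightFiber p.c_pos p.d_pos).1 hk
      have : MvPowerSeries.coeff k F = 0 := by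
        by_contra h
        have := hm.2 k h
        omega
      rw [this]; simp
    rw [this]; simp
  obtain ⟨g, hg⟩ := hdvd
  have hcoeff : ∀ k, MvPowerSeries.coeff (expo 0 k) g =
      ((facePoly F p.c p.d p.γ p.δ w).comp (Polynomial.X + Polynomial.C p.v)).coeff k := by
    intro k
    have h1 := p.coeff_pullback F (expo w k)
    rw [expo_zero, expo_one, hg, x, MvPowerSeries.X_pow_eq] at h1
    have e : expo w k = Finsupp.single 0 w + expo 0 k := by simp [expo]
    rw [e, MvPowerSeries.coeff_add_monomial_mul, one_mul] at h1
    exact h1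
  refine ⟨g, ⟨⟨w, hg⟩, ?_⟩, ?_⟩
  · intro hx
    rw [x, MvPowerSeries.X_dvd_iff] at hx
    apply hR
    rw [← Polynomial.comp_X_add_C_eq_zero_iff (t := p.v)]
    ext k
    rw [← hcoeff, hx _ (by simp), Polynomial.coeff_zero]
  · have := hcoeff 0
    rw [Polynomial.coeff_zero_eq_eval_zero, Polynomial.eval_comp] at this
    simp only [Polynomial.eval_add, Polynomial.eval_X, Polynomial.eval_C, zero_add] at this
    rw [← this, ← MvPowerSeries.coeff_zero_eq_constantCoeff_apply]
    congr 1
    simp [expo]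

end OrbitPoint

theorem prime_x : Prime x := by
  have h0 : x ≠ 0 := by
    intro h
    have := congrArg (MvPowerSeries.coeff (Finsupp.single 0 1)) h
    rw [x, MvPowerSeries.coeff_index_single_self_X] at this
    simp at this
  rw [← Ideal.span_singleton_prime h0]
  have : Ideal.span {x} = RingHom.ker (mkArc 0 t (map_zero _) (by simp)) := by
    ext F
    rw [Ideal.mem_span_singleton, RingHom.mem_ker]
    -- exchange the two coordinates
    let s := mkEndo y x (by simp) (by simp)
    have hs : s.comp s = AlgHom.id ℂ _ := by apply endo_ext <;> simp [s]
    have hc : (mkArc t 0 (by simp) (map_zero _)).comp s = mkArc 0 t (map_zero _) (by simp) := by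
      apply arc_ext <;> simp [s]
    have h1 := mkArc_eq_zero_iff 0 (map_zero _) (s F)
    rw [map_zero, sub_zero, ← AlgHom.comp_apply, hc] at h1
    rw [h1]
    constructor
    · rintro ⟨G, rfl⟩; rw [map_mul]; simp [s]
    · rintro ⟨G, hG⟩
      refine ⟨s G, ?_⟩
      have := DFunLike.congr_fun hs F
      rw [AlgHom.comp_apply, hG, map_mul] at this
      simpa [s] using this.symm
  rw [this]
  exact RingHom.ker_isPrime _

theorem x_pow_mul_right_cancel {a b : ℕ} {g h : FormalRing} (e : x ^ a * g = x ^ b * h)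
    (hg : ¬ x ∣ g) (hh : ¬ x ∣ h) : a = b ∧ g = h := by
  have key : ∀ {a b : ℕ} {g h : FormalRing}, x ^ a * g = x ^ b * h → ¬ x ∣ g → b ≤ a := by
    intro a b g h e hg
    by_contra hlt
    push Not at hlt
    obtain ⟨k, rfl⟩ := Nat.exists_eq_add_of_lt hlt
    apply hg
    refine ⟨x ^ k * h, mul_left_cancel₀ (pow_ne_zero a prime_x.ne_zero) ?_⟩
    rw [e]; ring
  have hab : a = b := le_antisymm (key e.symm hh) (key e hg)
  subst hab
  exact ⟨rfl, mul_left_cancel₀ (pow_ne_zero a prime_x.ne_zero) e⟩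

theorem IsStrictTransform.unique {G g h : FormalRing} (hg : IsStrictTransform G g)
    (hh : IsStrictTransform G h) : g = h := by
  obtain ⟨⟨a, ea⟩, h1⟩ := hg
  obtain ⟨⟨b, eb⟩, h2⟩ := hh
  exact (x_pow_mul_right_cancel (ea.symm.trans eb) h1 h2).2

theorem IsStrictTransform.dvd {G H g h : FormalRing} (hg : IsStrictTransform G g)
    (hh : IsStrictTransform H h) (hd : H ∣ G) : h ∣ g := by
  obtain ⟨⟨a, ea⟩, h1⟩ := hg
  obtain ⟨⟨b, eb⟩, h2⟩ := hh
  obtain ⟨K, hK⟩ := hd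
  have e : h * (x ^ b * K) = x ^ a * g := by rw [← ea, hK, eb]; ring
  obtain ⟨k, hk⟩ := Prime.pow_dvd_of_dvd_mul_left prime_x a h2 (Dvd.intro _ e.symm)
  refine ⟨k, mul_left_cancel₀ (pow_ne_zero a prime_x.ne_zero) ?_⟩
  rw [← e, hk]; ring

/-- The orbits met by the strict transform are those of the rays of the Newton fan. -/
theorem isNewtonRay_of_strictTransform (p : OrbitPoint) {F g : FormalRing}
    (hg : IsStrictTransform (p.pullback F) g) (h0 : MvPowerSeries.constantCoeff g = 0) :
    IsNewtonRay F p.c p.d := by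
  have hF : F ≠ 0 := by
    rintro rfl
    obtain ⟨⟨a, ea⟩, h1⟩ := hg
    rw [map_zero] at ea
    rcases mul_eq_zero.1 ea.symm with h | h
    · exact pow_ne_zero a prime_x.ne_zero h
    · exact h1 (h ▸ dvd_zero _)
  obtain ⟨m, hm⟩ := exists_isMinimal hF p.c p.d
  obtain ⟨g', hg', e⟩ := p.exists_strictTransform hm
  rw [← hg.unique hg', h0] at e
  rw [isNewtonRay_iff]
  refine ⟨p.c_pos, p.d_pos, ?_⟩
  by_contra hcon
  push Not at hcon
  have : facePoly F p.c p.d p.γ p.δ (weight p.c p.d m) =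
      Polynomial.C (MvPowerSeries.coeff m F) * Polynomial.X ^ (weight p.γ p.δ m) := by
    rw [facePoly, Finset.sum_eq_single m]
    · intro n hn hne
      have hn' := (mem_weightFiber p.c_pos p.d_pos).1 hn
      have : MvPowerSeries.coeff n F = 0 := by
        by_contra h
        exact hcon m n hne.symm hm ⟨h, fun k hk => hn' ▸ hm.2 k hk⟩
      rw [this]; simp
    · intro h
      exact absurd ((mem_weightFiber p.c_pos p.d_pos).2 rfl) h
  rw [this] at e
  simp only [Polynomial.eval_mul, Polynomial.eval_C, Polynomial.eval_pow, Polynomial.eval_X] at e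
  exact mul_ne_zero hm.1 (pow_ne_zero _ p.v_ne) e.symm

theorem exists_ne_zero_root {q : Polynomial ℂ} {i j : ℕ} (hij : i ≠ j) (hi : q.coeff i ≠ 0)
    (hj : q.coeff j ≠ 0) : ∃ v : ℂ, v ≠ 0 ∧ q.eval v = 0 := by
  have hq : q ≠ 0 := by rintro rfl; simp at hi
  obtain ⟨r, hr, hnd⟩ := Polynomial.exists_eq_pow_rootMultiplicity_mul_and_not_dvd q hq 0
  rw [map_zero, sub_zero] at hr hnd
  by_cases hdeg : r.degree = 0
  · exfalso
    rw [Polynomial.eq_C_of_degree_eq_zero hdeg, mul_comm] at hr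
    rw [hr, Polynomial.coeff_C_mul_X_pow] at hi hj
    have h1 : i = Polynomial.rootMultiplicity 0 q := by
      by_contra h; exact hi (if_neg h)
    have h2 : j = Polynomial.rootMultiplicity 0 q := by
      by_contra h; exact hj (if_neg h)
    exact hij (h1.trans h2.symm)
  · obtain ⟨z, hz⟩ := IsAlgClosed.exists_root r hdeg
    refine ⟨z, ?_, ?_⟩
    · rintro rfl
      exact hnd (by rw [Polynomial.X_dvd_iff, Polynomial.coeff_zero_eq_eval_zero]; exact hz)
    · rw [hr, Polynomial.eval_mul, hz.eq_zero, mul_zero]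

theorem exists_det_one {c d : ℕ} (hc : 0 < c) (h : c.Coprime d) :
    ∃ γ δ : ℕ, γ < c ∧ c * δ = d * γ + 1 := by
  rcases Nat.lt_or_ge 1 c with h1 | h1
  · obtain ⟨m, -, hm⟩ := Nat.exists_mul_mod_eq_one_of_coprime h.symm h1
    have hm' : d * (m % c) % c = 1 := by rw [Nat.mul_mod, Nat.mod_mod, ← Nat.mul_mod, hm]
    have hlt := Nat.mod_lt m hc
    have hpos : 0 < m % c := by
      rcases Nat.eq_zero_or_pos (m % c) with h0 | h0
      · rw [h0] at hm'; simp at hm'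
      · exact h0
    generalize m % c = k at *
    have e := Nat.div_add_mod (d * k) c
    rw [hm'] at e
    have hle : d * k / c ≤ d := by
      apply Nat.div_le_of_le_mul
      rw [mul_comm c]
      exact Nat.mul_le_mul_left _ hlt.le
    refine ⟨c - k, d - d * k / c, by omega, ?_⟩
    zify [hle, hlt.le]
    zify at e
    linear_combination -e
  · have : c = 1 := by omega
    subst this
    exact ⟨0, 1, by omega, by omega⟩

/-- On the orbit of every ray of the Newton fan there is a point of the strict transform. -/
theorem exists_orbitPoint {F : FormalRing} {c d : ℕ} (h : IsNewtonRay F c d)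
    (hcd : c.Coprime d) : ∃ p : OrbitPoint, p.c = c ∧ p.d = d ∧
      ∃ g, IsStrictTransform (p.pullback F) g ∧ MvPowerSeries.constantCoeff g = 0 := by
  obtain ⟨hc, hd, m, n, hne, hm, hn⟩ := isNewtonRay_iff.1 h
  obtain ⟨γ, δ, hγ, hdet⟩ := exists_det_one hc hcd
  have hw : weight c d m = weight c d n := le_antisymm (hm.2 _ hn.1) (hn.2 _ hm.1)
  obtain ⟨v, hv, e⟩ := exists_ne_zero_root (q := facePoly F c d γ δ (weight c d m))
    (i := weight γ δ m) (j := weight γ δ n) (fun e => hne (eq_of_weight_eq hdet hw e))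
    (by rw [coeff_facePoly hc hd hdet]; exact hm.1)
    (by rw [hw, coeff_facePoly hc hd hdet]; exact hn.1)
  let p : OrbitPoint := ⟨c, d, γ, δ, v, hd, hγ, hdet, hv⟩
  obtain ⟨g, hg, e'⟩ := p.exists_strictTransform hm
  exact ⟨p, rfl, rfl, g, hg, e'.trans e⟩

theorem IsNewtonRay.exists_coprime {F : FormalRing} {c d : ℕ} (h : IsNewtonRay F c d) :
    ∃ g c' d', 0 < g ∧ c = g * c' ∧ d = g * d' ∧ c'.Coprime d' ∧ IsNewtonRay F c' d' := by
  obtain ⟨c', d', hco, h1, h2⟩ := Nat.exists_coprime c d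
  have hg : 0 < c.gcd d := Nat.gcd_pos_of_pos_left _ h.1
  rw [mul_comm] at h1 h2
  refine ⟨c.gcd d, c', d', hg, h1, h2, hco, ?_⟩
  generalize c.gcd d = g at *
  subst h1 h2
  exact h.of_mul

theorem exists_newtonPoint_slope_eq {F : FormalRing} {s : ℝ≥0∞} (hs : s ∈ newtonSlopes F) :
    ∃ p : NewtonPoint F, p.toOrbitPoint.slope = s := by
  obtain ⟨c, d, h, rfl⟩ := hs
  obtain ⟨g, c', d', hg, rfl, rfl, hco, h'⟩ := h.exists_coprime
  obtain ⟨p, rfl, rfl, k, hk, hk0⟩ := exists_orbitPoint h' hco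
  refine ⟨⟨p, h', k, hk, hk0⟩, ?_⟩
  rw [OrbitPoint.slope]
  push_cast
  rw [ENNReal.mul_div_mul_left _ _ (by exact_mod_cast hg.ne') (ENNReal.natCast_ne_top g)]

/-- A curve which contains neither of the branches of the cross has a Newton polygon with a compact
edge. -/
theorem exists_isNewtonRay {h : FormalRing} (h0 : MvPowerSeries.constantCoeff h = 0)
    (hx : ¬ x ∣ h) (hy : ¬ y ∣ h) : ∃ c d, IsNewtonRay h c d := by
  classical
  rw [x, MvPowerSeries.X_dvd_iff] at hx
  rw [y, MvPowerSeries.X_dvd_iff] at hy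
  push Not at hx hy
  obtain ⟨a, ha0, ha⟩ := hx
  obtain ⟨b, hb1, hb⟩ := hy
  have hex : ∃ n, MvPowerSeries.coeff (expo 0 n) h ≠ 0 := ⟨a 1, by rw [← ha0, expo_eta]; exact ha⟩
  let n := Nat.find hex
  have hn : MvPowerSeries.coeff (expo 0 n) h ≠ 0 := Nat.find_spec hex
  have hmin : ∀ k < n, MvPowerSeries.coeff (expo 0 k) h = 0 := fun k hk =>
    not_not.1 (Nat.find_min hex hk)
  have hnpos : 0 < n := by
    rcases Nat.eq_zero_or_pos n with h' | h'
    · rw [h'] at hn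
      exfalso
      apply hn
      rw [← h0, ← MvPowerSeries.coeff_zero_eq_constantCoeff_apply]
      congr 1
      simp [expo]
    · exact h'
  -- the edge which starts at `(0, n)` has the steepest slope; slopes are compared through
  -- their multiples by `n !`
  let key : (Fin 2 →₀ ℕ) → ℕ := fun m => m 0 * (n.factorial / (n - m 1))
  have hkey : ∀ m : Fin 2 →₀ ℕ, m 1 < n → key m * (n - m 1) = m 0 * n.factorial := by
    intro m hm
    have hd : (n - m 1) ∣ n.factorial := Nat.dvd_factorial (by omega) (by omega)
    simp only [key]
    rw [mul_assoc, Nat.div_mul_cancel hd]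
  obtain ⟨m, ⟨hm, hmn⟩, hbest⟩ := (measure key).wf.has_min
    {m | MvPowerSeries.coeff m h ≠ 0 ∧ m 1 < n} ⟨b, hb, by rw [hb1]; exact hnpos⟩
  have hm0 : 0 < m 0 := by
    rcases Nat.eq_zero_or_pos (m 0) with h' | h'
    · exfalso
      apply hm
      rw [← expo_eta m, h']
      exact hmin _ hmn
    · exact h'
  have hle : ∀ k, MvPowerSeries.coeff k h ≠ 0 → n * m 0 ≤ weight (n - m 1) (m 0) k := by
    intro k hk
    rw [weight]
    rcases Nat.lt_or_ge (k 1) n with h1 | h1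
    · have h2 : key m ≤ key k := not_lt.1 (hbest k ⟨hk, h1⟩)
      have h3 := hkey m hmn
      have h4 := hkey k h1
      have h5 : m 0 * (n - k 1) ≤ k 0 * (n - m 1) := by
        apply Nat.le_of_mul_le_mul_right _ n.factorial_pos
        calc m 0 * (n - k 1) * n.factorial = key m * (n - m 1) * (n - k 1) := by rw [h3]; ring
          _ ≤ key k * (n - m 1) * (n - k 1) := by gcongr
          _ = (key k * (n - k 1)) * (n - m 1) := by ring
          _ = k 0 * (n - m 1) * n.factorial := by rw [h4]; ring
      calc n * m 0 = m 0 * (n - k 1) + m 0 * k 1 := by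
            rw [← mul_add, Nat.sub_add_cancel h1.le, mul_comm]
        _ ≤ k 0 * (n - m 1) + m 0 * k 1 := by gcongr
        _ = _ := by ring
    · calc n * m 0 ≤ k 1 * m 0 := by gcongr
        _ ≤ _ := by rw [mul_comm (k 1)]; exact Nat.le_add_left _ _
  refine ⟨n - m 1, m 0, isNewtonRay_iff.2 ⟨by omega, hm0, expo 0 n, m, ?_, ⟨hn, ?_⟩, ⟨hm, ?_⟩⟩⟩
  · intro e
    rw [← e, expo_zero] at hm0
    exact absurd hm0 (lt_irrefl _)
  · intro k hk
    have : weight (n - m 1) (m 0) (expo 0 n) = n * m 0 := by simp [weight, mul_comm]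
    rw [this]; exact hle k hk
  · intro k hk
    have : weight (n - m 1) (m 0) m = n * m 0 := by
      rw [weight, mul_comm (m 0), ← add_mul, Nat.sub_add_cancel hmn.le]
    rw [this]; exact hle k hk

/-- A factor of the equation of the curve, other than `y`, passes through one of the points of the
strict transform. -/
theorem exists_newtonPoint_of_dvd {F h : FormalRing} (hF : ¬ x ∣ F) (hh : h ∣ F)
    (hu : ¬ IsUnit h) (hy : ¬ y ∣ h) : ∃ (p : NewtonPoint F) (h' : FormalRing), ¬ IsUnit h' ∧
      IsStrictTransform (p.toOrbitPoint.pullback h) h' ∧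
      ∀ g, IsStrictTransform (p.toOrbitPoint.pullback F) g → h' ∣ g := by
  have h0 : MvPowerSeries.constantCoeff h = 0 := by
    rwa [MvPowerSeries.isUnit_iff_constantCoeff, isUnit_iff_ne_zero, not_not] at hu
  obtain ⟨c, d, hray⟩ := exists_isNewtonRay h0 (fun e => hF (e.trans hh)) hy
  obtain ⟨-, c', d', -, -, -, hco, hray'⟩ := hray.exists_coprime
  obtain ⟨p, rfl, rfl, h', hst, h'0⟩ := exists_orbitPoint hray' hco
  have hF0 : F ≠ 0 := by rintro rfl; exact hF (dvd_zero _)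
  obtain ⟨m, hm⟩ := exists_isMinimal hF0 p.c p.d
  obtain ⟨g, hg, -⟩ := p.exists_strictTransform hm
  have hd : ∀ g, IsStrictTransform (p.pullback F) g → h' ∣ g := fun g hg =>
    hg.dvd hst (map_dvd p.pullback hh)
  have hg0 : MvPowerSeries.constantCoeff g = 0 := by
    obtain ⟨k, hk⟩ := hd g hg
    rw [hk, map_mul, h'0, zero_mul]
  exact ⟨⟨p, isNewtonRay_of_strictTransform p hg hg0, g, hg, hg0⟩, h', not_isUnit_formal h'0,
    hst, hd⟩

/-! ### Exponents and orders of coincidence along a run -/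

namespace OrbitPoint

variable (p : OrbitPoint)

/-- The exponent with respect to `x` on the lower surface, in terms of the exponent with
respect to the exceptional component through the point. -/
def lift (s : ℝ≥0∞) : ℝ≥0∞ := ((p.d : ℝ≥0∞) + s) / (p.c : ℝ≥0∞)

/-- The inverse of `OrbitPoint.lift`, extended by `0` to the exponents below the slope. -/
def descend (s : ℝ≥0∞) : ℝ≥0∞ := (p.c : ℝ≥0∞) * s - (p.d : ℝ≥0∞)

theorem c_ne_zero : (p.c : ℝ≥0∞) ≠ 0 := by exact_mod_cast p.c_pos.ne'

theorem c_ne_top : (p.c : ℝ≥0∞) ≠ ⊤ := ENNReal.natCast_ne_top _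

theorem d_ne_top : (p.d : ℝ≥0∞) ≠ ⊤ := ENNReal.natCast_ne_top _

@[simp] theorem lift_zero : p.lift 0 = p.slope := by simp [lift, slope]

@[simp] theorem lift_top : p.lift ⊤ = ⊤ := by
  rw [lift, add_top, ENNReal.top_div_of_ne_top p.c_ne_top]

theorem lift_mono : Monotone p.lift := fun a b h => by
  unfold lift; gcongr

theorem slope_le_lift (s : ℝ≥0∞) : p.slope ≤ p.lift s := by
  rw [← lift_zero]; exact p.lift_mono zero_le

@[simp] theorem descend_lift (s : ℝ≥0∞) : p.descend (p.lift s) = s := by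
  rw [descend, lift, ENNReal.mul_div_cancel p.c_ne_zero p.c_ne_top,
    ENNReal.add_sub_cancel_left p.d_ne_top]

theorem lift_injective : Function.Injective p.lift :=
  Function.LeftInverse.injective p.descend_lift

theorem lift_lt_lift {a b : ℝ≥0∞} : p.lift a < p.lift b ↔ a < b :=
  (p.lift_mono.strictMono_of_injective p.lift_injective).lt_iff_lt

theorem lift_le_lift {a b : ℝ≥0∞} : p.lift a ≤ p.lift b ↔ a ≤ b :=
  (p.lift_mono.strictMono_of_injective p.lift_injective).le_iff_le

theorem lift_min (a b : ℝ≥0∞) : p.lift (min a b) = min (p.lift a) (p.lift b) :=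
  p.lift_mono.map_min

theorem le_lift_iff {a b : ℝ≥0∞} : a ≤ p.lift b ↔ p.descend a ≤ b := by
  rw [lift, descend, tsub_le_iff_left, ENNReal.le_div_iff_mul_le (Or.inl p.c_ne_zero)
    (Or.inl p.c_ne_top), mul_comm]

theorem descend_eq_zero {s : ℝ≥0∞} (h : s ≤ p.slope) : p.descend s = 0 := by
  rw [← lift_zero, le_lift_iff] at h
  exact le_antisymm h zero_le

theorem lift_descend {s : ℝ≥0∞} (h : p.slope ≤ s) : p.lift (p.descend s) = s := by
  apply le_antisymm
  · rw [lift, descend]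
    have : (p.d : ℝ≥0∞) ≤ p.c * s := by
      rw [slope, ENNReal.div_le_iff_le_mul (Or.inl p.c_ne_zero) (Or.inl p.c_ne_top)] at h
      rwa [mul_comm]
    rw [add_tsub_cancel_of_le this, mul_comm, ENNReal.mul_div_cancel_right p.c_ne_zero p.c_ne_top]
  · rw [le_lift_iff]

theorem continuous_lift : Continuous p.lift := by
  unfold lift
  exact (ENNReal.continuous_div_const _ p.c_ne_zero).comp (continuous_const_add _)

theorem continuous_descend : Continuous p.descend := by
  unfold descend
  exact (ENNReal.continuous_sub_right _).comp (ENNReal.continuous_const_mul p.c_ne_top)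

theorem slope_ne_top : p.slope ≠ ⊤ := ENNReal.div_ne_top p.d_ne_top p.c_ne_zero

theorem lift_ne_top {s : ℝ≥0∞} (h : s ≠ ⊤) : p.lift s ≠ ⊤ :=
  fun e => h (p.lift_injective (e.trans p.lift_top.symm))

theorem lift_div {M : ℕ} (hM : 0 < M) (K : ℕ) :
    p.lift ((K : ℝ≥0∞) / M) = ((p.d * M + K : ℕ) : ℝ≥0∞) / ((p.c * M : ℕ) : ℝ≥0∞) := by
  have hM0 : (M : ℝ≥0∞) ≠ 0 := by exact_mod_cast hM.ne'
  have hMt : (M : ℝ≥0∞) ≠ ⊤ := ENNReal.natCast_ne_top _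
  have e : ((p.d * M + K : ℕ) : ℝ≥0∞) = ((p.d : ℝ≥0∞) + (K : ℝ≥0∞) / M) * M := by
    rw [add_mul, ENNReal.div_mul_cancel hM0 hMt]; push_cast; rfl
  rw [e]
  push_cast
  rw [ENNReal.mul_div_mul_right _ _ hM0 hMt, lift]

end OrbitPoint

namespace Run

section Constructors

variable {f : FormalRing} {hc : ¬ IsCross x f} {φ : FormalRing ≃ₐ[ℂ] FormalRing}
  {hφ : Associated (φ x) x} {g : NewtonPoint (φ f) → FormalRing}
  {hg : ∀ p, IsStrictTransform (p.toOrbitPoint.pullback (φ f)) (g p)} {next : ∀ p, Run (g p)}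

/-- The first cross of a run which does not stop at once. -/
def first : (step f hc φ hφ g hg next).Cross := (none : Option (Σ p, Cross (next p)))

/-- A cross considered when the algorithm is run again at the point `p`. -/
def child (p : NewtonPoint (φ f)) (i : (next p).Cross) : (step f hc φ hφ g hg next).Cross :=
  (some ⟨p, i⟩ : Option (Σ p, Cross (next p)))

theorem cross_cases {motive : (step f hc φ hφ g hg next).Cross → Prop} (h1 : motive first)
    (h2 : ∀ p i, motive (child p i)) (k : (step f hc φ hφ g hg next).Cross) : motive k := by
  change Option (Σ p, Cross (next p)) at k
  rcases k with _ | ⟨p, i⟩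
  · exact h1
  · exact h2 p i

theorem first_ne_child (p : NewtonPoint (φ f)) (i : (next p).Cross) :
    (first : (step f hc φ hφ g hg next).Cross) ≠ child p i :=
  Option.some_ne_none _ |>.symm

theorem child_injective (p : NewtonPoint (φ f)) {i j : (next p).Cross}
    (h : (child p i : (step f hc φ hφ g hg next).Cross) = child p j) : i = j := by
  have := Option.some_injective _ h
  exact eq_of_heq (Sigma.mk.inj this).2

end Constructors

/-- The exponent function on the trunk of a cross, in terms of the slope. -/
def exponent : {f : FormalRing} → (r : Run f) → r.Cross → ℝ≥0∞ → ℝ≥0∞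
  | _, halt _ _ => fun _ s => s
  | _, step _ _ _ _ _ _ next => fun (k : Option (Σ p, Cross (next p))) s =>
      match k with
      | none => s
      | some ⟨p, i⟩ => p.toOrbitPoint.lift (exponent (next p) i s)

open Classical in
/-- The order of coincidence of the images of the branches `B_i` and `B_j`, as predicted by the
combinatorics of the run; it is `∞` for `i = j`. -/
def coin : {f : FormalRing} → (r : Run f) → r.Cross → r.Cross → ℝ≥0∞
  | _, halt _ _ => fun _ _ => ⊤
  | _, step _ _ _ _ _ _ next => fun (k l : Option (Σ p, Cross (next p))) =>
      match k, l with
      | none, none => ⊤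
      | none, some ⟨q, _⟩ => q.toOrbitPoint.slope
      | some ⟨p, _⟩, none => p.toOrbitPoint.slope
      | some ⟨p, i⟩, some ⟨q, j⟩ =>
          if h : p = q then q.toOrbitPoint.lift (coin (next q) (h ▸ i) j)
          else min p.toOrbitPoint.slope q.toOrbitPoint.slope

/-- The number of exceptional components over which a cross was created. -/
def depth : {f : FormalRing} → (r : Run f) → r.Cross → ℕ
  | _, halt _ _ => fun _ => 0
  | _, step _ _ _ _ _ _ next => fun (k : Option (Σ p, Cross (next p))) =>
      match k with
      | none => 0
      | some ⟨p, i⟩ => depth (next p) i + 1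

section Equations

variable {f : FormalRing} {hc : ¬ IsCross x f} {φ : FormalRing ≃ₐ[ℂ] FormalRing}
  {hφ : Associated (φ x) x} {g : NewtonPoint (φ f) → FormalRing}
  {hg : ∀ p, IsStrictTransform (p.toOrbitPoint.pullback (φ f)) (g p)} {next : ∀ p, Run (g p)}

@[simp] theorem exponent_first (s : ℝ≥0∞) :
    (step f hc φ hφ g hg next).exponent first s = s := by
  rw [exponent]; rfl

@[simp] theorem exponent_child (p : NewtonPoint (φ f)) (i : (next p).Cross) (s : ℝ≥0∞) :
    (step f hc φ hφ g hg next).exponent (child p i) s =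
      p.toOrbitPoint.lift ((next p).exponent i s) := by
  rw [exponent]; rfl

@[simp] theorem coin_first_first : (step f hc φ hφ g hg next).coin first first = ⊤ := by
  rw [coin]; rfl

@[simp] theorem coin_first_child (p : NewtonPoint (φ f)) (i : (next p).Cross) :
    (step f hc φ hφ g hg next).coin first (child p i) = p.toOrbitPoint.slope := by
  rw [coin]; rfl

@[simp] theorem coin_child_first (p : NewtonPoint (φ f)) (i : (next p).Cross) :
    (step f hc φ hφ g hg next).coin (child p i) first = p.toOrbitPoint.slope := by
  rw [coin]; rfl

@[simp] theorem coin_child_child_self (p : NewtonPoint (φ f)) (i j : (next p).Cross) :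
    (step f hc φ hφ g hg next).coin (child p i) (child p j) =
      p.toOrbitPoint.lift ((next p).coin i j) := by
  rw [coin]
  exact dif_pos rfl

theorem coin_child_child_of_ne {p q : NewtonPoint (φ f)} (h : p ≠ q) (i : (next p).Cross)
    (j : (next q).Cross) : (step f hc φ hφ g hg next).coin (child p i) (child q j) =
      min p.toOrbitPoint.slope q.toOrbitPoint.slope := by
  rw [coin]
  exact dif_neg h

@[simp] theorem slopes_first :
    (step f hc φ hφ g hg next).slopes first = newtonSlopes (φ f) := by
  rw [slopes]; rfl

@[simp] theorem slopes_child (p : NewtonPoint (φ f)) (i : (next p).Cross) :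
    (step f hc φ hφ g hg next).slopes (child p i) = (next p).slopes i := by
  rw [slopes]; rfl

@[simp] theorem parent_first : (step f hc φ hφ g hg next).parent first = none := by
  rw [parent]; rfl

theorem parent_child_of_none {p : NewtonPoint (φ f)} {i : (next p).Cross}
    (h : (next p).parent i = none) : (step f hc φ hφ g hg next).parent (child p i) =
      some (first, p.toOrbitPoint.slope) := by
  rw [parent]
  simp only [child, first]
  rw [h]

theorem parent_child_of_some {p : NewtonPoint (φ f)} {i j : (next p).Cross} {s : ℝ≥0∞}
    (h : (next p).parent i = some (j, s)) : (step f hc φ hφ g hg next).parent (child p i) =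
      some (child p j, s) := by
  rw [parent]
  simp only [child]
  rw [h]

@[simp] theorem branchIdeal_first :
    (step f hc φ hφ g hg next).branchIdeal first = Ideal.span {φ.symm y} := by
  rw [branchIdeal]; rfl

@[simp] theorem branchIdeal_child (p : NewtonPoint (φ f)) (i : (next p).Cross) :
    (step f hc φ hφ g hg next).branchIdeal (child p i) =
      ((next p).branchIdeal i).comap (p.toOrbitPoint.pullback.comp φ.toAlgHom) := by
  rw [branchIdeal]; rfl

@[simp] theorem isChosen_first : (step f hc φ hφ g hg next).IsChosen first := by
  rw [IsChosen]; trivial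

theorem isChosen_child (p : NewtonPoint (φ f)) (i : (next p).Cross) :
    (step f hc φ hφ g hg next).IsChosen (child p i) ↔ (next p).IsChosen i := by
  rw [IsChosen]; rfl

@[simp] theorem depth_first : (step f hc φ hφ g hg next).depth first = 0 := by
  rw [depth]; rfl

@[simp] theorem depth_child (p : NewtonPoint (φ f)) (i : (next p).Cross) :
    (step f hc φ hφ g hg next).depth (child p i) = (next p).depth i + 1 := by
  rw [depth]; rfl

theorem NewtonPoint.slope_mem {F : FormalRing} (p : NewtonPoint F) :
    p.toOrbitPoint.slope ∈ newtonSlopes F :=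
  ⟨p.c, p.d, p.isNewtonRay, rfl⟩

end Equations

variable {f : FormalRing}

theorem exponent_top (r : Run f) (i : r.Cross) : r.exponent i ⊤ = ⊤ := by
  induction r with
  | halt => rfl
  | step f hc φ hφ g hg next ih =>
    induction i using cross_cases with
    | h1 => rw [exponent_first]
    | h2 p i => rw [exponent_child, ih, OrbitPoint.lift_top]

theorem continuous_exponent (r : Run f) (i : r.Cross) : Continuous (r.exponent i) := by
  induction r with
  | halt => exact continuous_id
  | step f hc φ hφ g hg next ih =>
    induction i using cross_cases with
    | h1 => exact continuous_id.congr fun s => (exponent_first s).symm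
    | h2 p i =>
      exact (p.toOrbitPoint.continuous_lift.comp (ih p i)).congr fun s => (exponent_child p i s).symm

theorem coin_self (r : Run f) (i : r.Cross) : r.coin i i = ⊤ := by
  induction r with
  | halt => rfl
  | step f hc φ hφ g hg next ih =>
    induction i using cross_cases with
    | h1 => rw [coin_first_first]
    | h2 p i => rw [coin_child_child_self, ih, OrbitPoint.lift_top]

theorem coin_comm (r : Run f) (i j : r.Cross) : r.coin i j = r.coin j i := by
  induction r with
  | halt => rfl
  | step f hc φ hφ g hg next ih =>
    induction i using cross_cases with
    | h1 => induction j using cross_cases <;> simp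
    | h2 p i =>
      induction j using cross_cases with
      | h1 => simp
      | h2 q j =>
        by_cases h : p = q
        · subst h; rw [coin_child_child_self, coin_child_child_self, ih]
        · rw [coin_child_child_of_ne h, coin_child_child_of_ne (Ne.symm h), min_comm]

theorem coin_ne_top (r : Run f) {i j : r.Cross} (hij : i ≠ j) : r.coin i j ≠ ⊤ := by
  induction r with
  | halt => exact absurd (Subsingleton.elim (α := Unit) i j) hij
  | step f hc φ hφ g hg next ih =>
    induction i using cross_cases with
    | h1 =>
      induction j using cross_cases with
      | h1 => exact absurd rfl hij
      | h2 q j => rw [coin_first_child]; exact OrbitPoint.slope_ne_top _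
    | h2 p i =>
      induction j using cross_cases with
      | h1 => rw [coin_child_first]; exact OrbitPoint.slope_ne_top _
      | h2 q j =>
        by_cases h : p = q
        · subst h
          rw [coin_child_child_self]
          exact OrbitPoint.lift_ne_top _ (ih p fun e => hij (by rw [e]))
        · rw [coin_child_child_of_ne h]
          exact ne_top_of_le_ne_top (OrbitPoint.slope_ne_top _) (min_le_left _ _)

/-- Orders of coincidence satisfy the ultrametric inequality. -/
theorem min_coin_le (r : Run f) (i j l : r.Cross) :
    min (r.coin i j) (r.coin j l) ≤ r.coin i l := by
  induction r with
  | halt => exact le_top (α := ℝ≥0∞)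
  | step f hc φ hφ g hg next ih =>
    have hle : ∀ (p q : NewtonPoint (φ f)) i j,
        (step f hc φ hφ g hg next).coin (child p i) (child q j) ≤ p.toOrbitPoint.slope ∨ p = q := by
      intro p q i j
      by_cases h : p = q
      · exact Or.inr h
      · left; rw [coin_child_child_of_ne h]; exact min_le_left _ _
    have hge : ∀ (p q : NewtonPoint (φ f)) i j, min p.toOrbitPoint.slope q.toOrbitPoint.slope ≤
        (step f hc φ hφ g hg next).coin (child p i) (child q j) := by
      intro p q i j
      by_cases h : p = q
      · subst h
        rw [coin_child_child_self]
        exact (min_le_left _ _).trans (OrbitPoint.slope_le_lift _ _)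
      · rw [coin_child_child_of_ne h]
    induction i using cross_cases with
    | h1 =>
      induction l using cross_cases with
      | h1 => rw [coin_self]; exact le_top
      | h2 q l =>
        induction j using cross_cases with
        | h1 => exact min_le_right _ _
        | h2 p j =>
          rcases hle q p l j with h | rfl
          · rw [coin_comm] at h
            rw [coin_first_child q l]
            exact (min_le_right _ _).trans h
          · rw [coin_first_child, coin_first_child]
            exact min_le_left _ _
    | h2 p i =>
      induction l using cross_cases with
      | h1 =>
        induction j using cross_cases with
        | h1 => exact min_le_left _ _
        | h2 q j =>
          rcases hle p q i j with h | rfl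
          · rw [coin_child_first p i]
            exact (min_le_left _ _).trans h
          · rw [coin_child_first, coin_child_first]
            exact min_le_right _ _
      | h2 q l =>
        induction j using cross_cases with
        | h1 => rw [coin_child_first, coin_first_child]; exact hge p q i l
        | h2 o j =>
          by_cases h1 : p = o
          · subst h1
            by_cases h2 : p = q
            · subst h2
              simp only [coin_child_child_self, ← OrbitPoint.lift_min, OrbitPoint.lift_le_lift]
              exact ih p i j l
            · rw [coin_child_child_of_ne h2, coin_child_child_of_ne h2]
              exact min_le_right _ _
          · by_cases h2 : o = q
            · subst h2
              rw [coin_child_child_of_ne h1, coin_child_child_of_ne h1]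
              exact min_le_left _ _
            · rw [coin_child_child_of_ne h1, coin_child_child_of_ne h2]
              refine le_trans ?_ (hge p q i l)
              exact le_min ((min_le_left _ _).trans (min_le_left _ _))
                ((min_le_right _ _).trans (min_le_right _ _))

theorem exponent_zero_of_parent_none (r : Run f) (i : r.Cross) (h : r.parent i = none) :
    r.exponent i 0 = 0 := by
  induction r with
  | halt => rfl
  | step f hc φ hφ g hg next ih =>
    induction i using cross_cases with
    | h1 => rw [exponent_first]
    | h2 p i =>
      rcases h' : (next p).parent i with _ | ⟨j, s⟩
      · rw [parent_child_of_none h'] at h; cases h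
      · rw [parent_child_of_some h'] at h; cases h

theorem eq_of_parent_none (r : Run f) {i j : r.Cross} (hi : r.parent i = none)
    (hj : r.parent j = none) : i = j := by
  induction r with
  | halt => exact Subsingleton.elim (α := Unit) i j
  | step f hc φ hφ g hg next ih =>
    have key : ∀ p i, (step f hc φ hφ g hg next).parent (child p i) ≠ none := by
      intro p i h
      rcases h' : (next p).parent i with _ | ⟨j, s⟩
      · rw [parent_child_of_none h'] at h; cases h
      · rw [parent_child_of_some h'] at h; cases h
    induction i using cross_cases with
    | h1 =>
      induction j using cross_cases with
      | h1 => rfl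
      | h2 q j => exact absurd hj (key q j)
    | h2 p i => exact absurd hi (key p i)

theorem exists_parent_none (r : Run f) : ∃ i, r.parent i = none := by
  cases r with
  | halt => exact ⟨(), rfl⟩
  | step => exact ⟨first, parent_first⟩

/-- The trunk of a cross starts at the marked point of the trunk of its parent from which it
branches off. -/
theorem of_parent_some (r : Run f) {i j : r.Cross} {s : ℝ≥0∞} (h : r.parent i = some (j, s)) :
    s ∈ r.slopes j ∧ r.exponent j s = r.exponent i 0 ∧ r.coin i j = r.exponent i 0 ∧
      r.depth j < r.depth i := by
  induction r with
  | halt => cases h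
  | step f hc φ hφ g hg next ih =>
    induction i using cross_cases with
    | h1 => rw [parent_first] at h; cases h
    | h2 p i =>
      rcases h' : (next p).parent i with _ | ⟨l, s'⟩
      · rw [parent_child_of_none h'] at h
        obtain ⟨rfl, rfl⟩ := Prod.mk.inj (Option.some.inj h)
        rw [exponent_child, exponent_zero_of_parent_none _ _ h', OrbitPoint.lift_zero,
          slopes_first, exponent_first, coin_child_first, depth_first, depth_child]
        exact ⟨NewtonPoint.slope_mem p, rfl, rfl, Nat.succ_pos _⟩
      · rw [parent_child_of_some h'] at h
        obtain ⟨rfl, rfl⟩ := Prod.mk.inj (Option.some.inj h)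
        obtain ⟨h1, h2, h3, h4⟩ := ih p h'
        rw [slopes_child, depth_child, depth_child]
        refine ⟨h1, ?_, ?_, Nat.succ_lt_succ h4⟩
        · rw [exponent_child, exponent_child, h2]
        · rw [coin_child_child_self, exponent_child, h3]

/-- The branches `B_i` and `B_j` separate at a marked point. -/
theorem exists_marked_eq_coin (r : Run f) {i j : r.Cross} (hij : i ≠ j) :
    ∃ l s, s ∈ r.slopes l ∧ r.exponent l s = r.coin i j ∧ r.coin i j ≤ r.coin i l := by
  induction r with
  | halt => exact absurd (Subsingleton.elim (α := Unit) i j) hij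
  | step f hc φ hφ g hg next ih =>
    induction i using cross_cases with
    | h1 =>
      induction j using cross_cases with
      | h1 => exact absurd rfl hij
      | h2 q j =>
        refine ⟨first, q.toOrbitPoint.slope, ?_⟩
        rw [slopes_first, exponent_first, coin_first_child, coin_first_first]
        exact ⟨NewtonPoint.slope_mem q, rfl, le_top⟩
    | h2 p i =>
      induction j using cross_cases with
      | h1 =>
        refine ⟨first, p.toOrbitPoint.slope, ?_⟩
        rw [slopes_first, exponent_first, coin_child_first]
        exact ⟨NewtonPoint.slope_mem p, rfl, le_rfl⟩
      | h2 q j =>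
        by_cases h : p = q
        · subst h
          obtain ⟨l, s, h1, h2, h3⟩ := ih p (i := i) (j := j) fun e => hij (by rw [e])
          refine ⟨child p l, s, by rwa [slopes_child], ?_, ?_⟩
          · rw [coin_child_child_self, exponent_child, h2]
          · rw [coin_child_child_self, coin_child_child_self, OrbitPoint.lift_le_lift]
            exact h3
        · rw [coin_child_child_of_ne h]
          refine ⟨first, min p.toOrbitPoint.slope q.toOrbitPoint.slope, ?_, ?_⟩
          · rw [slopes_first]
            rcases min_choice p.toOrbitPoint.slope q.toOrbitPoint.slope with e | e <;> rw [e] <;>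
              exact NewtonPoint.slope_mem _
          · rw [exponent_first, coin_child_first]
            exact ⟨rfl, min_le_left _ _⟩

/-- At each marked point in the interior of a trunk, another trunk branches off. -/
theorem exists_coin_eq_of_mem_slopes (r : Run f) {i : r.Cross} {s : ℝ≥0∞} (hs : s ∈ r.slopes i) :
    ∃ j, i ≠ j ∧ r.coin i j = r.exponent i s := by
  induction r with
  | halt => exact absurd hs (Set.notMem_empty _)
  | step f hc φ hφ g hg next ih =>
    induction i using cross_cases with
    | h1 =>
      rw [slopes_first] at hs
      obtain ⟨p, rfl⟩ := exists_newtonPoint_slope_eq hs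
      obtain ⟨j, -⟩ := exists_parent_none (next p)
      exact ⟨child p j, first_ne_child p j, by rw [coin_first_child, exponent_first]⟩
    | h2 p i =>
      rw [slopes_child] at hs
      obtain ⟨j, h1, h2⟩ := ih p hs
      refine ⟨child p j, fun e => h1 (child_injective p e), ?_⟩
      rw [coin_child_child_self, exponent_child, h2]

end Run

/-! ### Close arcs and modifications -/

theorem hasOrd_arc_orbit (p : OrbitPoint) (α : Arc) : HasOrd (α (MvPowerSeries.C p.v + y)) 0 := by
  rw [hasOrd_zero_iff, PowerSeries.isUnit_iff_constantCoeff, isUnit_iff_ne_zero,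
    constantCoeff_arc]
  simpa using p.v_ne

theorem arc_pullback_hasOrd (p : OrbitPoint) {α : Arc} {M : ℕ} (h : HasOrd (α x) M) :
    HasOrd ((α.comp p.pullback) x) (p.c * M) ∧ HasOrd ((α.comp p.pullback) y) (p.d * M) := by
  have hv := hasOrd_arc_orbit p α
  rw [AlgHom.comp_apply, AlgHom.comp_apply, p.pullback_x, p.pullback_y]
  simp only [map_mul, map_pow]
  exact ⟨by simpa using (h.pow p.c).mul (hv.pow p.γ), by simpa using (h.pow p.d).mul (hv.pow p.δ)⟩

theorem HasOrd.of_dvd_sub {F G : Series} {N K : ℕ} (hF : HasOrd F N) (hNK : N < K)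
    (h : t ^ K ∣ F - G) : HasOrd G N := by
  obtain ⟨u, hu, rfl⟩ := hF
  obtain ⟨e, rfl⟩ := Nat.exists_eq_add_of_lt hNK
  obtain ⟨w, hw⟩ := h
  refine ⟨u - t ^ (e + 1) * w, ?_, ?_⟩
  · rw [PowerSeries.isUnit_iff_constantCoeff] at hu ⊢
    simpa using hu
  · rw [mul_sub, ← mul_assoc, ← pow_add, show N + (e + 1) = N + e + 1 by ring, ← hw]
    ring

theorem Close.symm {α β : Arc} {N K : ℕ} (h : Close α β N K) : Close β α N K where
  ord_left := h.ord_right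
  ord_right := h.ord_left
  dvd_x := by rw [← dvd_neg, neg_sub]; exact h.dvd_x
  dvd_y := by rw [← dvd_neg, neg_sub]; exact h.dvd_y

/-- Closeness only depends on the germ `Z(x)`, not on the coordinates. -/
theorem Close.comp_coord {φ : FormalRing →ₐ[ℂ] FormalRing} {u : FormalRing} (hu : IsUnit u)
    (hφ : φ x = x * u) {α β : Arc} {N K : ℕ} (h : Close α β N K) :
    Close (α.comp φ) (β.comp φ) N K := by
  have hcong := arc_dvd_sub α β ((pow_dvd_pow t (Nat.le_add_left K N)).trans h.dvd_x) h.dvd_y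
  have ho : ∀ γ : Arc, HasOrd (γ x) N → HasOrd ((γ.comp φ) x) N := by
    intro γ hγ
    rw [AlgHom.comp_apply, hφ, map_mul]
    simpa using hγ.mul (hasOrd_zero_iff.2 (hu.map γ))
  refine ⟨ho α h.ord_left, ho β h.ord_right, ?_, hcong (φ y)⟩
  rw [AlgHom.comp_apply, AlgHom.comp_apply, hφ, map_mul, map_mul]
  have e : α x * α u - β x * β u = (α x - β x) * α u + β x * (α u - β u) := by ring
  rw [e]
  refine dvd_add (h.dvd_x.mul_right _) ?_
  rw [pow_add]
  exact mul_dvd_mul ((h.ord_right.dvd_iff N).2 le_rfl) (hcong u)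

/-- Newton modifications transform closeness by an affine change of exponents, after suitable
reparametrizations of the arcs. -/
theorem Close.comp_pullback (p : OrbitPoint) {α β : Arc} {M K : ℕ} (h : Close α β M K) :
    ∃ σ τ : Series →ₐ[ℂ] Series, HasOrd (σ t) 1 ∧ HasOrd (τ t) 1 ∧
      Close (σ.comp (α.comp p.pullback)) (τ.comp (β.comp p.pullback)) (p.c * M) (p.d * M + K) := by
  have hx1 := (h.ord_left.dvd_iff M).2 le_rfl
  have hx2 := (h.ord_right.dvd_iff M).2 le_rfl
  have hv : t ^ (0 + K) ∣ α (MvPowerSeries.C p.v + y) - β (MvPowerSeries.C p.v + y) := by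
    rw [zero_add, map_add, map_add, arc_C, arc_C, add_sub_add_left_eq_sub]
    exact h.dvd_y
  have key : ∀ m n : ℕ, t ^ (m * M + K) ∣ α (x ^ m * (MvPowerSeries.C p.v + y) ^ n) -
      β (x ^ m * (MvPowerSeries.C p.v + y) ^ n) := by
    intro m n
    simp only [map_mul, map_pow]
    have h1 := dvd_pow_sub_pow hx1 hx2 h.dvd_x m
    have h2 := dvd_pow_sub_pow (by simp) (by simp) hv n
    rw [mul_zero] at h2
    have := dvd_mul_sub_mul (pow_mul_dvd_pow hx1 m) (by simp) h1 h2
    simpa using this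
  obtain ⟨h1, h2⟩ := arc_pullback_hasOrd p h.ord_left
  obtain ⟨h3, h4⟩ := arc_pullback_hasOrd p h.ord_right
  have kx : t ^ (p.c * M + K) ∣ (α.comp p.pullback) x - (β.comp p.pullback) x := by
    rw [AlgHom.comp_apply, AlgHom.comp_apply, p.pullback_x]; exact key _ _
  have ky : t ^ (p.d * M + K) ∣ (α.comp p.pullback) y - (β.comp p.pullback) y := by
    rw [AlgHom.comp_apply, AlgHom.comp_apply, p.pullback_y]; exact key _ _
  obtain ⟨σ, τ, hσ, hτ, ex, ex', hst⟩ :=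
    exists_normalize_pair (Nat.mul_pos p.c_pos h.pos) h1 h3 kx
  refine ⟨σ, τ, hσ, hτ, ?_, ?_, ?_, ?_⟩
  · rw [AlgHom.comp_apply, ex]; exact hasOrd_t_pow _
  · rw [AlgHom.comp_apply, ex']; exact hasOrd_t_pow _
  · change _ ∣ σ ((α.comp p.pullback) x) - τ ((β.comp p.pullback) x)
    rw [ex, ex', sub_self]; exact dvd_zero _
  · exact dvd_map_sub_map hσ hτ hst ((h2.dvd_iff _).2 le_rfl) ky

/-- A monomial change of coordinates of determinant one is invertible on units. -/
theorem eq_of_monomial_eq {R : Type*} [CommRing R] {c d γ δ : ℕ} (hdet : c * δ = d * γ + 1)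
    {a b v w : R} (ha : IsUnit a) (hv : IsUnit v) (h1 : a ^ c * v ^ γ = b ^ c * w ^ γ)
    (h2 : a ^ d * v ^ δ = b ^ d * w ^ δ) : a = b ∧ v = w := by
  have key : ∀ a v : R, a * (a ^ d * v ^ δ) ^ γ = (a ^ c * v ^ γ) ^ δ ∧
      v * (a ^ c * v ^ γ) ^ d = (a ^ d * v ^ δ) ^ c := by
    intro a v
    constructor
    · calc a * (a ^ d * v ^ δ) ^ γ = a ^ (d * γ + 1) * v ^ (γ * δ) := by ring
        _ = (a ^ c * v ^ γ) ^ δ := by rw [← hdet]; ring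
    · calc v * (a ^ c * v ^ γ) ^ d = a ^ (c * d) * v ^ (d * γ + 1) := by ring
        _ = (a ^ d * v ^ δ) ^ c := by rw [← hdet]; ring
  constructor
  · have hu : IsUnit ((a ^ d * v ^ δ) ^ γ) := ((ha.pow d).mul (hv.pow δ)).pow γ
    refine hu.mul_right_cancel ?_
    rw [(key a v).1, h1, ← (key b w).1, h2]
  · have hu : IsUnit ((a ^ c * v ^ γ) ^ d) := ((ha.pow c).mul (hv.pow γ)).pow d
    refine hu.mul_right_cancel ?_
    rw [(key a v).2, h2, ← (key b w).2, h1]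

theorem dvd_sub_of_monomial {c d γ δ : ℕ} (hdet : c * δ = d * γ + 1) {a b v w : Series} {K : ℕ}
    (ha : IsUnit a) (hv : IsUnit v) (h1 : t ^ K ∣ a ^ c * v ^ γ - b ^ c * w ^ γ)
    (h2 : t ^ K ∣ a ^ d * v ^ δ - b ^ d * w ^ δ) : t ^ K ∣ a - b ∧ t ^ K ∣ v - w := by
  simp only [← Ideal.mem_span_singleton, ← Ideal.Quotient.mk_eq_mk_iff_sub_mem] at h1 h2 ⊢
  simp only [map_mul, map_pow] at h1 h2
  exact eq_of_monomial_eq hdet (ha.map _) (hv.map _) h1 h2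

/-- Closeness of the images by the modification, beyond the slope of the exceptional component,
comes from the arcs upstairs. -/
theorem Close.of_comp_pullback {p q : OrbitPoint} (hc : p.c = q.c) (hd : p.d = q.d)
    (hγ : p.γ = q.γ) (hδ : p.δ = q.δ) {α β : Arc} {M N K : ℕ} (hα : HasOrd (α x) M)
    (hβ : HasOrd (β x) M)
    (h : Close (α.comp p.pullback) (β.comp q.pullback) N (p.d * M + K)) :
    t ^ (M + K) ∣ α x - β x ∧
      t ^ K ∣ α (MvPowerSeries.C p.v + y) - β (MvPowerSeries.C q.v + y) := by
  have hN : N = p.c * M := h.ord_left.unique (arc_pullback_hasOrd p hα).1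
  have hx := h.dvd_x
  have hy := h.dvd_y
  rw [AlgHom.comp_apply, AlgHom.comp_apply, p.pullback_x, q.pullback_x, ← hc, ← hγ] at hx
  rw [AlgHom.comp_apply, AlgHom.comp_apply, p.pullback_y, q.pullback_y, ← hd, ← hδ] at hy
  simp only [map_mul, map_pow] at hx hy
  obtain ⟨a, ha, ea⟩ := hα
  obtain ⟨b, hb, eb⟩ := hβ
  set v := α (MvPowerSeries.C p.v + y)
  set w := β (MvPowerSeries.C q.v + y)
  have hv : IsUnit v := hasOrd_zero_iff.1 (hasOrd_arc_orbit p α)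
  have ht : ∀ n : ℕ, (t ^ n : Series) ≠ 0 := fun n => pow_ne_zero _ PowerSeries.X_ne_zero
  have hx' : t ^ K ∣ a ^ p.c * v ^ p.γ - b ^ p.c * w ^ p.γ := by
    have e : α x ^ p.c * v ^ p.γ - β x ^ p.c * w ^ p.γ =
        t ^ (p.c * M) * (a ^ p.c * v ^ p.γ - b ^ p.c * w ^ p.γ) := by rw [ea, eb]; ring
    rw [e, hN, pow_add, mul_dvd_mul_iff_left (ht _)] at hx
    exact (pow_dvd_pow t (Nat.le_add_left K _)).trans hx
  have hy' : t ^ K ∣ a ^ p.d * v ^ p.δ - b ^ p.d * w ^ p.δ := by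
    have e : α x ^ p.d * v ^ p.δ - β x ^ p.d * w ^ p.δ =
        t ^ (p.d * M) * (a ^ p.d * v ^ p.δ - b ^ p.d * w ^ p.δ) := by rw [ea, eb]; ring
    rwa [e, pow_add, mul_dvd_mul_iff_left (ht _)] at hy
  obtain ⟨h1, h2⟩ := dvd_sub_of_monomial p.det_eq ha hv hx' hy'
  refine ⟨?_, h2⟩
  rw [ea, eb, ← mul_sub, pow_add]
  exact mul_dvd_mul_left _ h1

theorem Close.lift_pullback {p : OrbitPoint} {α β : Arc} {M N K : ℕ} (hα : HasOrd (α x) M)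
    (h : Close (α.comp p.pullback) (β.comp p.pullback) N (p.d * M + K)) : Close α β M K := by
  have hN : N = p.c * M := h.ord_left.unique (arc_pullback_hasOrd p hα).1
  have hβ0 : β x ≠ 0 := by
    intro h0
    apply h.ord_right.ne_zero
    rw [AlgHom.comp_apply, p.pullback_x, map_mul, map_pow, h0, zero_pow p.c_pos.ne', zero_mul]
  obtain ⟨M', hβ⟩ := exists_hasOrd hβ0
  have hM : M' = M := Nat.eq_of_mul_eq_mul_left p.c_pos
    (((arc_pullback_hasOrd p hβ).1.unique h.ord_right).trans hN)
  subst hM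
  obtain ⟨h1, h2⟩ := Close.of_comp_pullback rfl rfl rfl rfl hα hβ h
  refine ⟨hα, hβ, h1, ?_⟩
  simpa [arc_C] using h2

theorem OrbitPoint.coprime (p : OrbitPoint) : p.c.Coprime p.d := by
  have h := p.det_eq
  have h1 : p.c.gcd p.d ∣ p.d * p.γ + 1 := h ▸ (Nat.gcd_dvd_left _ _).mul_right _
  have h2 : p.c.gcd p.d ∣ p.d * p.γ := (Nat.gcd_dvd_right _ _).mul_right _
  exact Nat.dvd_one.1 ((Nat.dvd_add_right h2).1 h1)

theorem OrbitPoint.eq_of_dir_eq {p q : OrbitPoint} (hc : p.c = q.c) (hd : p.d = q.d) :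
    p.γ = q.γ ∧ p.δ = q.δ := by
  have h1 := p.det_eq
  have h2 := q.det_eq
  have hp := p.γ_lt
  have hq := q.γ_lt
  have hcp := p.c_pos
  have hco := p.coprime
  rw [← hc, ← hd] at h2
  rw [← hc] at hq
  have hmod : p.d * p.γ ≡ p.d * q.γ [MOD p.c] := by
    apply Nat.ModEq.add_right_cancel' 1
    rw [← h1, ← h2]
    exact (Nat.modEq_zero_iff_dvd.2 (dvd_mul_right _ _)).trans
      (Nat.modEq_zero_iff_dvd.2 (dvd_mul_right _ _)).symm
  have hγ : p.γ = q.γ := (hmod.cancel_left_of_coprime hco).eq_of_lt_of_lt hp hq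
  refine ⟨hγ, Nat.eq_of_mul_eq_mul_left hcp ?_⟩
  rw [h1, h2, hγ]

/-- The images of arcs based at different points of the exceptional components are not closer than
the slopes of these components allow. -/
theorem Close.le_of_ne {p q : OrbitPoint} (hpq : p ≠ q) {α β : Arc} {N K : ℕ} {M : ℕ}
    (hα : HasOrd (α x) M) (h : Close (α.comp p.pullback) (β.comp q.pullback) N K) :
    K ≤ p.d * M := by
  by_contra hlt
  push Not at hlt
  have hN : N = p.c * M := h.ord_left.unique (arc_pullback_hasOrd p hα).1
  have hβ0 : β x ≠ 0 := by
    intro h0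
    apply h.ord_right.ne_zero
    rw [AlgHom.comp_apply, q.pullback_x, map_mul, map_pow, h0, zero_pow q.c_pos.ne', zero_mul]
  obtain ⟨M', hβ⟩ := exists_hasOrd hβ0
  have e1 : q.c * M' = p.c * M := ((arc_pullback_hasOrd q hβ).1.unique h.ord_right).trans hN
  have e2 : q.d * M' = p.d * M := (arc_pullback_hasOrd q hβ).2.unique
    ((arc_pullback_hasOrd p hα).2.of_dvd_sub hlt h.dvd_y)
  have hM : M' = M := by
    have e3 := Nat.gcd_mul_right q.c M' q.d
    have e4 := Nat.gcd_mul_right p.c M p.d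
    rw [q.coprime.gcd_eq_one, one_mul, e1, e2] at e3
    rw [p.coprime.gcd_eq_one, one_mul] at e4
    exact e3.symm.trans e4
  subst hM
  have hM0 : 0 < M' := hβ.pos (by simp [constantCoeff_arc])
  have hc : p.c = q.c := Nat.eq_of_mul_eq_mul_right hM0 e1.symm
  have hd : p.d = q.d := Nat.eq_of_mul_eq_mul_right hM0 e2.symm
  obtain ⟨hγ, hδ⟩ := OrbitPoint.eq_of_dir_eq hc hd
  obtain ⟨k, rfl⟩ := Nat.exists_eq_add_of_lt hlt
  obtain ⟨-, h2⟩ := Close.of_comp_pullback (K := k + 1) hc hd hγ hδ hα hβ h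
  have h3 := (pow_dvd_pow t (Nat.le_add_left 1 k)).trans h2
  rw [pow_one, PowerSeries.X_dvd_iff, map_sub, constantCoeff_arc, constantCoeff_arc] at h3
  simp only [map_add, constantCoeff_y, add_zero, MvPowerSeries.constantCoeff_C] at h3
  apply hpq
  rcases p with ⟨c, d, γ, δ, v, _, _, _, _⟩
  rcases q with ⟨c', d', γ', δ', v', _, _, _, _⟩
  simp only at hc hd hγ hδ h3
  obtain rfl := hc
  obtain rfl := hd
  obtain rfl := hγ
  obtain rfl := hδ
  obtain rfl := sub_eq_zero.1 h3
  rfl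

/-- Any two arcs can be brought to a common order along `Z(x)`. -/
theorem exists_close {α β : Arc} {M N k l : ℕ} (hα : HasOrd (α x) M) (hβ : HasOrd (β x) N)
    (hk : t ^ k ∣ α y) (hl : t ^ l ∣ β y) : ∃ σ τ : Series →ₐ[ℂ] Series, σ t ≠ 0 ∧ τ t ≠ 0 ∧
      Close (σ.comp α) (τ.comp β) (M * N) (min (N * k) (M * l)) := by
  have hM : 0 < M := hα.pos (by simp [constantCoeff_arc])
  have hN : 0 < N := hβ.pos (by simp [constantCoeff_arc])
  obtain ⟨σ, hσ, eσ⟩ := exists_normalize hM hα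
  obtain ⟨τ, hτ, eτ⟩ := exists_normalize hN hβ
  have h1 := hasOrd_monoEndo one_ne_zero N hN
  have h2 := hasOrd_monoEndo one_ne_zero M hM
  have ex : ((monoEndo 1 N hN).comp σ).comp α x = t ^ (M * N) := by
    rw [AlgHom.comp_apply, AlgHom.comp_apply, eσ, monoEndo_t_pow]; simp [mul_comm]
  have ex' : ((monoEndo 1 M hM).comp τ).comp β x = t ^ (M * N) := by
    rw [AlgHom.comp_apply, AlgHom.comp_apply, eτ, monoEndo_t_pow]; simp
  refine ⟨(monoEndo 1 N hN).comp σ, (monoEndo 1 M hM).comp τ, (hσ.map h1).ne_zero,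
    (hτ.map h2).ne_zero, ?_, ?_, ?_, ?_⟩
  · rw [ex]; exact hasOrd_t_pow _
  · rw [ex']; exact hasOrd_t_pow _
  · rw [ex, ex', sub_self]; exact dvd_zero _
  · have a1 : t ^ (N * k) ∣ ((monoEndo 1 N hN).comp σ).comp α y := by
      rw [AlgHom.comp_apply, AlgHom.comp_apply]
      have := dvd_map hσ hk
      rw [one_mul] at this
      exact dvd_map h1 this
    have a2 : t ^ (M * l) ∣ ((monoEndo 1 M hM).comp τ).comp β y := by
      rw [AlgHom.comp_apply, AlgHom.comp_apply]
      have := dvd_map hτ hl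
      rw [one_mul] at this
      exact dvd_map h2 this
    exact dvd_sub ((pow_dvd_pow t (min_le_left _ _)).trans a1)
      ((pow_dvd_pow t (min_le_right _ _)).trans a2)

/-! ### The branches of a run -/

/-- A curve which forms a cross with `Z(x)` is the graph of a series. -/
theorem IsCross.exists_series {f : FormalRing} (h : IsCross x f) :
    ∃ (ζ : Series) (hζ : PowerSeries.constantCoeff ζ = 0),
      RingHom.ker (mkArc t ζ (by simp) hζ) = Ideal.span {f} := by
  rw [IsCross] at h
  have hf : f ∈ Ideal.span {x, y} := h ▸ Ideal.subset_span (by simp)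
  obtain ⟨f₁, f₂, e⟩ := Ideal.mem_span_pair.1 hf
  have hy : y ∈ Ideal.span {x, f} := h ▸ Ideal.subset_span (by simp)
  obtain ⟨a, b, e'⟩ := Ideal.mem_span_pair.1 hy
  have h₂ : IsUnit f₂ := by
    -- the linear part of `f` along `Z(x)` is read on the arc `(0, t)`
    have h1 := congrArg (mkArc 0 t (map_zero _) (by simp)) e
    have h2 := congrArg (mkArc 0 t (map_zero _) (by simp)) e'
    simp only [map_add, map_mul, mkArc_x, mkArc_y, mul_zero, zero_add] at h1 h2
    rw [← h1, ← mul_assoc] at h2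
    have h3 := mul_right_cancel₀ (b := t) PowerSeries.X_ne_zero (h2.trans (one_mul t).symm)
    have h4 := congrArg PowerSeries.constantCoeff h3
    rw [map_mul, constantCoeff_arc, constantCoeff_arc, map_one] at h4
    rw [MvPowerSeries.isUnit_iff_constantCoeff]
    exact IsUnit.of_mul_eq_one_right _ h4
  obtain ⟨ζ, hζ, h0⟩ := exists_implicit (f := f) (f₁ := f₁) (f₂ := f₂) (by rw [← e]; ring) h₂
  refine ⟨ζ, hζ, ?_⟩
  obtain ⟨k, hk⟩ := (mkArc_eq_zero_iff ζ hζ f).1 h0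
  have hku : IsUnit k := by
    have h1 := congrArg (mkArc 0 t (map_zero _) (by simp)) e
    have h2 := congrArg (mkArc 0 t (map_zero _) (by simp)) hk
    have h3 : mkArc 0 t (map_zero _) (by simp) (inX ζ) = 0 := by
      obtain ⟨ζ₁, e₁⟩ := exists_eq_const_add_series ζ
      rw [e₁, hζ, map_zero, zero_add, map_mul, inX_t, map_mul, mkArc_x, zero_mul]
    rw [map_mul, map_sub, h3, mkArc_y, sub_zero] at h2
    simp only [map_add, map_mul, mkArc_x, mkArc_y, mul_zero, zero_add] at h1
    rw [← h1, mul_comm] at h2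
    have h4 := mul_left_cancel₀ (a := t) PowerSeries.X_ne_zero h2
    have h5 := (h₂.map (mkArc 0 t (map_zero _) (by simp)))
    rw [h4] at h5
    rw [PowerSeries.isUnit_iff_constantCoeff, constantCoeff_arc] at h5
    rwa [MvPowerSeries.isUnit_iff_constantCoeff]
  ext F
  rw [RingHom.mem_ker, Ideal.mem_span_singleton, mkArc_eq_zero_iff, hk, hku.mul_right_dvd]

namespace Run

/-- A parametrization of the image `Z(branchIdeal i)` of the branch `B_i`. -/
def arc : {f : FormalRing} → (r : Run f) → r.Cross → Arc
  | _, halt _ h => fun _ => mkArc t h.exists_series.choose (by simp)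
      h.exists_series.choose_spec.choose
  | _, step _ _ φ _ _ _ next => fun (k : Option (Σ p, Cross (next p))) =>
      match k with
      | none => (mkArc t 0 (by simp) (map_zero _)).comp φ.toAlgHom
      | some ⟨p, i⟩ => (arc (next p) i).comp (p.toOrbitPoint.pullback.comp φ.toAlgHom)

section Equations

variable {f : FormalRing} {hc : ¬ IsCross x f} {φ : FormalRing ≃ₐ[ℂ] FormalRing}
  {hφ : Associated (φ x) x} {g : NewtonPoint (φ f) → FormalRing}
  {hg : ∀ p, IsStrictTransform (p.toOrbitPoint.pullback (φ f)) (g p)} {next : ∀ p, Run (g p)}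

theorem arc_halt {h : IsCross x f} (i : (halt f h).Cross) : ((halt f h).arc i) x = t ∧
    RingHom.ker ((halt f h).arc i) = Ideal.span {f} := by
  rw [arc]
  exact ⟨mkArc_x _ _ _ _, h.exists_series.choose_spec.choose_spec⟩

theorem arc_first : (step f hc φ hφ g hg next).arc first =
    (mkArc t 0 (by simp) (map_zero _)).comp φ.toAlgHom := by
  rw [arc]; rfl

theorem arc_child (p : NewtonPoint (φ f)) (i : (next p).Cross) :
    (step f hc φ hφ g hg next).arc (child p i) =
      ((next p).arc i).comp (p.toOrbitPoint.pullback.comp φ.toAlgHom) := by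
  rw [arc]; rfl

end Equations

theorem exists_unit_of_associated {φ : FormalRing ≃ₐ[ℂ] FormalRing} (hφ : Associated (φ x) x) :
    (∃ u, IsUnit u ∧ φ.toAlgHom x = x * u) ∧ ∃ u, IsUnit u ∧ φ.symm.toAlgHom x = x * u := by
  constructor
  · obtain ⟨u, hu⟩ := hφ.symm
    exact ⟨u, u.isUnit, hu.symm⟩
  · obtain ⟨u, hu⟩ := hφ
    refine ⟨φ.symm u, u.isUnit.map _, ?_⟩
    change φ.symm x = _
    rw [← hu, map_mul, AlgEquiv.symm_apply_apply, hu]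

theorem arc_x_ne_zero {f : FormalRing} (r : Run f) (i : r.Cross) : r.arc i x ≠ 0 := by
  induction r with
  | halt => rw [(arc_halt i).1]; exact PowerSeries.X_ne_zero
  | step f hc φ hφ g hg next ih =>
    obtain ⟨⟨u, hu, e⟩, -⟩ := exists_unit_of_associated hφ
    induction i using cross_cases with
    | h1 =>
      rw [arc_first, AlgHom.comp_apply, e, map_mul, mkArc_x]
      exact mul_ne_zero PowerSeries.X_ne_zero (hu.map _).ne_zero
    | h2 p i =>
      obtain ⟨M, hM⟩ := exists_hasOrd (ih p i)
      rw [arc_child, ← AlgHom.comp_assoc, AlgHom.comp_apply, e, map_mul]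
      exact mul_ne_zero (arc_pullback_hasOrd p.toOrbitPoint hM).1.ne_zero (hu.map _).ne_zero

theorem ker_arc {f : FormalRing} (r : Run f) (i : r.Cross) :
    RingHom.ker (r.arc i) = r.branchIdeal i := by
  induction r with
  | halt => exact (arc_halt i).2
  | step f hc φ hφ g hg next ih =>
    induction i using cross_cases with
    | h1 =>
      rw [arc_first, branchIdeal_first]
      ext F
      rw [RingHom.mem_ker, Ideal.mem_span_singleton, AlgHom.comp_apply, mkArc_eq_zero_iff, map_zero,
        sub_zero]
      constructor
      · intro h
        simpa using map_dvd φ.symm h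
      · intro h
        simpa using map_dvd φ h
    | h2 p i =>
      rw [arc_child, branchIdeal_child, ← ih p i]
      rfl

/-- Each branch of the curve is the image of one of the branches `B_i`. -/
theorem exists_mem_branchIdeal {f : FormalRing} (r : Run f) (hx : ¬ x ∣ f) {h : FormalRing}
    (hf : h ∣ f) (hu : ¬ IsUnit h) : ∃ i, h ∈ r.branchIdeal i := by
  induction r generalizing h with
  | halt f hcr =>
    refine ⟨(), ?_⟩
    obtain ⟨ζ, hζ, hk⟩ := hcr.exists_series
    have hp : Prime f := by
      rw [← Ideal.span_singleton_prime fun h0 : f = 0 => hx (h0 ▸ dvd_zero x), ← hk]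
      exact RingHom.ker_isPrime _
    change h ∈ Ideal.span {f}
    rw [Ideal.mem_span_singleton]
    exact (((hp.irreducible.dvd_iff).1 hf).resolve_left hu).dvd
  | step f hc φ hφ g hg next ih =>
    have hx' : ¬ x ∣ φ f := by
      intro hd
      apply hx
      have := map_dvd φ.symm (hφ.dvd_iff_dvd_left.2 hd)
      simpa using this
    by_cases hy : y ∣ φ h
    · refine ⟨first, ?_⟩
      rw [branchIdeal_first, Ideal.mem_span_singleton]
      simpa using map_dvd φ.symm hy
    · obtain ⟨p, h', h1, h2, h3⟩ := exists_newtonPoint_of_dvd hx' (map_dvd φ hf)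
        (fun hh => hu (by simpa using hh.map φ.symm)) hy
      obtain ⟨i, hi⟩ := ih p (hg p).2 (h3 _ (hg p)) h1
      refine ⟨child p i, ?_⟩
      rw [branchIdeal_child, Ideal.mem_comap]
      obtain ⟨k, hk⟩ := h2.1
      change p.toOrbitPoint.pullback (φ h) ∈ _
      rw [hk]
      exact Ideal.mul_mem_left _ _ hi

/-- If `B_i` was not chosen, it is the germ of the strict transform of the curve. -/
theorem mem_branchIdeal_of_not_isChosen {f : FormalRing} (r : Run f) (i : r.Cross)
    (hi : ¬ r.IsChosen i) : f ∈ r.branchIdeal i := by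
  induction r with
  | halt => exact Ideal.mem_span_singleton_self _
  | step f hc φ hφ g hg next ih =>
    induction i using cross_cases with
    | h1 => exact absurd isChosen_first hi
    | h2 p i =>
      rw [isChosen_child] at hi
      obtain ⟨k, hk⟩ := (hg p).1
      rw [branchIdeal_child, Ideal.mem_comap]
      change p.toOrbitPoint.pullback (φ f) ∈ _
      rw [hk]
      exact Ideal.mul_mem_left _ _ (ih p i hi)

theorem exists_prime_branchIdeal {f : FormalRing} (r : Run f) (i : r.Cross) :
    ∃ p, Prime p ∧ r.branchIdeal i = Ideal.span {p} := by
  rw [← ker_arc]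
  exact exists_prime_ker _ (arc_x_ne_zero r i)

theorem branchIdeal_mem_completion {f : FormalRing} (r : Run f) (i : r.Cross) :
    r.branchIdeal i ∈ r.completion := by
  by_cases hi : r.IsChosen i
  · exact Or.inr ⟨i, hi, rfl⟩
  · obtain ⟨p, hp, e⟩ := exists_prime_branchIdeal r i
    refine Or.inl (Or.inr ⟨p, hp, ?_, e⟩)
    rw [← Ideal.mem_span_singleton, ← e]
    exact mem_branchIdeal_of_not_isChosen r i hi

theorem branchIdeal_ne_idealL {f : FormalRing} (r : Run f) (i : r.Cross) :
    r.branchIdeal i ≠ idealL := by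
  intro h
  have : x ∈ r.branchIdeal i := h ▸ Ideal.mem_span_singleton_self x
  rw [← ker_arc, RingHom.mem_ker] at this
  exact arc_x_ne_zero r i this

theorem eq_branchIdeal_of_mem_completion {f : FormalRing} (r : Run f) (hx : ¬ x ∣ f)
    {P : Ideal FormalRing} (hP : P ∈ r.completion) (hL : P ≠ idealL) :
    ∃ i, P = r.branchIdeal i := by
  rcases hP with (hP | ⟨p, hp, hpf, rfl⟩) | ⟨i, -, rfl⟩
  · exact absurd hP hL
  · obtain ⟨i, hi⟩ := exists_mem_branchIdeal r hx hpf hp.not_isUnit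
    refine ⟨i, ?_⟩
    obtain ⟨q, hq, e⟩ := exists_prime_branchIdeal r i
    rw [e, Ideal.mem_span_singleton] at hi
    rw [e, Ideal.span_singleton_eq_span_singleton]
    exact (hq.associated_of_dvd hp hi).symm
  · exact ⟨i, rfl⟩

end Run

/-! ### Orders of coincidence of the branches of a run -/

theorem HasOrd.arc_pos {α : Arc} {M : ℕ} (h : HasOrd (α x) M) : 0 < M :=
  h.pos (by rw [constantCoeff_arc, constantCoeff_x])

theorem OrbitPoint.div_le_slope {p : OrbitPoint} {M K : ℕ} (hM : 0 < M) (h : K ≤ p.d * M) :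
    (K : ℝ≥0∞) / ((p.c * M : ℕ) : ℝ≥0∞) ≤ p.slope := by
  rw [← OrbitPoint.lift_zero]
  have := OrbitPoint.lift_div p hM 0
  rw [Nat.cast_zero, ENNReal.zero_div] at this
  rw [this]
  refine ENNReal.div_le_div_right ?_ _
  exact_mod_cast h

namespace Run

/-- The branches `B_i` and `B_j` are as close as the combinatorics of the run predicts. -/
theorem exists_close_arc {f : FormalRing} (r : Run f) {i j : r.Cross} (hij : i ≠ j) :
    ∃ (σ τ : Series →ₐ[ℂ] Series) (N K : ℕ), σ t ≠ 0 ∧ τ t ≠ 0 ∧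
      Close (σ.comp (r.arc i)) (τ.comp (r.arc j)) N K ∧ (K : ℝ≥0∞) / N = r.coin i j := by
  induction r with
  | halt => exact absurd (Subsingleton.elim (α := Unit) i j) hij
  | step f hc φ hφ g hg next ih =>
    obtain ⟨⟨u, hu, e⟩, -⟩ := exists_unit_of_associated hφ
    have hM : ∀ p i, ∃ M, 0 < M ∧ HasOrd ((next p).arc i x) M := fun p i => by
      obtain ⟨M, hM⟩ := exists_hasOrd (arc_x_ne_zero (next p) i)
      exact ⟨M, hM.arc_pos, hM⟩
    have hfirst : ∀ p i, ∃ (σ τ : Series →ₐ[ℂ] Series) (N K : ℕ), σ t ≠ 0 ∧ τ t ≠ 0 ∧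
        Close (σ.comp ((step f hc φ hφ g hg next).arc first))
          (τ.comp ((step f hc φ hφ g hg next).arc (child p i))) N K ∧
        (K : ℝ≥0∞) / N = p.toOrbitPoint.slope := by
      intro p i
      obtain ⟨M, hM0, hM⟩ := hM p i
      obtain ⟨h1, h2⟩ := arc_pullback_hasOrd p.toOrbitPoint hM
      obtain ⟨σ, τ, hσ, hτ, hcl⟩ := exists_close (α := mkArc t 0 (by simp) (map_zero _))
        (M := 1) (k := p.d * M) (by rw [mkArc_x]; exact hasOrd_t) h1
        (by rw [mkArc_y]; exact dvd_zero _) ((h2.dvd_iff _).2 le_rfl)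
      have hmin : min (p.c * M * (p.d * M)) (1 * (p.d * M)) = p.d * M + 0 := by
        rw [one_mul, add_zero, min_eq_right]
        exact Nat.le_mul_of_pos_left _ (Nat.mul_pos p.c_pos hM0)
      rw [hmin, one_mul] at hcl
      refine ⟨σ, τ, p.c * M, p.d * M + 0, hσ, hτ, ?_, ?_⟩
      · rw [arc_first, arc_child, ← AlgHom.comp_assoc, ← AlgHom.comp_assoc, ← AlgHom.comp_assoc]
        exact hcl.comp_coord hu e
      · rw [← OrbitPoint.lift_div _ hM0]; simp
    induction i using cross_cases with
    | h1 =>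
      induction j using cross_cases with
      | h1 => exact absurd rfl hij
      | h2 q j => rw [coin_first_child]; exact hfirst q j
    | h2 p i =>
      induction j using cross_cases with
      | h1 =>
        rw [coin_child_first]
        obtain ⟨σ, τ, N, K, h1, h2, h3, h4⟩ := hfirst p i
        exact ⟨τ, σ, N, K, h2, h1, h3.symm, h4⟩
      | h2 q j =>
        by_cases h : p = q
        · subst h
          obtain ⟨σ, τ, M, K, hσ, hτ, hcl, hK⟩ := ih p (i := i) (j := j) fun e => hij (by rw [e])
          obtain ⟨σ', τ', hσ', hτ', hcl'⟩ := hcl.comp_pullback p.toOrbitPoint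
          obtain ⟨m, hm⟩ := exists_hasOrd hσ
          obtain ⟨n, hn⟩ := exists_hasOrd hτ
          refine ⟨σ'.comp σ, τ'.comp τ, p.c * M, p.d * M + K, (hm.map hσ').ne_zero, (hn.map hτ').ne_zero, ?_, ?_⟩
          · rw [arc_child, arc_child]
            exact hcl'.comp_coord hu e
          · rw [coin_child_child_self, ← hK, OrbitPoint.lift_div _ hcl.pos]
        · rw [coin_child_child_of_ne h]
          obtain ⟨M, hM0, hM1⟩ := hM p i
          obtain ⟨M', hM0', hM1'⟩ := hM q j
          obtain ⟨h1, h2⟩ := arc_pullback_hasOrd p.toOrbitPoint hM1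
          obtain ⟨h3, h4⟩ := arc_pullback_hasOrd q.toOrbitPoint hM1'
          obtain ⟨σ, τ, hσ, hτ, hcl⟩ := exists_close h1 h3 ((h2.dvd_iff _).2 le_rfl)
            ((h4.dvd_iff _).2 le_rfl)
          refine ⟨σ, τ, p.c * M * (q.c * M'), min (q.c * M' * (p.d * M)) (p.c * M * (q.d * M')),
            hσ, hτ, ?_, ?_⟩
          · rw [arc_child, arc_child]
            exact hcl.comp_coord hu e
          · have e1 : p.toOrbitPoint.slope = ((q.c * M' * (p.d * M) : ℕ) : ℝ≥0∞) /
                ((p.c * M * (q.c * M') : ℕ) : ℝ≥0∞) := by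
              rw [← OrbitPoint.lift_zero]
              have := OrbitPoint.lift_div p.toOrbitPoint (M := M * (q.c * M'))
                (Nat.mul_pos hM0 (Nat.mul_pos q.c_pos hM0')) 0
              rw [Nat.cast_zero, ENNReal.zero_div] at this
              rw [this]
              congr 2 <;> ring
            have e2 : q.toOrbitPoint.slope = ((p.c * M * (q.d * M') : ℕ) : ℝ≥0∞) /
                ((p.c * M * (q.c * M') : ℕ) : ℝ≥0∞) := by
              rw [← OrbitPoint.lift_zero]
              have := OrbitPoint.lift_div q.toOrbitPoint (M := M' * (p.c * M))
                (Nat.mul_pos hM0' (Nat.mul_pos p.c_pos hM0)) 0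
              rw [Nat.cast_zero, ENNReal.zero_div] at this
              rw [this]
              congr 2 <;> ring
            have hmono : Monotone fun k : ℕ =>
                (k : ℝ≥0∞) / ((p.c * M * (q.c * M') : ℕ) : ℝ≥0∞) := fun a b h =>
              ENNReal.div_le_div_right (by exact_mod_cast h) _
            rw [e1, e2, min_comm]
            refine (hmono.map_min (a := p.c * M * (q.d * M')) (b := q.c * M' * (p.d * M))).symm ▸ ?_
            rw [min_comm]

/-- Reparametrizations of the branches `B_i` and `B_j` are not closer than the combinatorics of the
run predicts. -/
theorem _root_.FanEW.Close.le_coin {f : FormalRing} {r : Run f} {i j : r.Cross} (hij : i ≠ j)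
    {σ τ : Series →ₐ[ℂ] Series} {N K : ℕ}
    (h : Close (σ.comp (r.arc i)) (τ.comp (r.arc j)) N K) : (K : ℝ≥0∞) / N ≤ r.coin i j := by
  induction r generalizing σ τ N K with
  | halt => exact absurd (Subsingleton.elim (α := Unit) i j) hij
  | step f hc φ hφ g hg next ih =>
    obtain ⟨-, u, hu, e⟩ := exists_unit_of_associated hφ
    have hM : ∀ (p : NewtonPoint (φ f)) (i) {σ : Series →ₐ[ℂ] Series} {β : Arc} {N K : ℕ},
        Close ((σ.comp ((next p).arc i)).comp p.toOrbitPoint.pullback) β N K →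
        ∃ M, 0 < M ∧ HasOrd (σ.comp ((next p).arc i) x) M ∧ N = p.c * M := by
      intro p i σ β N K h
      have h0 : (σ.comp ((next p).arc i)) x ≠ 0 := by
        intro h0
        apply h.ord_left.ne_zero
        rw [AlgHom.comp_apply, p.pullback_x, map_mul, map_pow, h0, zero_pow p.c_pos.ne', zero_mul]
      obtain ⟨M, hM⟩ := exists_hasOrd h0
      exact ⟨M, hM.arc_pos, hM,
        h.ord_left.unique (arc_pullback_hasOrd _ hM).1⟩
    have hφφ : φ.toAlgHom.comp φ.symm.toAlgHom = AlgHom.id ℂ FormalRing := by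
      ext F; simp
    have hcoord : ∀ α : Arc, (α.comp φ.toAlgHom).comp φ.symm.toAlgHom = α := by
      intro α; rw [AlgHom.comp_assoc, hφφ, AlgHom.comp_id]
    have h' := h.comp_coord hu e
    have hfirst : ∀ p i {σ τ : Series →ₐ[ℂ] Series} {N K : ℕ},
        Close ((σ.comp ((next p).arc i)).comp p.toOrbitPoint.pullback)
          (τ.comp (mkArc t 0 (by simp) (map_zero _))) N K →
        (K : ℝ≥0∞) / N ≤ p.toOrbitPoint.slope := by
      intro p i σ τ N K h
      obtain ⟨M, hM0, hM, rfl⟩ := hM p i h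
      refine OrbitPoint.div_le_slope hM0 ?_
      rw [← (arc_pullback_hasOrd _ hM).2.dvd_iff]
      simpa using h.dvd_y
    induction i using cross_cases with
    | h1 =>
      induction j using cross_cases with
      | h1 => exact absurd rfl hij
      | h2 q j =>
        rw [coin_first_child]
        rw [arc_first, arc_child, ← AlgHom.comp_assoc, ← AlgHom.comp_assoc, ← AlgHom.comp_assoc,
          hcoord, hcoord] at h'
        exact hfirst q j h'.symm
    | h2 p i =>
      induction j using cross_cases with
      | h1 =>
        rw [coin_child_first]
        rw [arc_first, arc_child, ← AlgHom.comp_assoc, ← AlgHom.comp_assoc, ← AlgHom.comp_assoc,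
          hcoord, hcoord] at h'
        exact hfirst p i h'
      | h2 q j =>
        rw [arc_child, arc_child, ← AlgHom.comp_assoc, ← AlgHom.comp_assoc, ← AlgHom.comp_assoc,
          ← AlgHom.comp_assoc, hcoord, hcoord] at h'
        obtain ⟨M, hM0, hM1, hN⟩ := hM p i h'
        by_cases hpq : p = q
        · subst hpq
          rw [coin_child_child_self]
          rcases le_or_gt K (p.d * M) with hK | hK
          · rw [hN]
            exact (OrbitPoint.div_le_slope hM0 hK).trans (OrbitPoint.slope_le_lift _ _)
          · obtain ⟨K', rfl⟩ := Nat.exists_eq_add_of_le hK.le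
            have := ih p (fun e => hij (by rw [e])) (h'.lift_pullback hM1)
            rw [hN, ← OrbitPoint.lift_div _ hM0]
            exact OrbitPoint.lift_mono _ this
        · rw [coin_child_child_of_ne hpq]
          obtain ⟨M', hM0', hM1', hN'⟩ := hM q j h'.symm
          have hpq' : p.toOrbitPoint ≠ q.toOrbitPoint := by
            intro e
            apply hpq
            cases p; cases q
            simp only at e
            subst e
            rfl
          refine le_min ?_ ?_
          · rw [hN]
            exact OrbitPoint.div_le_slope hM0 (h'.le_of_ne hpq' hM1)
          · rw [hN']
            exact OrbitPoint.div_le_slope hM0' (h'.symm.le_of_ne hpq'.symm hM1')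

/-- Reparametrizations of the branch `B_i` which are closer than the contact with the exceptional
component which carries it have the same leading term. -/
theorem _root_.FanEW.Close.reparam_dvd {f : FormalRing} {r : Run f} {i : r.Cross}
    {σ τ : Series →ₐ[ℂ] Series} {N K : ℕ}
    (h : Close (σ.comp (r.arc i)) (τ.comp (r.arc i)) N K) (hK : r.exponent i 0 < (K : ℝ≥0∞) / N) :
    ∃ m, HasOrd (σ t) m ∧ HasOrd (τ t) m ∧ t ^ (m + 1) ∣ σ t - τ t := by
  have base : ∀ {α : Arc} {σ τ : Series →ₐ[ℂ] Series} {N K : ℕ}, α x = t →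
      Close (σ.comp α) (τ.comp α) N K → 0 < (K : ℝ≥0∞) / N →
      ∃ m, HasOrd (σ t) m ∧ HasOrd (τ t) m ∧ t ^ (m + 1) ∣ σ t - τ t := by
    intro α σ τ N K hα h hK
    obtain ⟨h1, h2, h3, -⟩ := h
    simp only [AlgHom.comp_apply, hα] at h1 h2 h3
    refine ⟨N, h1, h2, (pow_dvd_pow t (Nat.add_le_add_left ?_ N)).trans h3⟩
    rw [Nat.one_le_iff_ne_zero]
    rintro rfl
    simp at hK
  induction r generalizing σ τ N K with
  | halt => exact base (arc_halt i).1 h hK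
  | step f hc φ hφ g hg next ih =>
    obtain ⟨-, u, hu, e⟩ := exists_unit_of_associated hφ
    have hφφ : φ.toAlgHom.comp φ.symm.toAlgHom = AlgHom.id ℂ FormalRing := by
      ext F; simp
    have hcoord : ∀ α : Arc, (α.comp φ.toAlgHom).comp φ.symm.toAlgHom = α := by
      intro α; rw [AlgHom.comp_assoc, hφφ, AlgHom.comp_id]
    have h' := h.comp_coord hu e
    induction i using cross_cases with
    | h1 =>
      rw [exponent_first] at hK
      rw [arc_first, ← AlgHom.comp_assoc, ← AlgHom.comp_assoc, hcoord, hcoord] at h'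
      exact base (mkArc_x _ _ _ _) h' hK
    | h2 p i =>
      rw [exponent_child] at hK
      rw [arc_child, ← AlgHom.comp_assoc, ← AlgHom.comp_assoc, ← AlgHom.comp_assoc,
          ← AlgHom.comp_assoc, hcoord, hcoord] at h'
      have h0 : (σ.comp ((next p).arc i)) x ≠ 0 := by
        intro h0
        apply h'.ord_left.ne_zero
        rw [AlgHom.comp_apply, p.pullback_x, map_mul, map_pow, h0, zero_pow p.c_pos.ne', zero_mul]
      obtain ⟨M, hM⟩ := exists_hasOrd h0
      have hM0 : 0 < M := hM.arc_pos
      have hN := h'.ord_left.unique (arc_pullback_hasOrd _ hM).1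
      rcases le_or_gt K (p.d * M) with hK' | hK'
      · refine absurd hK (not_lt.2 ?_)
        rw [hN]
        exact (OrbitPoint.div_le_slope hM0 hK').trans (OrbitPoint.slope_le_lift _ _)
      · obtain ⟨K', rfl⟩ := Nat.exists_eq_add_of_le hK'.le
        refine ih p (h'.lift_pullback hM) ?_
        rw [hN, ← OrbitPoint.lift_div _ hM0] at hK
        exact (OrbitPoint.lift_lt_lift _).1 hK

end Run

/-! ### Characteristic exponents of the branches of a run -/

/-- An endomorphism of `ℂ[[t]]` is determined by its leading term and by the image of one series. -/
theorem seriesEndo_eq_of_map_eq {σ τ : Series →ₐ[ℂ] Series} {S : Series} {n m : ℕ} (hn : 0 < n)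
    (hS : HasOrd S n) (hσ : HasOrd (σ t) m) (h : t ^ (m + 1) ∣ σ t - τ t) (hST : σ S = τ S) :
    σ = τ := by
  obtain ⟨u, hu, rfl⟩ := hS
  obtain ⟨c, hc, hcu⟩ := exists_root_of_unity_factor hn hu
  obtain ⟨A, rfl, hA⟩ := exists_series_root hn hc hcu.symm
  have hA1 : HasOrd (t * A) 1 := by
    refine ⟨A, ?_, by rw [pow_one]⟩
    rw [PowerSeries.isUnit_iff_constantCoeff, hA]
    exact isUnit_iff_ne_zero.2 hc
  obtain ⟨ρ', -, -, ρ, hρ, hρ'⟩ := exists_reparam hA1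
  obtain ⟨a, ha, ea⟩ := hσ
  obtain ⟨w, hw⟩ := h
  have eb : τ t = t ^ m * (a - t * w) := by
    rw [mul_sub, ← ea, ← mul_assoc, ← pow_succ, ← hw]; ring
  have ht : ∀ k : ℕ, (t ^ k : Series) ≠ 0 := fun k => pow_ne_zero _ PowerSeries.X_ne_zero
  have key : a * σ A = (a - t * w) * τ A := by
    rw [← sub_eq_zero]
    refine eq_zero_of_forall_dvd fun K => dvd_sub_of_pow_sub hn ?_ ?_ ?_
    · exact ha.mul ((show IsUnit A by
        rw [PowerSeries.isUnit_iff_constantCoeff, hA]; exact isUnit_iff_ne_zero.2 hc).map σ)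
    · simp [constantCoeff_seriesEndo]
    · have e : (a * σ A) ^ n - ((a - t * w) * τ A) ^ n = 0 := by
        apply mul_left_cancel₀ (ht (m * n))
        rw [map_mul, map_mul, map_pow, map_pow, map_pow, map_pow, ea, eb] at hST
        rw [mul_zero, mul_sub, sub_eq_zero, mul_pow, mul_pow]
        rw [mul_pow, mul_pow, ← pow_mul, mul_assoc, mul_assoc] at hST
        exact hST
      rw [e]; exact dvd_zero _
  have e : σ.comp ρ = τ.comp ρ := by
    apply seriesEndo_ext
    rw [AlgHom.comp_apply, AlgHom.comp_apply, hρ, map_mul, map_mul, ea, eb, mul_assoc, mul_assoc,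
      key]
  apply seriesEndo_ext
  have := DFunLike.congr_fun e (ρ' t)
  rwa [AlgHom.comp_apply, AlgHom.comp_apply, hρ'] at this

/-- Two normalized arcs on the curves of `α₀` and `β₀` become, after a common ramification,
reparametrizations of `α₀` and `β₀`. -/
theorem exists_common_factor {α₀ β₀ : Arc} (hα₀ : α₀ x ≠ 0) (hβ₀ : β₀ x ≠ 0) {α β : Arc} {N K : ℕ}
    (hN : 0 < N) (hα : α x = t ^ N) (hβ : β x = t ^ N) (hkα : RingHom.ker α₀ ≤ RingHom.ker α)
    (hkβ : RingHom.ker β₀ ≤ RingHom.ker β) (h : t ^ K ∣ α y - β y) :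
    ∃ (M : ℕ) (μ σ τ : Series →ₐ[ℂ] Series), HasOrd (μ t) M ∧ 0 < M ∧
      σ.comp α₀ = μ.comp α ∧ τ.comp β₀ = μ.comp β ∧
      Close (σ.comp α₀) (τ.comp β₀) (M * N) (M * K) := by
  obtain ⟨m, hm, σ, hσ, e⟩ := exists_factor α₀ hα₀ hN hα hkα
  obtain ⟨n, hn, τ, hτ, e'⟩ := exists_factor β₀ hβ₀ hN hβ hkβ
  have hμ : HasOrd ((monoEndo 1 n hn).comp (monoEndo 1 m hm) t) (n * m) :=
    (hasOrd_monoEndo one_ne_zero m hm).map (hasOrd_monoEndo one_ne_zero n hn)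
  have hcomm : (monoEndo 1 n hn).comp (monoEndo 1 m hm) =
      (monoEndo 1 m hm).comp (monoEndo 1 n hn) := by
    apply seriesEndo_ext
    simp [← pow_mul, mul_comm]
  have e1 : ((monoEndo 1 n hn).comp σ).comp α₀ =
      ((monoEndo 1 n hn).comp (monoEndo 1 m hm)).comp α := by
    rw [AlgHom.comp_assoc, ← e, AlgHom.comp_assoc]
  have e2 : ((monoEndo 1 m hm).comp τ).comp β₀ =
      ((monoEndo 1 n hn).comp (monoEndo 1 m hm)).comp β := by
    rw [AlgHom.comp_assoc, ← e', hcomm, AlgHom.comp_assoc]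
  refine ⟨n * m, _, (monoEndo 1 n hn).comp σ, (monoEndo 1 m hm).comp τ, hμ, Nat.mul_pos hn hm,
    e1, e2, ?_⟩
  rw [e1, e2]
  refine Close.map ⟨?_, ?_, ?_, h⟩ hμ
  · rw [hα]; exact hasOrd_t_pow _
  · rw [hβ]; exact hasOrd_t_pow _
  · rw [hα, hβ, sub_self]; exact dvd_zero _

theorem mul_cast_div_mul_cast {M N K : ℕ} (hM : 0 < M) :
    ((M * K : ℕ) : ℝ≥0∞) / ((M * N : ℕ) : ℝ≥0∞) = (K : ℝ≥0∞) / N := by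
  push_cast
  exact ENNReal.mul_div_mul_left _ _ (by exact_mod_cast hM.ne') (ENNReal.natCast_ne_top _)

namespace Run

variable {f : FormalRing} (r : Run f)

theorem coincidence_branchIdeal {i j : r.Cross} (hij : i ≠ j) :
    coincidence (r.branchIdeal i) (r.branchIdeal j) = r.coin i j := by
  apply le_antisymm
  · refine coincidence_le fun N K α β hN hα hβ hi hj h => ?_
    rw [← ker_arc] at hi hj
    obtain ⟨M, μ, σ, τ, hμ, hM, -, -, hcl⟩ := exists_common_factor (arc_x_ne_zero r i)
      (arc_x_ne_zero r j) hN hα hβ hi hj h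
    rw [← mul_cast_div_mul_cast hM]
    exact hcl.le_coin hij
  · obtain ⟨σ, τ, N, K, hσ, hτ, hcl, e⟩ := exists_close_arc r hij
    rw [← e]
    refine hcl.le_coincidence ?_ ?_
    · rw [ker_comp_of_ne_zero _ hσ, ker_arc]
    · rw [ker_comp_of_ne_zero _ hτ, ker_arc]

theorem branchIdeal_injective : Function.Injective r.branchIdeal := by
  intro i j h
  by_contra hij
  obtain ⟨σ, n, hn, hσ, e⟩ := exists_normalize_arc (r.arc i) (arc_x_ne_zero r i)
  have htop : coincidence (r.branchIdeal i) (r.branchIdeal j) = ⊤ := by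
    refine eq_top_of_forall_nat_div_le n fun K => ?_
    refine Close.le_coincidence (α := σ.comp (r.arc i)) (β := σ.comp (r.arc i))
      ⟨?_, ?_, by rw [sub_self]; exact dvd_zero _, by rw [sub_self]; exact dvd_zero _⟩ ?_ ?_
    · rw [e]; exact hasOrd_t_pow _
    · rw [e]; exact hasOrd_t_pow _
    · rw [← ker_arc]; exact ker_le_ker_comp _ _
    · rw [← h, ← ker_arc]; exact ker_le_ker_comp _ _
  rw [coincidence_branchIdeal r hij] at htop
  exact coin_ne_top r hij htop

/-- The characteristic exponents of the image of `B_i` do not exceed the exponent of the exceptional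
component which carries `B_i`, since `B_i` is smooth and transversal to this component. -/
theorem charExponents_le {i : r.Cross} {k : ℝ≥0∞} (hk : k ∈ charExponents (r.branchIdeal i)) :
    k ≤ r.exponent i 0 := by
  by_contra hlt
  push Not at hlt
  obtain ⟨N, K, α, β, hN, hα, hβ, hi, hj, hK, rfl⟩ := mem_charExponents.1 hk
  rw [← ker_arc] at hi hj
  obtain ⟨M, μ, σ, τ, hμ, hM, eσ, eτ, hcl⟩ := exists_common_factor (arc_x_ne_zero r i)
    (arc_x_ne_zero r i) hN hα hβ hi hj ((hK.dvd_iff _).2 le_rfl)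
  rw [← mul_cast_div_mul_cast hM] at hlt
  obtain ⟨m, h1, h2, h3⟩ := hcl.reparam_dvd hlt
  obtain ⟨n, hn⟩ := exists_hasOrd (arc_x_ne_zero r i)
  have hx : σ (r.arc i x) = τ (r.arc i x) := by
    have e1 := DFunLike.congr_fun eσ x
    have e2 := DFunLike.congr_fun eτ x
    rw [AlgHom.comp_apply, AlgHom.comp_apply, hα] at e1
    rw [AlgHom.comp_apply, AlgHom.comp_apply, hβ] at e2
    rw [e1, e2]
  have hστ := seriesEndo_eq_of_map_eq hn.arc_pos hn h1 h3 hx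
  rw [hστ, eτ] at eσ
  have e3 := DFunLike.congr_fun eσ y
  rw [AlgHom.comp_apply, AlgHom.comp_apply] at e3
  apply hK.ne_zero
  rw [sub_eq_zero]
  exact (endo_injective hμ.ne_zero e3).symm

/-- Characteristic exponents below the order of coincidence of two branches are common to them. -/
theorem charExponents_of_lt_coin {i j : r.Cross} (hij : i ≠ j) {k : ℝ≥0∞}
    (hk : k ∈ charExponents (r.branchIdeal i)) (hlt : k < r.coin i j) :
    k ∈ charExponents (r.branchIdeal j) := by
  obtain ⟨N, K, α, β, hN, hα, hβ, hiα, hiβ, hK, rfl⟩ := mem_charExponents.1 hk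
  obtain ⟨σ, τ, N₁, K₁, hσ, hτ, hcl, e⟩ := exists_close_arc r hij
  obtain ⟨σ', τ', hσ', hτ', hx, hx', hy⟩ := hcl.exists_normalize
  have hN₁ := hcl.pos
  set α₁ := σ'.comp (σ.comp (r.arc i)) with hα₁
  set β₁ := τ'.comp (τ.comp (r.arc j)) with hβ₁
  replace hx : α₁ x = t ^ N₁ := hx
  replace hx' : β₁ x = t ^ N₁ := hx'
  replace hy : t ^ K₁ ∣ α₁ y - β₁ y := hy
  have hker : RingHom.ker α₁ = r.branchIdeal i := by
    rw [hα₁, ker_comp_of_ne_zero _ hσ'.ne_zero, ker_comp_of_ne_zero _ hσ, ker_arc]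
  have hker' : r.branchIdeal j ≤ RingHom.ker β₁ := by
    rw [hβ₁, ker_comp_of_ne_zero _ hτ'.ne_zero, ker_comp_of_ne_zero _ hτ, ker_arc]
  have conj : ∀ {α : Arc}, α x = t ^ N → r.branchIdeal i ≤ RingHom.ker α → ∃ γ : Arc,
      γ x = t ^ (N₁ * N) ∧ r.branchIdeal j ≤ RingHom.ker γ ∧
      t ^ (N * K₁) ∣ monoEndo 1 N₁ hN₁ (α y) - γ y := by
    intro α hα hi
    obtain ⟨ω, hω, h⟩ := exists_conj hN₁ hN hx hα (hker.trans_le hi)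
    refine ⟨(monoEndo ω N hN).comp β₁, ?_, hker'.trans (ker_le_ker_comp _ _), ?_⟩
    · rw [AlgHom.comp_apply, hx', monoEndo_t_pow, hω, map_one, one_mul, mul_comm]
    · have e := DFunLike.congr_fun h y
      rw [AlgHom.comp_apply, AlgHom.comp_apply] at e
      rw [e]
      change _ ∣ monoEndo ω N hN (α₁ y) - monoEndo ω N hN (β₁ y)
      rw [← map_sub]
      exact dvd_map (hasOrd_monoEndo (ne_zero_of_pow_eq_one hN₁ hω) N hN) hy
  obtain ⟨γ, h1, h2, h3⟩ := conj hα hiα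
  obtain ⟨γ', h1', h2', h3'⟩ := conj hβ hiβ
  have hKK : N₁ * K < N * K₁ := by
    rw [← e] at hlt
    have hn0 : (N : ℝ≥0∞) ≠ 0 := by exact_mod_cast hN.ne'
    have hn1 : (N₁ : ℝ≥0∞) ≠ 0 := by exact_mod_cast hN₁.ne'
    rw [ENNReal.lt_div_iff_mul_lt (Or.inl hn1) (Or.inl (ENNReal.natCast_ne_top _)),
      ← ENNReal.mul_div_right_comm, ENNReal.div_lt_iff (Or.inl hn0)
      (Or.inl (ENNReal.natCast_ne_top _))] at hlt
    have : K * N₁ < K₁ * N := by exact_mod_cast hlt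
    rwa [mul_comm N₁, mul_comm N]
  refine mem_charExponents.2 ⟨N₁ * N, N₁ * K, γ, γ', Nat.mul_pos hN₁ hN, h1, h1', h2, h2', ?_, ?_⟩
  · refine (hK.map (hasOrd_monoEndo one_ne_zero N₁ hN₁)).of_dvd_sub hKK ?_
    have e : monoEndo 1 N₁ hN₁ (α y - β y) - (γ y - γ' y) =
        (monoEndo 1 N₁ hN₁ (α y) - γ y) - (monoEndo 1 N₁ hN₁ (β y) - γ' y) := by
      rw [map_sub]; ring
    rw [e]
    exact dvd_sub h3 h3'
  · rw [mul_cast_div_mul_cast hN₁]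

/-- The points whose exponents are characteristic exponents are marked points of the run. -/
theorem exists_marked_eq_charExponent (i : r.Cross) {k : ℝ≥0∞}
    (hk : k ∈ charExponents (r.branchIdeal i)) :
    k = 0 ∨ ∃ l s, s ∈ r.slopes l ∧ r.exponent l s = k ∧ k ≤ r.coin i l := by
  induction hd : r.depth i using Nat.strong_induction_on generalizing i with
  | _ n ih =>
    have hle := charExponents_le r hk
    rcases hp : r.parent i with _ | ⟨j, s⟩
    · left
      rw [exponent_zero_of_parent_none r i hp] at hle
      exact le_antisymm hle zero_le
    · obtain ⟨h1, h2, h3, h4⟩ := of_parent_some r hp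
      have hij : i ≠ j := by rintro rfl; exact lt_irrefl _ h4
      rcases hle.eq_or_lt with rfl | hlt
      · exact Or.inr ⟨j, s, h1, h2, h3.ge⟩
      · rw [← h3] at hlt
        rcases ih _ (hd ▸ h4) j (charExponents_of_lt_coin r hij hk hlt) rfl with h | ⟨l, s', h5, h6, h7⟩
        · exact Or.inl h
        · exact Or.inr ⟨l, s', h5, h6, (le_min hlt.le h7).trans (min_coin_le r i j l)⟩

end Run

/-! ### The homeomorphism between the fan tree and the Eggers-Wall tree -/

namespace Run

theorem HasLabel.eq_of_branch {f : FormalRing} {r : Run f} {a b : r.Trunks} {P : Ideal FormalRing}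
    (ha : r.HasLabel a (.branch P)) (hb : r.HasLabel b (.branch P)) : a = b := by
  have key : ∀ {a : r.Trunks} {P}, r.HasLabel a (.branch P) →
      (∃ i, r.parent i = none ∧ P = idealL ∧ a = ⟨i, 0⟩) ∨ ∃ i, P = r.branchIdeal i ∧ a = ⟨i, ⊤⟩ := by
    rintro a P (⟨i, h⟩ | _ | _ | i)
    · exact Or.inl ⟨i, h, rfl, rfl⟩
    · exact Or.inr ⟨_, rfl, rfl⟩
  rcases key ha with ⟨i, hi, hP, rfl⟩ | ⟨i, hP, rfl⟩ <;>
    rcases key hb with ⟨j, hj, hQ, rfl⟩ | ⟨j, hQ, rfl⟩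
  · rw [eq_of_parent_none r hi hj]
  · exact absurd (hQ.symm.trans hP) (branchIdeal_ne_idealL r j)
  · exact absurd (hP.symm.trans hQ) (branchIdeal_ne_idealL r i)
  · rw [branchIdeal_injective r (hP.symm.trans hQ)]

theorem HasLabel.of_exceptional {f : FormalRing} {r : Run f} {a : r.Trunks} {j : r.Cross}
    {s : ℝ≥0∞} (ha : r.HasLabel a (.exceptional j s)) :
    (r.parent a.1 = some (j, s) ∧ a.2 = 0) ∨ (a = ⟨j, s⟩ ∧ s ∈ r.slopes j) := by
  rcases ha with _ | ⟨i, _, _, h⟩ | ⟨_, _, h⟩ | _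
  · exact Or.inl ⟨h, rfl⟩
  · exact Or.inr ⟨rfl, h⟩

theorem continuous_fanMk {f : FormalRing} (r : Run f) (i : r.Cross) :
    Continuous fun s => r.fanMk ⟨i, s⟩ :=
  (continuous_quot_mk (X := r.Trunks)).comp (continuous_sigmaMk (σ := fun _ : r.Cross => ℝ≥0∞))

theorem fanMk_eq_of_parent {f : FormalRing} (r : Run f) {i j : r.Cross} {s : ℝ≥0∞}
    (h : r.parent i = some (j, s)) : r.fanMk ⟨i, 0⟩ = r.fanMk ⟨j, s⟩ :=
  Quot.sound ⟨_, .start i j s h, .inner j s (of_parent_some r h).1⟩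

section Inclusion

variable {f : FormalRing} {hc : ¬ IsCross x f} {φ : FormalRing ≃ₐ[ℂ] FormalRing}
  {hφ : Associated (φ x) x} {g : NewtonPoint (φ f) → FormalRing}
  {hg : ∀ p, IsStrictTransform (p.toOrbitPoint.pullback (φ f)) (g p)} {next : ∀ p, Run (g p)}

theorem HasLabel.child {p : NewtonPoint (φ f)} {a : (next p).Trunks} {j : (next p).Cross}
    {s : ℝ≥0∞} (h : (next p).HasLabel a (.exceptional j s)) :
    (step f hc φ hφ g hg next).HasLabel ⟨child p a.1, a.2⟩ (.exceptional (child p j) s) := by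
  rcases h with _ | ⟨i, _, _, h⟩ | ⟨_, _, h⟩ | _
  · exact .start _ _ _ (parent_child_of_some h)
  · exact .inner _ _ (by rwa [slopes_child])

/-- The fan tree of the run at a point `p` of the strict transform is a part of the whole
fan tree. -/
def fanIncl (p : NewtonPoint (φ f)) : (next p).FanTree → (step f hc φ hφ g hg next).FanTree :=
  Quot.lift (fun a => fanMk _ ⟨child p a.1, a.2⟩) (by
    rintro a b ⟨l | ⟨j, s⟩, ha, hb⟩
    · rw [ha.eq_of_branch hb]
    · exact Quot.sound ⟨_, ha.child, hb.child⟩)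

theorem fanIncl_fanMk (p : NewtonPoint (φ f)) (i : (next p).Cross) (s : ℝ≥0∞) :
    fanIncl (hc := hc) (hφ := hφ) (hg := hg) p ((next p).fanMk ⟨i, s⟩) = fanMk _ ⟨child p i, s⟩ :=
  rfl

theorem continuous_fanIncl (p : NewtonPoint (φ f)) :
    Continuous (fanIncl (hc := hc) (hφ := hφ) (hg := hg) (next := next) p) :=
  continuous_quot_lift _ (continuous_sigma fun i => continuous_fanMk _ (Run.child p i))

end Inclusion

/-- The sections of the exponent function of the fan tree: `G i t` is the point of exponent `t` of
the path which goes from the root to the end labeled by the image of `B_i`. -/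
theorem exists_fanSection {f : FormalRing} (r : Run f) : ∃ G : r.Cross → ℝ≥0∞ → r.FanTree,
    (∀ i, Continuous (G i)) ∧ (∀ i s, G i (r.exponent i s) = r.fanMk ⟨i, s⟩) ∧
    (∀ i j t, t ≤ r.coin i j → G i t = G j t) ∧
    ∀ i t, ∃ j s, G i t = r.fanMk ⟨j, s⟩ ∧ r.exponent j s = t ∧ t ≤ r.coin i j := by
  induction r with
  | halt f h =>
    refine ⟨fun i t => fanMk _ ⟨i, t⟩, fun i => continuous_fanMk _ i, fun i s => rfl,
      fun i j t _ => by rw [Subsingleton.elim (α := Unit) i j], fun i t => ⟨i, t, rfl, rfl, le_top⟩⟩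
  | step f hc φ hφ g hg next ih =>
    choose G hcont hexp hcoin hrep using ih
    let r := step f hc φ hφ g hg next
    -- the path to the end of a child leaves the first trunk at the slope of `p`
    have hjoin : ∀ p i, fanIncl (hc := hc) (hφ := hφ) (hg := hg) (next := next) p (G p i 0) =
        r.fanMk ⟨first, p.toOrbitPoint.slope⟩ := by
      intro p i
      obtain ⟨j, hj⟩ := exists_parent_none (next p)
      rw [hcoin p i j 0 zero_le]
      have := hexp p j 0
      rw [exponent_zero_of_parent_none _ _ hj] at this
      rw [this, fanIncl_fanMk]
      exact fanMk_eq_of_parent _ (parent_child_of_none hj)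
    let H : r.Cross → ℝ≥0∞ → r.FanTree := fun (k : Option (Σ p, Cross (next p))) t =>
      match k with
      | none => r.fanMk ⟨first, t⟩
      | some ⟨p, i⟩ => if t ≤ p.toOrbitPoint.slope then r.fanMk ⟨first, t⟩ else
          fanIncl p (G p i (p.toOrbitPoint.descend t))
    have H1 : ∀ t, H first t = r.fanMk ⟨first, t⟩ := fun t => rfl
    have H2 : ∀ p i t, H (child p i) t = if t ≤ p.toOrbitPoint.slope then r.fanMk ⟨first, t⟩ else
        fanIncl p (G p i (p.toOrbitPoint.descend t)) := fun p i t => rfl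
    have H3 : ∀ p i t, t ≤ p.toOrbitPoint.slope → H (child p i) t = r.fanMk ⟨first, t⟩ :=
      fun p i t h => by rw [H2, if_pos h]
    have H4 : ∀ p i t, p.toOrbitPoint.slope ≤ t →
        H (child p i) t = fanIncl p (G p i (p.toOrbitPoint.descend t)) := by
      intro p i t h
      rcases h.eq_or_lt with rfl | h
      · rw [H3 p i _ le_rfl, OrbitPoint.descend_eq_zero _ le_rfl, hjoin]
      · rw [H2, if_neg h.not_ge]
    refine ⟨H, ?_, ?_, ?_, ?_⟩
    · intro i
      induction i using cross_cases with
      | h1 => exact continuous_fanMk r first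
      | h2 p i =>
        refine Continuous.if_le (continuous_fanMk r first)
          ((continuous_fanIncl p).comp ((hcont p i).comp (OrbitPoint.continuous_descend _)))
          continuous_id continuous_const ?_
        rintro t rfl
        rw [← H3 p i _ le_rfl]
        exact H4 p i _ le_rfl
    · intro i s
      induction i using cross_cases with
      | h1 => rw [exponent_first]; rfl
      | h2 p i =>
        rw [exponent_child, H4 p i _ (OrbitPoint.slope_le_lift _ _), OrbitPoint.descend_lift, hexp]
        rfl
    · intro i j t ht
      induction i using cross_cases with
      | h1 =>
        induction j using cross_cases with
        | h1 => rfl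
        | h2 q j =>
          rw [coin_first_child] at ht
          rw [H3 q j t ht, H1]
      | h2 p i =>
        induction j using cross_cases with
        | h1 =>
          rw [coin_child_first] at ht
          rw [H3 p i t ht, H1]
        | h2 q j =>
          by_cases h : p = q
          · subst h
            rw [coin_child_child_self, OrbitPoint.le_lift_iff] at ht
            rcases le_total t p.toOrbitPoint.slope with h | h
            · rw [H3 p i t h, H3 p j t h]
            · rw [H4 p i t h, H4 p j t h, hcoin p i j _ ht]
          · rw [coin_child_child_of_ne h] at ht
            rw [H3 p i t (ht.trans (min_le_left _ _)), H3 q j t (ht.trans (min_le_right _ _))]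
    · intro i t
      induction i using cross_cases with
      | h1 => exact ⟨first, t, rfl, exponent_first t, by rw [coin_first_first]; exact le_top⟩
      | h2 p i =>
        rcases le_total t p.toOrbitPoint.slope with h | h
        · exact ⟨first, t, H3 p i t h, exponent_first t, by rwa [coin_child_first]⟩
        · obtain ⟨j, s, h1, h2, h3⟩ := hrep p i (p.toOrbitPoint.descend t)
          refine ⟨child p j, s, ?_, ?_, ?_⟩
          · rw [H4 p i t h, h1, fanIncl_fanMk]
          · rw [exponent_child, h2, OrbitPoint.lift_descend _ h]
          · rwa [coin_child_child_self, OrbitPoint.le_lift_iff]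

variable {f : FormalRing} (r : Run f)

/-- The branch of the completion which is the image of `B_i`. -/
def toCompletion (i : r.Cross) : r.completion := ⟨r.branchIdeal i, branchIdeal_mem_completion r i⟩

/-- The point of exponent `s` on the segment of the image of `B_i` in the Eggers-Wall tree. -/
def ewPoint (i : r.Cross) (s : ℝ≥0∞) : EWTree r.completion :=
  ewMk ⟨r.toCompletion i, ⟨s, fun h => absurd h (branchIdeal_ne_idealL r i)⟩⟩

theorem ewPoint_eq {i j : r.Cross} {s : ℝ≥0∞} (h : s ≤ r.coin i j) :
    r.ewPoint i s = r.ewPoint j s := by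
  by_cases hij : i = j
  · rw [hij]
  · refine Quot.sound ⟨fun e => hij (branchIdeal_injective r (Subtype.ext_iff.1 e)), rfl, ?_⟩
    change s ≤ coincidence (r.branchIdeal i) (r.branchIdeal j)
    rwa [coincidence_branchIdeal r hij]

theorem continuous_ewPoint (i : r.Cross) : Continuous (r.ewPoint i) :=
  (continuous_quot_mk (X := EWSegments r.completion)).comp
    ((continuous_sigmaMk (σ := fun P : r.completion =>
      {t : ℝ≥0∞ // (P : Ideal FormalRing) = idealL → t = 0})).comp (by fun_prop))

/-- The root of the Eggers-Wall tree lies on all the segments. -/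
theorem ewMk_eq_root (i : r.Cross) {a : EWSegments r.completion} (ha : (a.2 : ℝ≥0∞) = 0) :
    ewMk a = r.ewPoint i 0 := by
  by_cases h : a.1 = r.toCompletion i
  · obtain ⟨P, s, hs⟩ := a
    simp only at h ha
    subst h
    subst ha
    rfl
  · exact Quot.sound ⟨h, ha, by rw [ha]; exact zero_le⟩

theorem exists_eq_ewPoint_of_ne (hx : ¬ x ∣ f) (a : EWSegments r.completion)
    (ha : (a.1 : Ideal FormalRing) ≠ idealL) :
    ∃ i, r.branchIdeal i = a.1 ∧ ewMk a = r.ewPoint i a.2 := by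
  obtain ⟨⟨P, hP⟩, s, hs⟩ := a
  obtain ⟨i, rfl⟩ := eq_branchIdeal_of_mem_completion r hx hP ha
  exact ⟨i, rfl, rfl⟩

theorem exists_eq_ewPoint (hx : ¬ x ∣ f) (a : EWSegments r.completion) :
    ∃ i, ewMk a = r.ewPoint i a.2 := by
  by_cases ha : (a.1 : Ideal FormalRing) = idealL
  · obtain ⟨i, -⟩ := exists_parent_none r
    exact ⟨i, by rw [a.2.2 ha]; exact ewMk_eq_root r i (a.2.2 ha)⟩
  · obtain ⟨i, -, h⟩ := exists_eq_ewPoint_of_ne r hx a ha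
    exact ⟨i, h⟩

/-- A function on the Eggers-Wall tree of the completion, given by its values on the segments of
the branches `B_i`. -/
theorem exists_ewLift (hx : ¬ x ∣ f) {X : Type*} [TopologicalSpace X] (G : r.Cross → ℝ≥0∞ → X)
    (hG : ∀ i, Continuous (G i)) (hcoin : ∀ i j t, t ≤ r.coin i j → G i t = G j t) :
    ∃ H : EWTree r.completion → X, Continuous H ∧ ∀ i t, H (r.ewPoint i t) = G i t := by
  classical
  obtain ⟨i₀, -⟩ := exists_parent_none r
  let cr : r.completion → r.Cross := fun P => if h : ∃ i, r.branchIdeal i = P then h.choose else i₀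
  have hcr : ∀ P : r.completion, (P : Ideal FormalRing) ≠ idealL → r.branchIdeal (cr P) = P := by
    intro P hP
    have h : ∃ i, r.branchIdeal i = P := by
      obtain ⟨i, hi⟩ := eq_branchIdeal_of_mem_completion r hx P.2 hP
      exact ⟨i, hi.symm⟩
    simp only [cr, dif_pos h]
    exact h.choose_spec
  have hcr' : ∀ i, cr (r.toCompletion i) = i := fun i =>
    branchIdeal_injective r (hcr _ (branchIdeal_ne_idealL r i))
  refine ⟨Quot.lift (fun a => G (cr a.1) a.2) ?_, ?_, ?_⟩
  · rintro ⟨P, s, hs⟩ ⟨Q, s', hs'⟩ ⟨hPQ, e, hle⟩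
    simp only at hPQ e hle ⊢
    subst e
    by_cases hP : (P : Ideal FormalRing) = idealL
    · rw [hs hP]; exact hcoin _ _ _ zero_le
    by_cases hQ : (Q : Ideal FormalRing) = idealL
    · rw [hs' hQ]; exact hcoin _ _ _ zero_le
    apply hcoin
    rwa [← coincidence_branchIdeal r, hcr P hP, hcr Q hQ]
    intro e
    apply hPQ
    rw [Subtype.ext_iff, ← hcr P hP, ← hcr Q hQ, e]
  · exact continuous_quot_lift _ (continuous_sigma fun P => (hG (cr P)).comp continuous_subtype_val)
  · intro i t
    change G (cr (r.toCompletion i)) t = _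
    rw [hcr']

/-- The map of trees which preserves the exponents. -/
def toEW : r.FanTree → EWTree r.completion :=
  Quot.lift (fun a => r.ewPoint a.1 (r.exponent a.1 a.2)) (by
    have key : ∀ {a : r.Trunks} {j s}, r.HasLabel a (.exceptional j s) →
        r.ewPoint a.1 (r.exponent a.1 a.2) = r.ewPoint j (r.exponent j s) := by
      rintro ⟨i, s'⟩ j s h
      rcases h.of_exceptional with ⟨h1, h2⟩ | ⟨h1, -⟩
      · obtain ⟨-, h3, h4, -⟩ := of_parent_some r h1
        simp only at h2 h3 h4 ⊢
        rw [h2, h3]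
        exact ewPoint_eq r h4.ge
      · rw [h1]
    rintro a b ⟨l | ⟨j, s⟩, ha, hb⟩
    · rw [ha.eq_of_branch hb]
    · rw [key ha, key hb])

theorem toEW_fanMk (i : r.Cross) (s : ℝ≥0∞) :
    r.toEW (r.fanMk ⟨i, s⟩) = r.ewPoint i (r.exponent i s) := rfl

theorem continuous_toEW : Continuous r.toEW :=
  continuous_quot_lift _ (continuous_sigma fun i =>
    (continuous_ewPoint r i).comp (continuous_exponent r i))

theorem exists_homeomorph (hx : ¬ x ∣ f) :
    ∃ Ψ : r.FanTree ≃ₜ EWTree r.completion, ∀ i s, Ψ (r.fanMk ⟨i, s⟩) =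
      r.ewPoint i (r.exponent i s) := by
  obtain ⟨G, hcont, hexp, hcoin, hrep⟩ := exists_fanSection r
  obtain ⟨H, hH, hHG⟩ := exists_ewLift r hx G hcont hcoin
  refine ⟨⟨⟨r.toEW, H, ?_, ?_⟩, continuous_toEW r, hH⟩, fun i s => rfl⟩
  · rintro ⟨i, s⟩
    change H (r.ewPoint i (r.exponent i s)) = _
    rw [hHG, hexp]
    rfl
  · rintro ⟨a⟩
    obtain ⟨i, hi⟩ := exists_eq_ewPoint r hx a
    change r.toEW (H (ewMk a)) = ewMk a
    obtain ⟨j, s, h1, h2, h3⟩ := hrep i a.2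
    rw [hi, hHG, h1, toEW_fanMk, h2]
    exact (ewPoint_eq r h3).symm

end Run

/-! ### Vertices and labels -/

namespace Run

variable {f : FormalRing} (r : Run f)

theorem isEWLabel_root (i : r.Cross) : IsEWLabel (r.ewPoint i 0) idealL :=
  ⟨_, rfl, Or.inl ⟨rfl, rfl⟩⟩

theorem isEWLabel_end (i : r.Cross) : IsEWLabel (r.ewPoint i ⊤) (r.branchIdeal i) :=
  ⟨_, rfl, Or.inr ⟨rfl, rfl⟩⟩

theorem isEWVertex_ramification {i j : r.Cross} (hij : i ≠ j) :
    IsEWVertex (r.ewPoint i (r.coin i j)) := by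
  refine Or.inr ⟨_, rfl, Or.inr ⟨⟨r.toCompletion j, r.coin i j, fun h =>
    absurd h (branchIdeal_ne_idealL r j)⟩, (ewPoint_eq r le_rfl).symm,
    fun e => hij (branchIdeal_injective r (Subtype.ext_iff.1 e)),
    (coincidence_branchIdeal r hij).symm⟩⟩

/-- The labeled points of the Eggers-Wall tree. -/
theorem eq_of_isEWLabel (hx : ¬ x ∣ f) {w : EWTree r.completion} {P : Ideal FormalRing}
    (h : IsEWLabel w P) : (P = idealL ∧ ∀ i, w = r.ewPoint i 0) ∨
      ∃ i, P = r.branchIdeal i ∧ w = r.ewPoint i ⊤ := by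
  obtain ⟨a, rfl, ⟨ha, rfl⟩ | ⟨ha, rfl⟩⟩ := h
  · exact Or.inl ⟨rfl, fun i => ewMk_eq_root r i ha⟩
  · have hP : (a.1 : Ideal FormalRing) ≠ idealL := by
      intro h
      rw [a.2.2 h] at ha
      exact ENNReal.zero_ne_top ha
    obtain ⟨i, hi, e⟩ := exists_eq_ewPoint_of_ne r hx a hP
    exact Or.inr ⟨i, hi.symm, by rw [e, ha]⟩

/-- The vertices of the Eggers-Wall tree are its root, its ends, and the marked points of the run. -/
theorem eq_of_isEWVertex (hx : ¬ x ∣ f) {w : EWTree r.completion} (h : IsEWVertex w) :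
    (∀ i, w = r.ewPoint i 0) ∨ (∃ i, w = r.ewPoint i ⊤) ∨
      ∃ i s, s ∈ r.slopes i ∧ w = r.ewPoint i (r.exponent i s) := by
  rcases h with ⟨P, h⟩ | ⟨a, rfl, h⟩
  · rcases eq_of_isEWLabel r hx h with ⟨-, h⟩ | ⟨i, -, h⟩
    · exact Or.inl h
    · exact Or.inr (Or.inl ⟨i, h⟩)
  by_cases ha : (a.2 : ℝ≥0∞) = 0
  · exact Or.inl fun i => ewMk_eq_root r i ha
  have hP : (a.1 : Ideal FormalRing) ≠ idealL := fun h => ha (a.2.2 h)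
  obtain ⟨i, hi, e⟩ := exists_eq_ewPoint_of_ne r hx a hP
  rw [e]
  generalize (a.2 : ℝ≥0∞) = k at h ha
  rcases h with h | ⟨b, hb, hab, h⟩
  · rw [← hi] at h
    rcases exists_marked_eq_charExponent r i h with h | ⟨l, s, h1, h2, h3⟩
    · exact absurd h ha
    · exact Or.inr (Or.inr ⟨l, s, h1, by rw [h2]; exact ewPoint_eq r h3⟩)
  · have hQ : (b.1 : Ideal FormalRing) ≠ idealL := by
      intro hQ
      rw [hQ, coincidence_comm, coincidence_idealL_left] at h
      exact ha h
    obtain ⟨j, hj, -⟩ := exists_eq_ewPoint_of_ne r hx b hQ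
    have hij : i ≠ j := by
      rintro rfl
      exact hab (Subtype.ext (hi.symm.trans hj))
    rw [← hi, ← hj, coincidence_branchIdeal r hij] at h
    obtain ⟨l, s, h1, h2, h3⟩ := exists_marked_eq_coin r hij
    refine Or.inr (Or.inr ⟨l, s, h1, ?_⟩)
    rw [h2, h]
    exact ewPoint_eq r h3

theorem isFanVertex_iff {Ψ : r.FanTree ≃ₜ EWTree r.completion}
    (hΨ : ∀ i s, Ψ (r.fanMk ⟨i, s⟩) = r.ewPoint i (r.exponent i s)) (hx : ¬ x ∣ f)
    (z : r.FanTree) : r.IsFanVertex z ↔ IsEWVertex (Ψ z) := by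
  constructor
  · have hin : ∀ i s, s ∈ r.slopes i → IsEWVertex (Ψ (r.fanMk ⟨i, s⟩)) := by
      intro i s hs
      obtain ⟨j, hij, e⟩ := exists_coin_eq_of_mem_slopes r hs
      rw [hΨ, ← e]
      exact isEWVertex_ramification r hij
    rintro ⟨a, l, ⟨i, h⟩ | ⟨i, j, s, h⟩ | ⟨i, s, h⟩ | i, rfl⟩
    · rw [hΨ, exponent_zero_of_parent_none r i h]
      exact Or.inl ⟨_, isEWLabel_root r i⟩
    · rw [fanMk_eq_of_parent r h]
      exact hin j s (of_parent_some r h).1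
    · exact hin i s h
    · rw [hΨ, exponent_top]
      exact Or.inl ⟨_, isEWLabel_end r i⟩
  · intro h
    rcases eq_of_isEWVertex r hx h with h | ⟨i, h⟩ | ⟨i, s, hs, h⟩
    · obtain ⟨i, hi⟩ := exists_parent_none r
      refine ⟨_, _, .root i hi, Ψ.injective ?_⟩
      rw [hΨ, exponent_zero_of_parent_none r i hi, h i]
    · refine ⟨_, _, .finish i, Ψ.injective ?_⟩
      rw [hΨ, exponent_top, h]
    · exact ⟨_, _, .inner i s hs, Ψ.injective (by rw [hΨ, h])⟩

theorem isFanLabel_iff {Ψ : r.FanTree ≃ₜ EWTree r.completion}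
    (hΨ : ∀ i s, Ψ (r.fanMk ⟨i, s⟩) = r.ewPoint i (r.exponent i s)) (hx : ¬ x ∣ f)
    (z : r.FanTree) (P : Ideal FormalRing) :
    r.IsFanLabel z P ↔ IsEWLabel (Ψ z) P := by
  constructor
  · rintro ⟨a, ⟨i, h⟩ | _ | _ | i, rfl⟩
    · rw [hΨ, exponent_zero_of_parent_none r i h]
      exact isEWLabel_root r i
    · rw [hΨ, exponent_top]
      exact isEWLabel_end r _
  · intro h
    rcases eq_of_isEWLabel r hx h with ⟨rfl, hw⟩ | ⟨i, rfl, hw⟩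
    · obtain ⟨i, hi⟩ := exists_parent_none r
      refine ⟨_, .root i hi, Ψ.injective ?_⟩
      rw [hΨ, exponent_zero_of_parent_none r i hi, hw i]
    · refine ⟨_, .finish i, Ψ.injective ?_⟩
      rw [hΨ, exponent_top, hw]

/-! ### Rigidity of the Eggers-Wall tree -/

theorem ewPoint_eq_iff (hx : ¬ x ∣ f) {i j : r.Cross} {s s' : ℝ≥0∞} :
    r.ewPoint i s = r.ewPoint j s' ↔ s = s' ∧ s ≤ r.coin i j := by
  constructor
  · intro h
    obtain ⟨E, -, hE⟩ := exists_ewLift r hx (fun _ s => s) (fun _ => continuous_id)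
      (fun _ _ _ _ => rfl)
    have e : s = s' := by rw [← hE i s, h, hE]
    subst e
    refine ⟨rfl, ?_⟩
    obtain ⟨ρ, -, hρ⟩ := exists_ewLift r hx (fun l s => min s (r.coin i l))
      (fun _ => by fun_prop) (fun l m t ht => by
        have h1 := min_coin_le r i l m
        have h2 := min_coin_le r i m l
        rw [coin_comm r m l] at h2
        apply le_antisymm
        · exact le_min (min_le_left _ _) (le_trans (le_min (min_le_right _ _)
            ((min_le_left _ _).trans ht)) h1)
        · exact le_min (min_le_left _ _) (le_trans (le_min (min_le_right _ _)
            ((min_le_left _ _).trans ht)) h2))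
    have := hρ i s
    rw [h, hρ, coin_self, min_top_right] at this
    exact min_eq_left_iff.1 this
  · rintro ⟨rfl, h⟩
    exact ewPoint_eq r h

theorem isOpen_ewTree_iff (hx : ¬ x ∣ f) {U : Set (EWTree r.completion)} :
    IsOpen U ↔ ∀ i, IsOpen {s | r.ewPoint i s ∈ U} := by
  constructor
  · exact fun h i => h.preimage (continuous_ewPoint r i)
  · intro h
    refine (isQuotientMap_quot_mk (X := EWSegments r.completion)).isOpen_preimage.1 ?_
    rw [isOpen_sigma_iff]
    rintro ⟨P, hP⟩
    by_cases hL : P = idealL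
    · have : Subsingleton {t : ℝ≥0∞ // ((⟨P, hP⟩ : r.completion) : Ideal FormalRing) = idealL →
          t = 0} := ⟨fun a b => Subtype.ext ((a.2 hL).trans (b.2 hL).symm)⟩
      exact isOpen_discrete _
    · obtain ⟨i, rfl⟩ := eq_branchIdeal_of_mem_completion r hx hP hL
      exact (h i).preimage continuous_subtype_val

/-- A point in the interior of the segment of `B_i` separates the root from the end of this
segment. -/
theorem exists_separation (hx : ¬ x ∣ f) (i : r.Cross) {t : ℝ≥0∞} (h0 : 0 < t) (h1 : t < ⊤) :
    ∃ U V : Set (EWTree r.completion), IsOpen U ∧ IsOpen V ∧ Disjoint U V ∧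
      U ∪ V = {r.ewPoint i t}ᶜ ∧ r.ewPoint i ⊤ ∈ U ∧ r.ewPoint i 0 ∈ V := by
  -- `U` is the set of the points of exponent greater than `t` above the given point
  let U : Set (EWTree r.completion) := {w | ∃ j s, t < s ∧ t < r.coin i j ∧ w = r.ewPoint j s}
  have hU : ∀ j s, r.ewPoint j s ∈ U ↔ t < s ∧ t < r.coin i j := by
    intro j s
    constructor
    · rintro ⟨l, s', h2, h3, e⟩
      obtain ⟨rfl, h4⟩ := (ewPoint_eq_iff r hx).1 e
      refine ⟨h2, (lt_min h3 ?_).trans_le (min_coin_le r i l j)⟩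
      rw [coin_comm]
      exact h2.trans_le h4
    · rintro ⟨h2, h3⟩
      exact ⟨j, s, h2, h3, rfl⟩
  have hz : ∀ j s, r.ewPoint j s = r.ewPoint i t ↔ s = t ∧ t ≤ r.coin i j := by
    intro j s
    rw [ewPoint_eq_iff r hx, coin_comm]
    exact ⟨fun ⟨a, b⟩ => ⟨a, a ▸ b⟩, fun ⟨a, b⟩ => ⟨a, a ▸ b⟩⟩
  have hzU : r.ewPoint i t ∉ U := by
    rw [hU]; exact fun h => lt_irrefl _ h.1
  refine ⟨U, Uᶜ \ {r.ewPoint i t}, ?_, ?_, ?_, ?_, ?_, ?_, ?_⟩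
  · rw [isOpen_ewTree_iff r hx]
    intro j
    simp only [hU]
    by_cases h : t < r.coin i j
    · simpa [h] using isOpen_lt continuous_const continuous_id
    · simp [h]
  · rw [isOpen_ewTree_iff r hx]
    intro j
    have e : {s | r.ewPoint j s ∈ Uᶜ \ {r.ewPoint i t}} =
        {s | (t < s ∧ t < r.coin i j) ∨ (s = t ∧ t ≤ r.coin i j)}ᶜ := by
      ext s
      simp only [Set.mem_sdiff, Set.mem_compl_iff, Set.mem_singleton_iff, Set.mem_ofPred_eq, hU, hz,
        not_or]
    rw [e, isOpen_compl_iff]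
    rcases lt_trichotomy t (r.coin i j) with h | h | h
    · have : {s | (t < s ∧ t < r.coin i j) ∨ (s = t ∧ t ≤ r.coin i j)} = Set.Ici t := by
        ext s
        simp only [h, h.le, and_true, Set.mem_ofPred_eq, Set.mem_Ici]
        rw [le_iff_lt_or_eq, eq_comm (a := s)]
      rw [this]; exact isClosed_Ici
    · have : {s | (t < s ∧ t < r.coin i j) ∨ (s = t ∧ t ≤ r.coin i j)} = {t} := by
        ext s
        simp [← h]
      rw [this]; exact isClosed_singleton
    · have : {s | (t < s ∧ t < r.coin i j) ∨ (s = t ∧ t ≤ r.coin i j)} = ∅ := by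
        ext s
        simp [h.not_ge, h.not_gt]
      rw [this]; exact isClosed_empty
  · exact Set.disjoint_left.2 fun w h h' => h'.1 h
  · ext w
    simp only [Set.mem_union, Set.mem_sdiff, Set.mem_compl_iff, Set.mem_singleton_iff]
    constructor
    · rintro (h | h)
      · rintro rfl; exact hzU h
      · exact h.2
    · intro h
      by_cases hw : w ∈ U
      · exact Or.inl hw
      · exact Or.inr ⟨hw, h⟩
  · rw [hU, coin_self]; exact ⟨h1, h1⟩
  · rw [Set.mem_compl_iff, hU]; exact fun h => not_lt_zero h.1
  · rw [Set.mem_singleton_iff, hz]; exact fun h => h0.ne h.1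

/-- A homeomorphism which fixes the root and the end of a segment preserves this segment. -/
theorem exists_eq_ewPoint_of_fixed (hx : ¬ x ∣ f) (h : EWTree r.completion ≃ₜ EWTree r.completion)
    (i : r.Cross) (h0 : h (r.ewPoint i 0) = r.ewPoint i 0)
    (h1 : h (r.ewPoint i ⊤) = r.ewPoint i ⊤) (t : ℝ≥0∞) :
    ∃ t', h (r.ewPoint i t) = r.ewPoint i t' := by
  rcases eq_or_ne t 0 with rfl | ht0
  · exact ⟨0, h0⟩
  rcases eq_or_ne t ⊤ with rfl | ht1
  · exact ⟨⊤, h1⟩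
  by_contra hcon
  push Not at hcon
  obtain ⟨U, V, hU, hV, hd, hUV, h2, h3⟩ :=
    exists_separation r hx i (pos_iff_ne_zero.2 ht0) (lt_top_iff_ne_top.2 ht1)
  -- the image of the segment by the inverse homeomorphism joins the two ends and avoids the point
  have hconn : IsPreconnected (Set.range fun s => h.symm (r.ewPoint i s)) :=
    isPreconnected_range (h.symm.continuous.comp (continuous_ewPoint r i))
  have hsub : (Set.range fun s => h.symm (r.ewPoint i s)) ⊆ U ∪ V := by
    rintro _ ⟨s, rfl⟩
    rw [hUV]
    intro e
    apply hcon s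
    rw [← Set.mem_singleton_iff.1 e]
    simp
  have hm1 : r.ewPoint i ⊤ ∈ Set.range fun s => h.symm (r.ewPoint i s) :=
    ⟨⊤, by simp only; rw [Homeomorph.symm_apply_eq, h1]⟩
  have hm0 : r.ewPoint i 0 ∈ Set.range fun s => h.symm (r.ewPoint i s) :=
    ⟨0, by simp only; rw [Homeomorph.symm_apply_eq, h0]⟩
  have := hconn.subset_left_of_subset_union hU hV hd hsub ⟨_, hm1, h2⟩ hm0
  exact Set.disjoint_left.1 hd this h3

/-- A homeomorphism which fixes the root and the ends fixes the ramification points. -/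
theorem ramification_fixed (hx : ¬ x ∣ f) (h : EWTree r.completion ≃ₜ EWTree r.completion)
    (h0 : ∀ i, h (r.ewPoint i 0) = r.ewPoint i 0) (h1 : ∀ i, h (r.ewPoint i ⊤) = r.ewPoint i ⊤)
    (i j : r.Cross) : h (r.ewPoint i (r.coin i j)) = r.ewPoint i (r.coin i j) := by
  obtain ⟨E, hEc, hE⟩ := exists_ewLift r hx (fun _ s => s) (fun _ => continuous_id)
    (fun _ _ _ _ => rfl)
  have key : ∀ h : EWTree r.completion ≃ₜ EWTree r.completion,
      (∀ i, h (r.ewPoint i 0) = r.ewPoint i 0) → (∀ i, h (r.ewPoint i ⊤) = r.ewPoint i ⊤) →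
      ∃ u : ℝ≥0∞ → ℝ≥0∞, (∀ t, h (r.ewPoint i t) = r.ewPoint i (u t)) ∧ StrictMono u ∧
        u (r.coin i j) ≤ r.coin i j := by
    intro h h0 h1
    choose u hu using fun t => exists_eq_ewPoint_of_fixed r hx h i (h0 i) (h1 i) t
    have huE : ∀ t, u t = E (h (r.ewPoint i t)) := fun t => by rw [hu, hE]
    have hc : Continuous u := by
      rw [funext huE]
      exact hEc.comp (h.continuous.comp (continuous_ewPoint r i))
    have hinj : Function.Injective u := by
      intro s s' e
      have := h.injective ((hu s).trans ((congrArg _ e).trans (hu s').symm))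
      exact ((ewPoint_eq_iff r hx).1 this).1
    have hu0 : u 0 = 0 := by rw [huE, h0, hE]
    refine ⟨u, hu, ?_, ?_⟩
    · refine (hc.strictMono_of_inj hinj).resolve_right fun hanti => ?_
      have := hanti (show (0 : ℝ≥0∞) < ⊤ by simp)
      rw [hu0] at this
      exact not_lt_zero this
    · obtain ⟨t', ht'⟩ := exists_eq_ewPoint_of_fixed r hx h j (h0 j) (h1 j) (r.coin i j)
      rw [← ewPoint_eq r (le_refl (r.coin i j)), hu] at ht'
      exact ((ewPoint_eq_iff r hx).1 ht').2
  obtain ⟨u, hu, hmono, hle⟩ := key h h0 h1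
  obtain ⟨v, hv, -, hle'⟩ := key h.symm (fun i => by rw [Homeomorph.symm_apply_eq, h0])
    (fun i => by rw [Homeomorph.symm_apply_eq, h1])
  have huv : u (v (r.coin i j)) = r.coin i j := by
    have := hu (v (r.coin i j))
    rw [← hv, Homeomorph.apply_symm_apply] at this
    exact ((ewPoint_eq_iff r hx).1 this).1.symm
  rw [hu, le_antisymm hle (huv.symm.le.trans (hmono.monotone hle'))]

end Run

end FanEW

end

theorem theorem5p28 (f : FanEW.FormalRing) (hf_not_unit : ¬ IsUnit f) (hf_reduced : Squarefree f)
    (hf_L : ¬ FanEW.x ∣ f) (r : FanEW.Run f) :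
    ∃! e : {z : r.FanTree // r.IsFanVertex z} ≃
        {z : FanEW.EWTree r.completion // FanEW.IsEWVertex z},
      FanEW.IsLabelIso r e := by
  obtain ⟨Ψ, hΨ⟩ := r.exists_homeomorph hf_L
  refine ⟨Ψ.toEquiv.subtypeEquiv fun z => r.isFanVertex_iff hΨ hf_L z,
    ⟨⟨Ψ, fun z => rfl⟩, fun z P => r.isFanLabel_iff hΨ hf_L z.1 P⟩, ?_⟩
  rintro e ⟨⟨Ψ', hΨ'⟩, hlabel⟩
  -- the composition of one isomorphism with the inverse of the other fixes the labeled points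
  have hfix : ∀ {w P}, FanEW.IsEWLabel w P → FanEW.IsEWLabel (Ψ' (Ψ.symm w)) P := by
    intro w P hw
    have hv : r.IsFanVertex (Ψ.symm w) := by
      rw [r.isFanVertex_iff hΨ hf_L, Homeomorph.apply_symm_apply]
      exact Or.inl ⟨P, hw⟩
    have := (hlabel ⟨Ψ.symm w, hv⟩ P).1 (by
      rw [r.isFanLabel_iff hΨ hf_L, Homeomorph.apply_symm_apply]
      exact hw)
    rwa [← hΨ'] at this
  have h0 : ∀ i, (Ψ.symm.trans Ψ') (r.ewPoint i 0) = r.ewPoint i 0 := by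
    intro i
    rcases r.eq_of_isEWLabel hf_L (hfix (r.isEWLabel_root i)) with ⟨-, h⟩ | ⟨j, h, -⟩
    · exact h i
    · exact absurd h.symm (r.branchIdeal_ne_idealL j)
  have h1 : ∀ i, (Ψ.symm.trans Ψ') (r.ewPoint i ⊤) = r.ewPoint i ⊤ := by
    intro i
    rcases r.eq_of_isEWLabel hf_L (hfix (r.isEWLabel_end i)) with ⟨h, -⟩ | ⟨j, h, h'⟩
    · exact absurd h (r.branchIdeal_ne_idealL i)
    · obtain rfl := r.branchIdeal_injective h
      exact h'
  ext z
  change (e z).1 = Ψ z.1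
  rw [← hΨ']
  have hz : (Ψ.symm.trans Ψ') (Ψ z.1) = Ψ' z.1 := by simp
  rw [← hz]
  rcases r.eq_of_isEWVertex hf_L ((r.isFanVertex_iff hΨ hf_L z.1).1 z.2) with h | ⟨i, h⟩ |
    ⟨i, s, hs, h⟩
  · obtain ⟨i, -⟩ := r.exists_parent_none
    rw [h i, h0]
  · rw [h, h1]
  · obtain ⟨j, -, hj⟩ := r.exists_coin_eq_of_mem_slopes hs
    rw [h, ← hj]
    exact r.ramification_fixed hf_L _ h0 h1 i j
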